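/- **Setting.** Let $T>0$, $r_0>0$, $H\in(\tfrac12,1)$, and let $W=(W^1,\dots,W^m)$ be independent (continuous) fractional Brownian motions on $[0,T]$ with Hurst parameter $H$ on a probability space $(\Omega,\mathcal F,P)$. For $a<b$ and $f:[a,b]\to\mathbb R^d$ put $$\|f\|_{\alpha,\infty(a,b)}=\sup_{t\in[a,b]}\Big(|f(t)|+\int_a^t\frac{|f(t)-f(s)|}{(t-s)^{\alpha+1}}\,ds\Big),$$ let $W_0^{\alpha,\infty}(a,b;\mathbb R^d)$ be the space of measurable $f$ for which this is finite, let $C^{\lambda}(a,b;\mathbb R^d)$ be the space of $\lambda$-Hölder continuous functions, and write $\|\cdot\|_{\alpha,\infty}=\|\cdot\|_{\alpha,\infty(0,T)}$. **Hypotheses.** (H1) $\sigma:[0,T]\times\mathbb R^d\to\mathbb R^{d\times m}$ is measurable, $\sigma(t,x)$ is differentiable in $x$, and there are $\beta,\delta\in(0,1]$ and, for every $N\ge0$, a constant $M_N>0$ such that for all $s,t\in[0,T]$ and $i=1,\dots,d$: $|\sigma(t,x)-\sigma(t,y)|\le M_0|x-y|$ for all $x,y\in\mathbb R^d$; $|\partial_{x_i}\sigma(t,x)-\partial_{x_i}\sigma(t,y)|\le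 M_N|x-y|^\delta$ for all $|x|,|y|\le N$; and $|\sigma(t,x)-\sigma(s,x)|+|\partial_{x_i}\sigma(t,x)-\partial_{x_i}\sigma(s,x)|\le M_0|t-s|^\beta$ for all $x\in\mathbb R^d$. (H2') $b:[0,T]\times\mathbb R^d\to\mathbb R^d$ is measurable, and there are $\rho\ge2$, $b_0\in L^\rho(0,T)$ and, for every $N\ge0$, a constant $L_N>0$ such that for all $t\in[0,T]$: $|b(t,x)-b(t,y)|\le L_N|x-y|$ for all $|x|,|y|\le N$, and $|b(t,x)|\le L_0|x|+b_0(t)$ for all $x\in\mathbb R^d$. (H3) There are $\gamma\in[0,1]$ and $K_0>0$ such that $|\sigma(t,x)|\le K_0(1+|x|^\gamma)$ for all $t\in[0,T]$, $x\in\mathbb R^d$. **Theorem.** Assume (H1) and (H2') with $\beta>1-H$ and $\delta>\frac1H-1$, and set $\alpha_0=\min\{\tfrac12,\beta,\tfrac{\delta}{1+\delta}\}$. Let $\alpha>1-H$ with $\rho\le\frac1\alpha$, and let $\eta\in W_0^{\alpha,\infty}(-r_0,0;\mathbb R^d)\cap C^{1-\alpha}(-r_0,0;\mathbb R^d)$.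 For $r\in(0,r_0]$ let $X^r$ be a process with paths almost surely in $W_0^{\alpha,\infty}(-r,T;\mathbb R^d)$ solving $$X^r(t)=\eta(0)+\int_0^t b(s,X^r(s))\,ds+\int_0^t\sigma(s,X^r(s-r))\,dW_s,\quad t\in(0,T],\qquad X^r(t)=\eta(t),\quad t\in[-r,0],$$ and let $X$ be a process with paths almost surely in $W_0^{\alpha,\infty}(0,T;\mathbb R^d)$ solving $$X(t)=\eta(0)+\int_0^t b(s,X(s))\,ds+\int_0^t\sigma(s,X(s))\,dW_s,\quad t\in[0,T],$$ where the integrals with respect to $W$ are pathwise Riemann–Stieltjes integrals. 1. If $\alpha\in(1-H,\alpha_0)$ and, for almost every $\omega$, the path $X^r(\omega,\cdot)$ solves its equation for all $r\in(0,r_0]$ simultaneously, then for $P$-almost all $\omega$ $$\lim_{r\downarrow0}\|X(\omega,\cdot)-X^r(\omega,\cdot)\|_{\alpha,\infty}=0.$$ 2. If (H3) holds and $\alpha\in\big(1-H,\ \alpha_0\vee\tfrac{2-\gamma}{4}\big)$, where $\vee$ denotes the maximum, then $$\lim_{r\downarrow0}E\big(\|X-X^r\|_{\alpha,\infty}^p\big)=0\qquad\text{for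 every }p\ge1.$$ -/

import Mathlib

open MeasureTheory ProbabilityTheory Filter Topology Set
open scoped ENNReal

namespace DelayFBM

noncomputable section

/-- The norm `‖f‖_{α,∞}` on `[a, b]`, with value `∞` when it is not finite:
`sup_{t ∈ [a,b]} ( |f t| + ∫_a^t |f t - f s| / (t - s)^(α+1) ds )`. -/
def wNorm {E : Type*} [NormedAddCommGroup E] (α a b : ℝ) (f : ℝ → E) : ℝ≥0∞ :=
  ⨆ t ∈ Icc a b,
    (‖f t‖ₑ + ∫⁻ s in Ioo a t, ‖f t - f s‖ₑ / ENNReal.ofReal ((t - s) ^ (α + 1)))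

/-- The space `W_0^{α,∞}(a, b; E)`. Only the values of `f` on `[a, b]` matter. -/
def MemW {E : Type*} [NormedAddCommGroup E] [MeasurableSpace E] (α a b : ℝ) (f : ℝ → E) : Prop :=
  Measurable (fun t : Icc a b => f t) ∧ wNorm α a b f < ∞

/-- The `lam`-Hölder norm on `[a, b]`, with value `∞` when it is not finite. -/
def holderNorm {E : Type*} [NormedAddCommGroup E] (lam a b : ℝ) (f : ℝ → E) : ℝ≥0∞ :=
  (⨆ t ∈ Icc a b, ‖f t‖ₑ) +
    ⨆ t ∈ Icc a b, ⨆ s ∈ Ico a t, ‖f t - f s‖ₑ / ENNReal.ofReal ((t - s) ^ lam)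

/-- The space `C^lam(a, b; E)` of Hölder continuous functions. -/
def MemHolder {E : Type*} [NormedAddCommGroup E] (lam a b : ℝ) (f : ℝ → E) : Prop :=
  holderNorm lam a b f < ∞

/-- The Riemann-Stieltjes integral of `f` with respect to `g` over `[a, b]` exists and equals `I`:
the sums `∑ (g (t_{i+1}) - g (t_i)) f (ξ_i)` tend to `I` as the mesh of the partition
`a = t_0 ≤ t_1 ≤ … ≤ t_n = b` tends to zero, whatever the tags `ξ_i ∈ [t_i, t_{i+1}]`. -/
def HasRSIntegral {E : Type*} [NormedAddCommGroup E] [NormedSpace ℝ E]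
    (f : ℝ → E) (g : ℝ → ℝ) (a b : ℝ) (I : E) : Prop :=
  ∀ ε > 0, ∃ κ > 0, ∀ (n : ℕ) (t ξ : ℕ → ℝ), t 0 = a → t n = b →
    (∀ i < n, t i ≤ t (i + 1)) → (∀ i < n, t (i + 1) - t i < κ) →
    (∀ i < n, ξ i ∈ Icc (t i) (t (i + 1))) →
    ‖(∑ i ∈ Finset.range n, (g (t (i + 1)) - g (t i)) • f (ξ i)) - I‖ < ε

/-- Hypothesis (H1) with exponents `β`, `δ`. The `d × m` matrix `σ t x` is given by its columns
`σ t x j`, `j : Fin m`; the constant `M N` is the `M_N` of the hypothesis. -/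
structure HypH1 {d m : ℕ} (T β δ : ℝ)
    (σ : ℝ → EuclideanSpace ℝ (Fin d) → Fin m → EuclideanSpace ℝ (Fin d)) : Prop where
  measurable : Measurable (fun p : Icc (0 : ℝ) T × EuclideanSpace ℝ (Fin d) => σ p.1 p.2)
  differentiable : ∀ t ∈ Icc 0 T, Differentiable ℝ (σ t)
  β_mem : β ∈ Ioc (0 : ℝ) 1
  δ_mem : δ ∈ Ioc (0 : ℝ) 1
  bounds : ∃ M : ℝ → ℝ, (∀ N ≥ 0, 0 < M N) ∧
    (∀ t ∈ Icc 0 T, ∀ x y, ‖σ t x - σ t y‖ ≤ M 0 * ‖x - y‖) ∧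
    (∀ N ≥ 0, ∀ t ∈ Icc 0 T, ∀ x y, ‖x‖ ≤ N → ‖y‖ ≤ N → ∀ i : Fin d,
      ‖fderiv ℝ (σ t) x (EuclideanSpace.single i 1) -
        fderiv ℝ (σ t) y (EuclideanSpace.single i 1)‖ ≤ M N * ‖x - y‖ ^ δ) ∧
    (∀ t ∈ Icc 0 T, ∀ s ∈ Icc 0 T, ∀ x, ∀ i : Fin d,
      ‖σ t x - σ s x‖ +
        ‖fderiv ℝ (σ t) x (EuclideanSpace.single i 1) -
          fderiv ℝ (σ s) x (EuclideanSpace.single i 1)‖ ≤ M 0 * |t - s| ^ β)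

/-- Hypothesis (H2') with integrability exponent `ρ`; `L N` is the constant `L_N`. -/
structure HypH2' {d : ℕ} (T ρ : ℝ)
    (b : ℝ → EuclideanSpace ℝ (Fin d) → EuclideanSpace ℝ (Fin d)) : Prop where
  measurable : Measurable (fun p : Icc (0 : ℝ) T × EuclideanSpace ℝ (Fin d) => b p.1 p.2)
  ρ_ge : 2 ≤ ρ
  bounds : ∃ (b₀ : ℝ → ℝ) (L : ℝ → ℝ),
    MemLp b₀ (ENNReal.ofReal ρ) (volume.restrict (Icc 0 T)) ∧ (∀ N ≥ 0, 0 < L N) ∧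
    (∀ N ≥ 0, ∀ t ∈ Icc 0 T, ∀ x y, ‖x‖ ≤ N → ‖y‖ ≤ N → ‖b t x - b t y‖ ≤ L N * ‖x - y‖) ∧
    (∀ t ∈ Icc 0 T, ∀ x, ‖b t x‖ ≤ L 0 * ‖x‖ + b₀ t)

/-- Hypothesis (H3) with growth exponent `γ`. -/
def HypH3 {d m : ℕ} (T γ : ℝ)
    (σ : ℝ → EuclideanSpace ℝ (Fin d) → Fin m → EuclideanSpace ℝ (Fin d)) : Prop :=
  γ ∈ Icc (0 : ℝ) 1 ∧ ∃ K₀ > 0, ∀ t ∈ Icc 0 T, ∀ x, ‖σ t x‖ ≤ K₀ * (1 + ‖x‖ ^ γ)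

/-- `W` is a (continuous) fractional Brownian motion on `[0, T]` with Hurst parameter `H`. -/
structure IsFractionalBrownianMotion {Ω : Type*} [MeasurableSpace Ω] (P : Measure Ω) (H T : ℝ)
    (W : ℝ → Ω → ℝ) : Prop where
  gaussian : IsGaussianProcess (fun (t : Icc (0 : ℝ) T) ω => W t ω) P
  mean_zero : ∀ t ∈ Icc 0 T, ∫ ω, W t ω ∂P = 0
  covariance : ∀ s ∈ Icc 0 T, ∀ t ∈ Icc 0 T,
    ∫ ω, W s ω * W t ω ∂P = (s ^ (2 * H) + t ^ (2 * H) - |t - s| ^ (2 * H)) / 2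
  continuous : ∀ᵐ ω ∂P, ContinuousOn (fun t => W t ω) (Icc 0 T)

/-- The path `x`, driven by `g = (g 1, …, g m)`, is a solution in `W_0^{α,∞}(-r, T)` of
`x t = η 0 + ∫_0^t b (s, x s) ds + ∫_0^t σ (s, x (s - r)) dg_s`, `t ∈ (0, T]`,
`x t = η t`, `t ∈ [-r, 0]`. -/
structure IsDelaySolution {d m : ℕ} (α T r : ℝ)
    (b : ℝ → EuclideanSpace ℝ (Fin d) → EuclideanSpace ℝ (Fin d))
    (σ : ℝ → EuclideanSpace ℝ (Fin d) → Fin m → EuclideanSpace ℝ (Fin d))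
    (η : ℝ → EuclideanSpace ℝ (Fin d)) (g : Fin m → ℝ → ℝ)
    (x : ℝ → EuclideanSpace ℝ (Fin d)) : Prop where
  memW : MemW α (-r) T x
  initial : ∀ t ∈ Icc (-r) 0, x t = η t
  equation : ∀ t ∈ Ioc 0 T, IntervalIntegrable (fun s => b s (x s)) volume 0 t ∧
    ∃ I : Fin m → EuclideanSpace ℝ (Fin d),
      (∀ j, HasRSIntegral (fun s => σ s (x (s - r)) j) (g j) 0 t (I j)) ∧
      x t = η 0 + (∫ s in (0 : ℝ)..t, b s (x s)) + ∑ j, I j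

/-- The path `x`, driven by `g = (g 1, …, g m)`, is a solution in `W_0^{α,∞}(0, T)` of
`x t = x₀ + ∫_0^t b (s, x s) ds + ∫_0^t σ (s, x s) dg_s`, `t ∈ [0, T]`. -/
structure IsSolution {d m : ℕ} (α T : ℝ)
    (b : ℝ → EuclideanSpace ℝ (Fin d) → EuclideanSpace ℝ (Fin d))
    (σ : ℝ → EuclideanSpace ℝ (Fin d) → Fin m → EuclideanSpace ℝ (Fin d))
    (x₀ : EuclideanSpace ℝ (Fin d)) (g : Fin m → ℝ → ℝ)
    (x : ℝ → EuclideanSpace ℝ (Fin d)) : Prop where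
  memW : MemW α 0 T x
  equation : ∀ t ∈ Icc 0 T, IntervalIntegrable (fun s => b s (x s)) volume 0 t ∧
    ∃ I : Fin m → EuclideanSpace ℝ (Fin d),
      (∀ j, HasRSIntegral (fun s => σ s (x s) j) (g j) 0 t (I j)) ∧
      x t = x₀ + (∫ s in (0 : ℝ)..t, b s (x s)) + ∑ j, I j

end

end DelayFBM

open DelayFBM

/-!
The argument is pathwise. If the driver `g` is `ν`-Hölder with constant `G`, where `1/2 < ν < H`,
Young's inequality bounds the integral against `g` by the Hölder norm of the integrand, so on time
steps of length of order `(1 + G) ^ (-1/ν)` the a priori estimates for a solution improve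
themselves. Concatenating the steps gives sup and Hölder bounds of the form
`C * exp (C * (1 + G) ^ (1/ν))`, uniformly in the delay `r`. Since the diffusion coefficient is
Lipschitz, these bounds do not depend on the growth rate of `σ`.

To compare solutions, time is measured by the clock `t + ∫ b₀`: there the solutions are Hölder with
the exponent of the driver even though `b₀` is merely in `L²`. A Gronwall argument in this clock
bounds `‖x - y‖` by a power of the delay, and interpolation with the uniform `1/2`-Hölder bound
gives convergence in `‖·‖_{α,∞}` for every `α < 1/2`.

The Hölder constant of fractional Brownian motion has Gaussian tails, by dyadic chaining. As
`1/ν < 2`, the pathwise bounds therefore have moments of all orders, and dominated convergence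
gives the limits in `L^p`.
-/

namespace DelayFBM

noncomputable section

section SelfImprovement

theorem fixedPoint_mem_of_mapsTo {S : Set ℝ} {K q : ℝ} (hS : IsClosed S) (hne : S.Nonempty)
    (hq : 0 ≤ q) (hq1 : q < 1) (hmaps : MapsTo (fun B => K + q * B) S S) : K / (1 - q) ∈ S := by
  obtain ⟨B₀, hB₀⟩ := hne
  set F := K / (1 - q) with hF
  have hfix : K + q * F = F := by
    have : 1 - q ≠ 0 := by linarith
    rw [hF]; field_simp; ring
  have hiter : ∀ n : ℕ, F + q ^ n * (B₀ - F) ∈ S := by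
    intro n
    induction n with
    | zero => simpa using hB₀
    | succ n ih =>
      convert hmaps ih using 1
      linear_combination -hfix
  have hlim : Tendsto (fun n : ℕ => F + q ^ n * (B₀ - F)) atTop (𝓝 (F + 0 * (B₀ - F))) :=
    ((tendsto_pow_atTop_nhds_zero_of_lt_one hq hq1).mul_const _).const_add _
  simpa using hS.mem_of_tendsto hlim (Eventually.of_forall hiter)

theorem isClosed_setOf_forall_le_mul {ι : Sort*} (f w : ι → ℝ) :
    IsClosed {B | 0 ≤ B ∧ ∀ i, f i ≤ B * w i} := by
  simp only [Set.ofPred_and, Set.ofPred_forall]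
  exact isClosed_Ici.inter
    (isClosed_iInter fun _ => isClosed_le continuous_const (continuous_id.mul continuous_const))

end SelfImprovement

section HolderBounds

variable {E : Type*} [NormedAddCommGroup E]

/-- `f` is `θ`-Hölder on `S` with constant `K`. Unlike in `HolderOnWith`, constant and exponent are
real and the quotient is not formed, so `K` may be negative and `S` need not be bounded. -/
def HolderBound (K θ : ℝ) (S : Set ℝ) (f : ℝ → E) : Prop :=
  ∀ ⦃u⦄, u ∈ S → ∀ ⦃v⦄, v ∈ S → u ≤ v → ‖f v - f u‖ ≤ K * (v - u) ^ θ

/-- The Hölder condition with distances measured in the clock `φ`. -/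
def ClockHolder (φ : ℝ → ℝ) (K θ : ℝ) (S : Set ℝ) (f : ℝ → E) : Prop :=
  ∀ ⦃u⦄, u ∈ S → ∀ ⦃v⦄, v ∈ S → u ≤ v → ‖f v - f u‖ ≤ K * (φ v - φ u) ^ θ

/-- A continuous clock on `[a, b]` that runs at least as fast as time. -/
structure IsClock (φ : ℝ → ℝ) (a b : ℝ) : Prop where
  continuousOn : ContinuousOn φ (Icc a b)
  sub_le_sub : ∀ ⦃u⦄, u ∈ Icc a b → ∀ ⦃v⦄, v ∈ Icc a b → u ≤ v → v - u ≤ φ v - φ u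

variable {f : ℝ → E} {φ : ℝ → ℝ} {K L θ a b c d : ℝ} {S S' : Set ℝ}

theorem HolderBound.mono (h : HolderBound K θ S f) (hS : S' ⊆ S) : HolderBound K θ S' f :=
  fun _ hu _ hv huv => h (hS hu) (hS hv) huv

theorem ClockHolder.mono (h : ClockHolder φ K θ S f) (hS : S' ⊆ S) : ClockHolder φ K θ S' f :=
  fun _ hu _ hv huv => h (hS hu) (hS hv) huv

theorem HolderBound.weaken (h : HolderBound K θ S f) (hK : K ≤ L) : HolderBound L θ S f :=
  fun _ hu _ hv huv => (h hu hv huv).trans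
    (mul_le_mul_of_nonneg_right hK (Real.rpow_nonneg (sub_nonneg.2 huv) _))

theorem isClosed_setOf_clockHolder (φ : ℝ → ℝ) (θ : ℝ) (S : Set ℝ) (f : ℝ → E) :
    IsClosed {B | 0 ≤ B ∧ ClockHolder φ B θ S f} := by
  convert isClosed_setOf_forall_le_mul
    (fun p : {p : ℝ × ℝ // p.1 ∈ S ∧ p.2 ∈ S ∧ p.1 ≤ p.2} => ‖f p.1.2 - f p.1.1‖)
    (fun p => (φ p.1.2 - φ p.1.1) ^ θ) using 4 with B
  exact ⟨fun h p => h p.2.1 p.2.2.1 p.2.2.2, fun h u hu v hv huv => h ⟨(u, v), hu, hv, huv⟩⟩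

theorem IsClock.mono (h : IsClock φ a b) (hac : a ≤ c) (hdb : d ≤ b) : IsClock φ c d where
  continuousOn := h.continuousOn.mono (Icc_subset_Icc hac hdb)
  sub_le_sub _ hu _ hv := h.sub_le_sub (Icc_subset_Icc hac hdb hu) (Icc_subset_Icc hac hdb hv)

theorem IsClock.sub_mem_Icc (h : IsClock φ a b) {u v : ℝ} (hu : u ∈ Icc a b) (hv : v ∈ Icc a b)
    (huv : u ≤ v) : φ v - φ u ∈ Icc 0 (φ b - φ a) := by
  have hab : a ≤ b := hu.1.trans hu.2
  have h₁ := h.sub_le_sub (left_mem_Icc.2 hab) hu hu.1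
  have h₂ := h.sub_le_sub hu hv huv
  have h₃ := h.sub_le_sub hv (right_mem_Icc.2 hab) hv.2
  constructor <;> linarith [hu.1, hv.2]

theorem IsClock.strictMonoOn (h : IsClock φ a b) : StrictMonoOn φ (Icc a b) := fun _ hu _ hv huv =>
  sub_pos.1 ((sub_pos.2 huv).trans_le (h.sub_le_sub hu hv huv.le))

theorem HolderBound.clockHolder (h : HolderBound K θ (Icc a b) f) (hφ : IsClock φ a b)
    (hK : 0 ≤ K) (hθ : 0 ≤ θ) : ClockHolder φ K θ (Icc a b) f := fun _ hu _ hv huv =>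
  (h hu hv huv).trans <| mul_le_mul_of_nonneg_left
    (Real.rpow_le_rpow (sub_nonneg.2 huv) (hφ.sub_le_sub hu hv huv) hθ) hK

theorem IsClock.exists_inverse (h : IsClock φ a b) (hab : a ≤ b) :
    ∃ ψ : ℝ → ℝ, MapsTo ψ (Icc (φ a) (φ b)) (Icc a b) ∧ RightInvOn ψ φ (Icc (φ a) (φ b)) ∧
      MonotoneOn ψ (Icc (φ a) (φ b)) ∧ ψ (φ a) = a ∧ ψ (φ b) = b := by
  have ha : a ∈ Icc a b := left_mem_Icc.2 hab
  have hb : b ∈ Icc a b := right_mem_Icc.2 hab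
  have hφab : φ a ≤ φ b := h.strictMonoOn.monotoneOn ha hb hab
  choose! ψ hψ hφψ using fun y (hy : y ∈ Icc (φ a) (φ b)) =>
    intermediate_value_Icc hab h.continuousOn hy
  refine ⟨ψ, hψ, hφψ, fun y hy z hz hyz => ?_, ?_, ?_⟩
  · rwa [← h.strictMonoOn.le_iff_le (hψ y hy) (hψ z hz), hφψ y hy, hφψ z hz]
  · have hl := left_mem_Icc.2 hφab
    exact h.strictMonoOn.injOn (hψ _ hl) ha (hφψ _ hl)
  · have hr := right_mem_Icc.2 hφab
    exact h.strictMonoOn.injOn (hψ _ hr) hb (hφψ _ hr)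

end HolderBounds

section RiemannStieltjes

variable {E : Type*} [NormedAddCommGroup E] [NormedSpace ℝ E]
  {f f₁ f₂ : ℝ → E} {g : ℝ → ℝ} {a b c : ℝ} {I I₁ I₂ J : E}

theorem HasRSIntegral.eq_zero_of_eq (h : HasRSIntegral f g a a I) : I = 0 := by
  by_contra hI
  obtain ⟨κ, -, hκ⟩ := h ‖I‖ (norm_pos_iff.2 hI)
  have := hκ 0 (fun _ => a) (fun _ => a) rfl rfl (by simp) (by simp) (by simp)
  simp at this

theorem HasRSIntegral.sub (h₁ : HasRSIntegral f₁ g a b I₁) (h₂ : HasRSIntegral f₂ g a b I₂) :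
    HasRSIntegral (fun s => f₁ s - f₂ s) g a b (I₁ - I₂) := by
  intro ε hε
  obtain ⟨κ₁, hκ₁, H₁⟩ := h₁ (ε / 2) (half_pos hε)
  obtain ⟨κ₂, hκ₂, H₂⟩ := h₂ (ε / 2) (half_pos hε)
  refine ⟨min κ₁ κ₂, lt_min hκ₁ hκ₂, fun n t ξ h0 hn hmono hmesh hξ => ?_⟩
  have A₁ := H₁ n t ξ h0 hn hmono (fun i hi => (hmesh i hi).trans_le (min_le_left _ _)) hξ
  have A₂ := H₂ n t ξ h0 hn hmono (fun i hi => (hmesh i hi).trans_le (min_le_right _ _)) hξ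
  simp only [smul_sub, Finset.sum_sub_distrib]
  rw [sub_sub_sub_comm]
  calc _ ≤ _ := norm_sub_le _ _
    _ < ε / 2 + ε / 2 := add_lt_add A₁ A₂
    _ = ε := add_halves ε

theorem mem_Icc_of_forall_le_succ {t : ℕ → ℝ} {n i : ℕ} (ht : ∀ k < n, t k ≤ t (k + 1))
    (hi : i ≤ n) : t i ∈ Icc (t 0) (t n) := by
  have hle : ∀ k l, k ≤ l → l ≤ n → t k ≤ t l := by
    intro k l hkl
    induction l, hkl using Nat.le_induction with
    | base => exact fun _ => le_rfl
    | succ l _ ih => exact fun hl => (ih (by omega)).trans (ht l hl)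
  exact ⟨hle 0 i (Nat.zero_le i) hi, hle i n hi le_rfl⟩

theorem HasRSIntegral.comp_of_monotoneOn {ψ : ℝ → ℝ} (h : HasRSIntegral f g (ψ a) (ψ b) I)
    (hmono : MonotoneOn ψ (Icc a b))
    (hlip : ∀ u ∈ Icc a b, ∀ v ∈ Icc a b, u ≤ v → ψ v - ψ u ≤ v - u) :
    HasRSIntegral (f ∘ ψ) (g ∘ ψ) a b I := by
  intro ε hε
  obtain ⟨κ, hκ, H⟩ := h ε hε
  refine ⟨κ, hκ, fun n t ξ h0 hn ht hmesh hξ => ?_⟩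
  have htmem : ∀ i ≤ n, t i ∈ Icc a b := fun i hi => by
    simpa only [h0, hn] using mem_Icc_of_forall_le_succ ht hi
  refine H n (ψ ∘ t) (ψ ∘ ξ) (congrArg ψ h0) (congrArg ψ hn) (fun i hi => ?_) (fun i hi => ?_)
    (fun i hi => ?_)
  · exact hmono (htmem i hi.le) (htmem _ hi) (ht i hi)
  · exact (hlip _ (htmem i hi.le) _ (htmem _ hi) (ht i hi)).trans_lt (hmesh i hi)
  · have hξmem : ξ i ∈ Icc a b :=
      ⟨(htmem i hi.le).1.trans (hξ i hi).1, (hξ i hi).2.trans (htmem _ hi).2⟩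
    exact ⟨hmono (htmem i hi.le) hξmem (hξ i hi).1, hmono hξmem (htmem _ hi) (hξ i hi).2⟩

/-- The `k`-th of the points that divide `[a, b]` into `2 ^ n` equal parts. -/
def dyadicPoint (a b : ℝ) (n k : ℕ) : ℝ := a + k * ((b - a) / 2 ^ n)

theorem dyadicPoint_zero (a b : ℝ) (n : ℕ) : dyadicPoint a b n 0 = a := by simp [dyadicPoint]

theorem dyadicPoint_two_pow (a b : ℝ) (n : ℕ) : dyadicPoint a b n (2 ^ n) = b := by
  simp only [dyadicPoint, Nat.cast_pow, Nat.cast_ofNat]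
  field_simp
  ring

theorem dyadicPoint_succ_sub (a b : ℝ) (n k : ℕ) :
    dyadicPoint a b n (k + 1) - dyadicPoint a b n k = (b - a) / 2 ^ n := by
  simp only [dyadicPoint, Nat.cast_add, Nat.cast_one]
  ring

theorem dyadicPoint_succ_two_mul (a b : ℝ) (n k : ℕ) :
    dyadicPoint a b (n + 1) (2 * k) = dyadicPoint a b n k := by
  simp only [dyadicPoint, Nat.cast_mul, Nat.cast_ofNat, pow_succ]
  field_simp

theorem dyadicPoint_le_succ (hab : a ≤ b) (n k : ℕ) :
    dyadicPoint a b n k ≤ dyadicPoint a b n (k + 1) := by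
  have : 0 ≤ (b - a) / 2 ^ n := div_nonneg (sub_nonneg.2 hab) (by positivity)
  linarith [dyadicPoint_succ_sub a b n k]

theorem dyadicPoint_mem_Icc (hab : a ≤ b) {n k : ℕ} (hk : k ≤ 2 ^ n) :
    dyadicPoint a b n k ∈ Icc a b := by
  simpa only [dyadicPoint_zero, dyadicPoint_two_pow] using
    mem_Icc_of_forall_le_succ (fun i _ => dyadicPoint_le_succ hab n i) hk

theorem exists_dyadicPoint_mesh_lt (a b : ℝ) {κ : ℝ} (hκ : 0 < κ) :
    ∃ n₀, ∀ n ≥ n₀, ∀ k, dyadicPoint a b n (k + 1) - dyadicPoint a b n k < κ := by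
  have hlim : Tendsto (fun n : ℕ => (b - a) / 2 ^ n) atTop (𝓝 0) :=
    tendsto_const_nhds.div_atTop (tendsto_pow_atTop_atTop_of_one_lt one_lt_two)
  simpa only [dyadicPoint_succ_sub, eventually_atTop, forall_const] using
    hlim.eventually (gt_mem_nhds hκ)

/-- The first `N` terms of `p` followed by the terms of `q`. -/
def glue (N : ℕ) (p q : ℕ → ℝ) (i : ℕ) : ℝ := if i < N then p i else q (i - N)

theorem glue_of_lt {N i : ℕ} (p q : ℕ → ℝ) (hi : i < N) : glue N p q i = p i := if_pos hi

theorem glue_add (N i : ℕ) (p q : ℕ → ℝ) : glue N p q (N + i) = q i := by simp [glue]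

theorem glue_of_le {N i : ℕ} {p q : ℕ → ℝ} (hpq : p N = q 0) (hi : i ≤ N) :
    glue N p q i = p i := by
  rcases hi.lt_or_eq with h | rfl
  · exact glue_of_lt p q h
  · rw [hpq]; exact glue_add i 0 p q

theorem HasRSIntegral.tail (hab : a ≤ b) (hI : HasRSIntegral f g a c I)
    (hJ : HasRSIntegral f g a b J) : HasRSIntegral f g b c (I - J) := by
  intro ε hε
  obtain ⟨κ₁, hκ₁, H₁⟩ := hI (ε / 2) (half_pos hε)
  obtain ⟨κ₂, hκ₂, H₂⟩ := hJ (ε / 2) (half_pos hε)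
  obtain ⟨n₀, hn₀⟩ := exists_dyadicPoint_mesh_lt a b (lt_min hκ₁ hκ₂)
  set N := 2 ^ n₀
  set p := dyadicPoint a b n₀
  have hmesh₀ : ∀ i, p (i + 1) - p i < min κ₁ κ₂ := hn₀ n₀ le_rfl
  have hp : ∀ i, p i ≤ p (i + 1) := dyadicPoint_le_succ hab n₀
  refine ⟨κ₁, hκ₁, fun n t ξ h0 hn ht hmesh hξ => ?_⟩
  have hpN : p N = t 0 := (dyadicPoint_two_pow a b n₀).trans h0.symm
  have split : ∀ {Q : ℕ → Prop}, (∀ i < N, Q i) → (∀ i < n, Q (N + i)) → ∀ i < N + n, Q i := by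
    intro Q hlo hhi i hi
    rcases lt_or_ge i N with h | h
    · exact hlo i h
    · obtain ⟨k, rfl⟩ := Nat.exists_eq_add_of_le h
      exact hhi k (by omega)
  have lo : ∀ i < N, glue N p t i = p i ∧ glue N p t (i + 1) = p (i + 1) := fun i hi =>
    ⟨glue_of_le hpN hi.le, glue_of_le hpN hi⟩
  have A₂ := H₂ N p p (dyadicPoint_zero a b n₀) (dyadicPoint_two_pow a b n₀) (fun i _ => hp i)
    (fun i _ => (hmesh₀ i).trans_le (min_le_right _ _)) (fun i _ => ⟨le_rfl, hp i⟩)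
  have A₁ := H₁ (N + n) (glue N p t) (glue N p ξ)
    ((glue_of_le hpN (Nat.zero_le N)).trans (dyadicPoint_zero a b n₀)) ((glue_add N n p t).trans hn)
    (split (fun i hi => by rw [(lo i hi).1, (lo i hi).2]; exact hp i)
      (fun i hi => by rw [add_assoc, glue_add, glue_add]; exact ht i hi))
    (split (fun i hi => by
        rw [(lo i hi).1, (lo i hi).2]; exact (hmesh₀ i).trans_le (min_le_left _ _))
      (fun i hi => by rw [add_assoc, glue_add, glue_add]; exact hmesh i hi))
    (split (fun i hi => by
        rw [(lo i hi).1, (lo i hi).2, glue_of_lt p ξ hi]; exact ⟨le_rfl, hp i⟩)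
      (fun i hi => by rw [add_assoc, glue_add, glue_add, glue_add]; exact hξ i hi))
  rw [Finset.sum_range_add, Finset.sum_congr rfl fun i hi => by
    rw [(lo i (Finset.mem_range.1 hi)).1, (lo i (Finset.mem_range.1 hi)).2,
      glue_of_lt p ξ (Finset.mem_range.1 hi)]] at A₁
  simp only [add_assoc, glue_add] at A₁
  calc _ = _ := by congr 1; abel
    _ ≤ _ := norm_sub_le _ _
    _ < ε / 2 + ε / 2 := add_lt_add A₁ A₂
    _ = ε := add_halves ε

/-- The Riemann-Stieltjes sum over the dyadic partition of level `n`, tagged at right end points. -/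
def dyadicSum (f : ℝ → E) (g : ℝ → ℝ) (a b : ℝ) (n : ℕ) : E :=
  ∑ k ∈ Finset.range (2 ^ n),
    (g (dyadicPoint a b n (k + 1)) - g (dyadicPoint a b n k)) • f (dyadicPoint a b n (k + 1))

theorem HasRSIntegral.tendsto_dyadicSum (hab : a ≤ b) (hI : HasRSIntegral f g a b I) :
    Tendsto (dyadicSum f g a b) atTop (𝓝 I) := by
  rw [Metric.tendsto_atTop]
  intro ε hε
  obtain ⟨κ, hκ, H⟩ := hI ε hε
  obtain ⟨n₀, hn₀⟩ := exists_dyadicPoint_mesh_lt a b hκ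
  refine ⟨n₀, fun n hn => ?_⟩
  rw [dist_eq_norm]
  exact H (2 ^ n) (dyadicPoint a b n) (fun k => dyadicPoint a b n (k + 1)) (dyadicPoint_zero a b n)
    (dyadicPoint_two_pow a b n) (fun k _ => dyadicPoint_le_succ hab n k) (fun k _ => hn₀ n hn k)
    (fun k _ => ⟨dyadicPoint_le_succ hab n k, le_rfl⟩)

theorem dyadicSum_sub_succ (f : ℝ → E) (g : ℝ → ℝ) (a b : ℝ) (n : ℕ) :
    letI p := dyadicPoint a b (n + 1)
    dyadicSum f g a b n - dyadicSum f g a b (n + 1) = ∑ k ∈ Finset.range (2 ^ n),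
      (g (p (2 * k + 1)) - g (p (2 * k))) • (f (p (2 * k + 1 + 1)) - f (p (2 * k + 1))) := by
  have sum_range_two_mul : ∀ (h : ℕ → E) (N : ℕ), ∑ i ∈ Finset.range (2 * N), h i =
      ∑ k ∈ Finset.range N, (h (2 * k) + h (2 * k + 1)) := by
    intro h N
    induction N with
    | zero => rfl
    | succ N ih => simp only [mul_add, mul_one, Finset.sum_range_succ, ih, add_assoc]
  simp only [dyadicSum]
  rw [pow_succ, mul_comm (2 ^ n) 2, sum_range_two_mul, ← Finset.sum_sub_distrib]
  refine Finset.sum_congr rfl fun k _ => ?_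
  rw [← dyadicPoint_succ_two_mul a b n k, ← dyadicPoint_succ_two_mul a b n (k + 1),
    show 2 * (k + 1) = 2 * k + 1 + 1 by ring]
  simp only [smul_sub, sub_smul]
  abel

/-- The constant in the Young estimate with total exponent `s > 1`: the sum over `n ≥ 0` of
`2 ^ n * (2 ^ (-s)) ^ (n + 1)`. -/
def youngConst (s : ℝ) : ℝ := (2 : ℝ) ^ (-s) / (1 - 2 * (2 : ℝ) ^ (-s))

theorem two_mul_two_rpow_neg_lt_one {s : ℝ} (hs : 1 < s) : 2 * (2 : ℝ) ^ (-s) < 1 := by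
  have : (2 : ℝ) ^ (-s) < 2 ^ (-1 : ℝ) :=
    Real.rpow_lt_rpow_of_exponent_lt one_lt_two (by linarith)
  rw [Real.rpow_neg_one] at this
  linarith

theorem youngConst_nonneg {s : ℝ} (hs : 1 < s) : 0 ≤ youngConst s :=
  div_nonneg (by positivity) (sub_nonneg.2 (two_mul_two_rpow_neg_lt_one hs).le)

theorem div_two_pow_rpow {x : ℝ} (hx : 0 ≤ x) (s : ℝ) (n : ℕ) :
    (x / 2 ^ n) ^ s = x ^ s * ((2 : ℝ) ^ (-s)) ^ n := by
  rw [Real.div_rpow hx (by positivity), ← Real.rpow_natCast, ← Real.rpow_natCast,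
    ← Real.rpow_mul two_pos.le, ← Real.rpow_mul two_pos.le, div_eq_mul_inv,
    ← Real.rpow_neg two_pos.le, neg_mul, mul_comm (n : ℝ)]

variable {θ ν B G : ℝ}

theorem norm_dyadicSum_sub_succ_le (hab : a < b) (hG : 0 ≤ G) (hf : HolderBound B θ (Ioc a b) f)
    (hg : HolderBound G ν (Icc a b) g) (n : ℕ) :
    ‖dyadicSum f g a b n - dyadicSum f g a b (n + 1)‖ ≤
      B * G * (b - a) ^ (θ + ν) * 2 ^ (-(θ + ν)) * (2 * 2 ^ (-(θ + ν))) ^ n := by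
  have hL : 0 < b - a := sub_pos.2 hab
  set p := dyadicPoint a b (n + 1)
  have hstep : ∀ k, p (k + 1) - p k = (b - a) / 2 ^ (n + 1) := dyadicPoint_succ_sub a b (n + 1)
  have hp : ∀ k, p k ≤ p (k + 1) := dyadicPoint_le_succ hab.le (n + 1)
  have hterm : ∀ k ∈ Finset.range (2 ^ n),
      ‖(g (p (2 * k + 1)) - g (p (2 * k))) • (f (p (2 * k + 1 + 1)) - f (p (2 * k + 1)))‖ ≤
        B * G * ((b - a) ^ (θ + ν) * ((2 : ℝ) ^ (-(θ + ν))) ^ (n + 1)) := by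
    intro k hk
    have hmem : ∀ i ≤ 2 * k + 1 + 1, p i ∈ Icc a b := fun i hi =>
      dyadicPoint_mem_Icc hab.le (by have := Finset.mem_range.1 hk; rw [pow_succ]; omega)
    have hlt : a < p (2 * k + 1) :=
      lt_add_of_pos_right a (mul_pos (by positivity) (div_pos hL (by positivity)))
    have hg' := hg (hmem (2 * k) (by omega)) (hmem _ (by omega)) (hp _)
    have hf' := hf ⟨hlt, (hmem _ (by omega)).2⟩ ⟨hlt.trans_le (hp _), (hmem _ le_rfl).2⟩ (hp _)
    rw [hstep] at hg' hf'
    rw [norm_smul]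
    calc _ ≤ (G * ((b - a) / 2 ^ (n + 1)) ^ ν) * (B * ((b - a) / 2 ^ (n + 1)) ^ θ) :=
          mul_le_mul hg' hf' (norm_nonneg _) (by positivity)
      _ = B * G * ((b - a) / 2 ^ (n + 1)) ^ (θ + ν) := by rw [Real.rpow_add (by positivity)]; ring
      _ = _ := by rw [div_two_pow_rpow hL.le]
  rw [dyadicSum_sub_succ]
  refine (norm_sum_le_of_le _ hterm).trans_eq ?_
  simp only [Finset.sum_const, Finset.card_range, nsmul_eq_mul, Nat.cast_pow, Nat.cast_ofNat]
  ring

/-- The integrand need not be controlled at the left end point: the sums are tagged on the right. -/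
theorem HasRSIntegral.young_estimate (hab : a ≤ b) (hθν : 1 < θ + ν) (hG : 0 ≤ G)
    (hf : HolderBound B θ (Ioc a b) f) (hg : HolderBound G ν (Icc a b) g)
    (hI : HasRSIntegral f g a b I) :
    ‖I - (g b - g a) • f b‖ ≤ youngConst (θ + ν) * (B * G * (b - a) ^ (θ + ν)) := by
  rcases hab.eq_or_lt with rfl | hab
  · simp [hI.eq_zero_of_eq, Real.zero_rpow (show θ + ν ≠ 0 by linarith)]
  have hS₀ : dyadicSum f g a b 0 = (g b - g a) • f b := by simp [dyadicSum, dyadicPoint]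
  have := dist_le_of_le_geometric_of_tendsto₀ _ _ (two_mul_two_rpow_neg_lt_one hθν)
    (fun n => (dist_eq_norm _ _).trans_le (norm_dyadicSum_sub_succ_le hab hG hf hg n))
    (hI.tendsto_dyadicSum hab.le)
  rw [hS₀, dist_comm, dist_eq_norm] at this
  exact this.trans_eq (by rw [youngConst]; ring)

theorem HasRSIntegral.young_estimate_clock {φ : ℝ → ℝ} (hab : a ≤ b) (hφ : IsClock φ a b)
    (hθν : 1 < θ + ν) (hG : 0 ≤ G) (hf : ClockHolder φ B θ (Ioc a b) f)
    (hg : ClockHolder φ G ν (Icc a b) g) (hI : HasRSIntegral f g a b I) :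
    ‖I - (g b - g a) • f b‖ ≤ youngConst (θ + ν) * (B * G * (φ b - φ a) ^ (θ + ν)) := by
  obtain ⟨ψ, hψ, hφψ, hmono, hψa, hψb⟩ := hφ.exists_inverse hab
  have hφab : φ a ≤ φ b :=
    hφ.strictMonoOn.monotoneOn (left_mem_Icc.2 hab) (right_mem_Icc.2 hab) hab
  have hlip : ∀ u ∈ Icc (φ a) (φ b), ∀ v ∈ Icc (φ a) (φ b), u ≤ v → ψ v - ψ u ≤ v - u := by
    intro u hu v hv huv
    simpa only [hφψ hu, hφψ hv] using hφ.sub_le_sub (hψ hu) (hψ hv) (hmono hu hv huv)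
  have hI' : HasRSIntegral (f ∘ ψ) (g ∘ ψ) (φ a) (φ b) I :=
    HasRSIntegral.comp_of_monotoneOn (by rwa [hψa, hψb]) hmono hlip
  have hψIoc : MapsTo ψ (Ioc (φ a) (φ b)) (Ioc a b) := fun u hu => by
    have hu' := Ioc_subset_Icc_self hu
    refine ⟨(hφ.strictMonoOn.lt_iff_lt (left_mem_Icc.2 hab) (hψ hu')).1 ?_, (hψ hu').2⟩
    rw [hφψ hu']; exact hu.1
  have hf' : HolderBound B θ (Ioc (φ a) (φ b)) (f ∘ ψ) := fun u hu v hv huv => by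
    have hu' := Ioc_subset_Icc_self hu
    have hv' := Ioc_subset_Icc_self hv
    simpa only [hφψ hu', hφψ hv', Function.comp_apply] using
      hf (hψIoc hu) (hψIoc hv) (hmono hu' hv' huv)
  have hg' : HolderBound G ν (Icc (φ a) (φ b)) (g ∘ ψ) := fun u hu v hv huv => by
    simpa only [hφψ hu, hφψ hv, Function.comp_apply] using hg (hψ hu) (hψ hv) (hmono hu hv huv)
  simpa only [Function.comp_apply, hψa, hψb] using hI'.young_estimate hφab hθν hG hf' hg'

/-- The two exponents of a path and of its driver for which the Young integral is defined, in the
range that occurs for solutions of Hölder order `θ ≤ 1/2`. -/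
structure YoungPair (θ ν : ℝ) : Prop where
  le_half : θ ≤ 1 / 2
  le_one : ν ≤ 1
  one_lt : 1 < θ + ν

namespace YoungPair

theorem pos_left (h : YoungPair θ ν) : 0 < θ := by linarith [h.le_one, h.one_lt]

theorem half_lt_right (h : YoungPair θ ν) : 1 / 2 < ν := by linarith [h.le_half, h.one_lt]

theorem pos_right (h : YoungPair θ ν) : 0 < ν := one_half_pos.trans h.half_lt_right

end YoungPair

/-- The driving path `g = (g 1, …, g m)` is `ν`-Hölder on `[0, T]` with constant `G ≥ 0`. -/
structure HolderDriver {m : ℕ} (T ν G : ℝ) (g : Fin m → ℝ → ℝ) : Prop where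
  nonneg : 0 ≤ G
  holder : ∀ j, HolderBound G ν (Icc 0 T) (g j)

theorem norm_sum_le_of_hasRSIntegral {m : ℕ} {F : ℝ → Fin m → E} {g : Fin m → ℝ → ℝ}
    {φ : ℝ → ℝ} {T S : ℝ} {J : Fin m → E} (ha : 0 ≤ a) (hab : a ≤ b) (hb : b ≤ T)
    (hφ : IsClock φ a b) (hθ : 0 ≤ θ) (hν : 0 ≤ ν) (hθν : 1 < θ + ν)
    (hF : ClockHolder φ B θ (Ioc a b) F) (hFb : ‖F b‖ ≤ S) (hg : HolderDriver T ν G g)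
    (hJ : ∀ j, HasRSIntegral (fun u => F u j) (g j) a b (J j)) :
    ‖∑ j, J j‖ ≤ m * (G * (S + youngConst (θ + ν) * B * (φ b - φ a) ^ θ) * (φ b - φ a) ^ ν) := by
  have hG := hg.nonneg
  have hL : 0 ≤ φ b - φ a := (sub_nonneg.2 hab).trans
    (hφ.sub_le_sub (left_mem_Icc.2 hab) (right_mem_Icc.2 hab) hab)
  have hg' : ∀ j, ClockHolder φ G ν (Icc a b) (g j) := fun j =>
    ((hg.holder j).mono (Icc_subset_Icc ha hb)).clockHolder hφ hG hν
  have hterm : ∀ j ∈ Finset.univ, ‖J j‖ ≤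
      G * (S + youngConst (θ + ν) * B * (φ b - φ a) ^ θ) * (φ b - φ a) ^ ν := by
    intro j _
    have hYoung := (hJ j).young_estimate_clock hab hφ hθν hG
      (fun u hu v hv huv => (norm_le_pi_norm (F v - F u) j).trans (hF hu hv huv)) (hg' j)
    have hend : ‖(g j b - g j a) • F b j‖ ≤ G * (φ b - φ a) ^ ν * S := by
      rw [norm_smul]
      exact mul_le_mul (hg' j (left_mem_Icc.2 hab) (right_mem_Icc.2 hab) hab)
        ((norm_le_pi_norm (F b) j).trans hFb) (norm_nonneg _) (by positivity)
    calc ‖J j‖ ≤ ‖J j - (g j b - g j a) • F b j‖ + ‖(g j b - g j a) • F b j‖ := by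
          simpa only [sub_add_cancel] using
            norm_add_le (J j - (g j b - g j a) • F b j) ((g j b - g j a) • F b j)
      _ ≤ _ := add_le_add hYoung hend
      _ = _ := by rw [Real.rpow_add_of_nonneg hL hθ hν]; ring
  simpa only [Finset.sum_const, Finset.card_univ, Fintype.card_fin, nsmul_eq_mul] using
    norm_sum_le_of_le _ hterm

end RiemannStieltjes

section SlobodeckijRegularity

variable {E : Type*} [NormedAddCommGroup E] {α a b : ℝ} {f : ℝ → E}

theorem setLIntegral_enorm_sub_le {t s h A : ℝ} (hα : 0 ≤ α + 1)
    (hA : ∫⁻ s in Ioo a t, ‖f t - f s‖ₑ / ENNReal.ofReal ((t - s) ^ (α + 1)) ≤ ENNReal.ofReal A)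
    (has : a ≤ s - h) (hst : s ≤ t) (hh : 0 < h) :
    ∫⁻ u in Ioo (s - h) s, ‖f t - f u‖ₑ ≤ ENNReal.ofReal ((t - s + h) ^ (α + 1) * A) := by
  have : 0 < t - s + h := by linarith
  set c := ENNReal.ofReal ((t - s + h) ^ (α + 1))
  calc ∫⁻ u in Ioo (s - h) s, ‖f t - f u‖ₑ
      ≤ ∫⁻ u in Ioo (s - h) s, c * (‖f t - f u‖ₑ / ENNReal.ofReal ((t - u) ^ (α + 1))) := by
        refine setLIntegral_mono' measurableSet_Ioo fun u hu => ?_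
        have hne : ENNReal.ofReal ((t - u) ^ (α + 1)) ≠ 0 := by
          simpa using Real.rpow_pos_of_pos (show 0 < t - u by linarith [hu.2]) (α + 1)
        rw [← mul_div_assoc, ENNReal.le_div_iff_mul_le (.inl hne) (.inl ENNReal.ofReal_ne_top),
          mul_comm]
        refine mul_le_mul_left (ENNReal.ofReal_le_ofReal ?_) _
        exact Real.rpow_le_rpow (by linarith [hu.2]) (by linarith [hu.1]) hα
    _ = c * ∫⁻ u in Ioo (s - h) s, (‖f t - f u‖ₑ / ENNReal.ofReal ((t - u) ^ (α + 1))) :=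
        lintegral_const_mul' _ _ ENNReal.ofReal_ne_top
    _ ≤ c * ENNReal.ofReal A := by
        gcongr
        exact (lintegral_mono_set (Ioo_subset_Ioo has hst)).trans hA
    _ = _ := (ENNReal.ofReal_mul (by positivity)).symm

theorem enorm_le_wNorm {t : ℝ} (ht : t ∈ Icc a b) : ‖f t‖ₑ ≤ wNorm α a b f :=
  le_self_add.trans (le_iSup₂ (f := fun t (_ : t ∈ Icc a b) => ‖f t‖ₑ +
    ∫⁻ s in Ioo a t, ‖f t - f s‖ₑ / ENNReal.ofReal ((t - s) ^ (α + 1))) t ht)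

theorem setLIntegral_le_wNorm {t : ℝ} (ht : t ∈ Icc a b) :
    ∫⁻ s in Ioo a t, ‖f t - f s‖ₑ / ENNReal.ofReal ((t - s) ^ (α + 1)) ≤ wNorm α a b f :=
  le_add_self.trans (le_iSup₂ (f := fun t (_ : t ∈ Icc a b) => ‖f t‖ₑ +
    ∫⁻ s in Ioo a t, ‖f t - f s‖ₑ / ENNReal.ofReal ((t - s) ^ (α + 1))) t ht)

variable [MeasurableSpace E]

theorem MemW.norm_le (hf : MemW α a b f) {t : ℝ} (ht : t ∈ Icc a b) :
    ‖f t‖ ≤ (wNorm α a b f).toReal := by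
  simpa only [toReal_enorm] using ENNReal.toReal_mono hf.2.ne (enorm_le_wNorm ht)

variable [BorelSpace E] [SecondCountableTopology E]

theorem norm_sub_mul_le_of_setLIntegral {s t c d P Q : ℝ}
    (hf : AEMeasurable f (volume.restrict (Ioo c d))) (hP₀ : 0 ≤ P) (hQ₀ : 0 ≤ Q)
    (hP : ∫⁻ u in Ioo c d, ‖f t - f u‖ₑ ≤ ENNReal.ofReal P)
    (hQ : ∫⁻ u in Ioo c d, ‖f s - f u‖ₑ ≤ ENNReal.ofReal Q) :
    ‖f t - f s‖ * (d - c) ≤ P + Q := by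
  have hle : ∫⁻ _ in Ioo c d, ‖f t - f s‖ₑ ≤ ENNReal.ofReal P + ENNReal.ofReal Q := by
    calc ∫⁻ _ in Ioo c d, ‖f t - f s‖ₑ
        ≤ ∫⁻ u in Ioo c d, (‖f t - f u‖ₑ + ‖f s - f u‖ₑ) := by
          refine lintegral_mono fun u => ?_
          simpa only [sub_sub_sub_cancel_right] using
            enorm_sub_le (a := f t - f u) (b := f s - f u)
      _ = (∫⁻ u in Ioo c d, ‖f t - f u‖ₑ) + ∫⁻ u in Ioo c d, ‖f s - f u‖ₑ :=
          lintegral_add_left' ((aemeasurable_const.sub hf).enorm) _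
      _ ≤ _ := add_le_add hP hQ
  rw [setLIntegral_const, Real.volume_Ioo, ← ofReal_norm, ← ENNReal.ofReal_add hP₀ hQ₀,
    ← ENNReal.ofReal_mul (norm_nonneg _)] at hle
  exact (ENNReal.ofReal_le_ofReal_iff (add_nonneg hP₀ hQ₀)).1 hle

/-- The increment is compared with its average over an interval of length `t - s` to the left of
`s`, which must fit into `[a, b]`. -/
theorem MemW.norm_sub_le (hα : 0 < α) (hf : MemW α a b f) {s t : ℝ} (hst : s < t) (htb : t ≤ b)
    (has : a ≤ s - (t - s)) :
    ‖f t - f s‖ ≤ (2 ^ (α + 1) + 1) * (wNorm α a b f).toReal * (t - s) ^ α := by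
  set h := t - s
  set A := (wNorm α a b f).toReal
  have hA : 0 ≤ A := ENNReal.toReal_nonneg
  have hpos : 0 < h := sub_pos.2 hst
  have hint : ∀ r ∈ Icc a b, ∫⁻ u in Ioo a r, ‖f r - f u‖ₑ / ENNReal.ofReal ((r - u) ^ (α + 1)) ≤
      ENNReal.ofReal A := fun r hr => by
    rw [ENNReal.ofReal_toReal hf.2.ne]; exact setLIntegral_le_wNorm hr
  have hmeas : AEMeasurable f (volume.restrict (Ioo (s - h) s)) := by
    refine (aemeasurable_restrict_of_measurable_subtype measurableSet_Icc hf.1).mono_measure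
      (Measure.restrict_mono (fun u hu => ?_) le_rfl)
    exact ⟨has.trans hu.1.le, by linarith [hu.2]⟩
  have hP := setLIntegral_enorm_sub_le (by linarith) (hint t ⟨by linarith, htb⟩) has hst.le hpos
  have hQ := setLIntegral_enorm_sub_le (by linarith) (hint s ⟨by linarith, by linarith⟩) has
    le_rfl hpos
  have havg := norm_sub_mul_le_of_setLIntegral hmeas
    (mul_nonneg (Real.rpow_nonneg (by linarith) _) hA)
    (mul_nonneg (Real.rpow_nonneg (by linarith) _) hA) hP hQ
  refine le_of_mul_le_mul_right (a := h) ?_ hpos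
  calc ‖f t - f s‖ * h = ‖f t - f s‖ * (s - (s - h)) := by ring
    _ ≤ _ := havg
    _ = (2 * h) ^ (α + 1) * A + h ^ (α + 1) * A := by rw [sub_self, zero_add, two_mul]
    _ = _ := by
      rw [Real.mul_rpow two_pos.le hpos.le, Real.rpow_add_one hpos.ne' α]
      ring

theorem MemW.exists_holderBound_Icc (hα : 0 < α) (hf : MemW α a b f) {ε : ℝ} (hε : 0 < ε) :
    ∃ K, 0 ≤ K ∧ HolderBound K α (Icc (a + ε) b) f := by
  set A := (wNorm α a b f).toReal
  set K := (2 ^ (α + 1) + 1) * A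
  have : 0 ≤ A := ENNReal.toReal_nonneg
  have : 0 ≤ K := by positivity
  refine ⟨K + 2 * A / ε ^ α, by positivity, fun s hs t ht hst => ?_⟩
  rcases hst.eq_or_lt with rfl | hst
  · simp [Real.zero_rpow hα.ne']
  have : 0 ≤ (t - s) ^ α := Real.rpow_nonneg (sub_nonneg.2 hst.le) _
  rw [add_mul]
  rcases le_or_gt (t - s) ε with h | h
  · refine (hf.norm_sub_le hα hst ht.2 (by linarith [hs.1])).trans (le_add_of_nonneg_right ?_)
    positivity
  · have hbd : ∀ r ∈ Icc (a + ε) b, ‖f r‖ ≤ A := fun r hr => hf.norm_le ⟨by linarith [hr.1], hr.2⟩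
    calc ‖f t - f s‖ ≤ A + A := (_root_.norm_sub_le _ _).trans (add_le_add (hbd t ht) (hbd s hs))
      _ = 2 * A / ε ^ α * ε ^ α := by field_simp; ring
      _ ≤ 2 * A / ε ^ α * (t - s) ^ α := by gcongr
      _ ≤ _ := le_add_of_nonneg_left (by positivity)

/-- A pair `s < t` that is close to `a` compared with `t - s` is split at the midpoint `c` of
`[a, t]`: the increment over `[c, t]` is controlled, and `c - s` is at most half of `t - s`, so that
the bound improves itself. -/
theorem MemW.exists_holderBound_Ioc (hα : 0 < α) (hf : MemW α a b f) :
    ∃ K, 0 ≤ K ∧ HolderBound K α (Ioc a b) f := by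
  set K := (2 ^ (α + 1) + 1) * (wNorm α a b f).toReal
  have hK : 0 ≤ K := mul_nonneg (by positivity) ENNReal.toReal_nonneg
  set q : ℝ := (1 / 2) ^ α with hq
  have hq0 : 0 ≤ q := by positivity
  have hq1 : q < 1 := Real.rpow_lt_one (by norm_num) (by norm_num) hα
  refine ⟨K / (1 - q), div_nonneg hK (by linarith), fun s₀ hs₀ t₀ ht₀ hst₀ => ?_⟩
  obtain ⟨B₀, hB₀⟩ := hf.exists_holderBound_Icc hα (sub_pos.2 hs₀.1)
  rw [add_sub_cancel] at hB₀
  refine (fixedPoint_mem_of_mapsTo (isClosed_setOf_clockHolder id α (Icc s₀ b) f) ⟨B₀, hB₀⟩ hq0 hq1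
    ?_).2 ⟨le_rfl, hs₀.2⟩ ⟨hst₀, ht₀.2⟩ hst₀
  refine fun B ⟨hB, hBh⟩ => ⟨by positivity, fun s hs t ht hst => ?_⟩
  replace hBh : HolderBound B α (Icc s₀ b) f := hBh
  change ‖f t - f s‖ ≤ (K + q * B) * (t - s) ^ α
  rcases hst.eq_or_lt with rfl | hst
  · simp [Real.zero_rpow hα.ne']
  have : 0 ≤ (t - s) ^ α := Real.rpow_nonneg (by linarith) _
  rw [add_mul]
  rcases le_or_gt (t - s) (s - a) with h | h
  · exact (hf.norm_sub_le hα hst ht.2 (by linarith)).trans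
      (le_add_of_nonneg_right (by positivity))
  · set c := (a + t) / 2 with hc
    have hsc : s ≤ c := by linarith
    have hct : c < t := by linarith [hs₀.1, hs.1]
    have hright : ‖f t - f c‖ ≤ K * (t - s) ^ α :=
      (hf.norm_sub_le hα hct ht.2 (by linarith)).trans <| mul_le_mul_of_nonneg_left
        (Real.rpow_le_rpow (by linarith) (by linarith) hα.le) hK
    have hleft : ‖f c - f s‖ ≤ B * (q * (t - s) ^ α) := by
      refine (hBh hs ⟨hs.1.trans hsc, hct.le.trans ht.2⟩ hsc).trans
        (mul_le_mul_of_nonneg_left ?_ hB)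
      rw [hq, ← Real.mul_rpow (by norm_num) (by linarith)]
      exact Real.rpow_le_rpow (by linarith) (by linarith [hs₀.1, hs.1]) hα.le
    calc ‖f t - f s‖ ≤ ‖f t - f c‖ + ‖f c - f s‖ := norm_sub_le_norm_sub_add_norm_sub _ _ _
      _ ≤ K * (t - s) ^ α + B * (q * (t - s) ^ α) := add_le_add hright hleft
      _ = _ := by ring

end SlobodeckijRegularity

section APriori

variable {E : Type*} [NormedAddCommGroup E] {m : ℕ}

/-- `f` satisfies the `θ`-Hölder condition on `S` for pairs at distance at most `Δ`. -/
def HolderAtScale (Δ K θ : ℝ) (S : Set ℝ) (f : ℝ → E) : Prop :=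
  ∀ ⦃u⦄, u ∈ S → ∀ ⦃v⦄, v ∈ S → u ≤ v → v - u ≤ Δ → ‖f v - f u‖ ≤ K * (v - u) ^ θ

/-- On `[a, b]` the function `x` is bounded and `θ`-Hölder, both with constant `R`. -/
structure HolderNormLe (R θ a b : ℝ) (x : ℝ → E) : Prop where
  norm_le : ∀ t ∈ Icc a b, ‖x t‖ ≤ R
  holder : HolderBound R θ (Icc a b) x

theorem isClosed_setOf_holderAtScale (Δ θ : ℝ) (S : Set ℝ) (f : ℝ → E) :
    IsClosed {B | 0 ≤ B ∧ HolderAtScale Δ B θ S f} := by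
  convert isClosed_setOf_forall_le_mul
    (fun p : {p : ℝ × ℝ // p.1 ∈ S ∧ p.2 ∈ S ∧ p.1 ≤ p.2 ∧ p.2 - p.1 ≤ Δ} =>
      ‖f p.1.2 - f p.1.1‖)
    (fun p => (p.1.2 - p.1.1) ^ θ) using 4 with B
  exact ⟨fun h p => h p.2.1 p.2.2.1 p.2.2.2.1 p.2.2.2.2,
    fun h u hu v hv huv hΔ => h ⟨(u, v), hu, hv, huv, hΔ⟩⟩

theorem HolderBound.trans_holderAtScale {f : ℝ → E} {Δ K₁ K₂ θ a b c : ℝ} (hθ : 0 ≤ θ)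
    (hK₁ : 0 ≤ K₁) (hK₂ : 0 ≤ K₂) (h₁ : HolderBound K₁ θ (Icc a c) f)
    (h₂ : HolderAtScale Δ K₂ θ (Icc c b) f) : HolderAtScale Δ (K₁ + K₂) θ (Icc a b) f := by
  intro u hu v hv huv hΔ
  have : 0 ≤ (v - u) ^ θ := Real.rpow_nonneg (sub_nonneg.2 huv) _
  rw [add_mul]
  rcases le_total c u with hcu | huc
  · exact (h₂ ⟨hcu, hu.2⟩ ⟨hcu.trans huv, hv.2⟩ huv hΔ).trans
      (le_add_of_nonneg_left (by positivity))
  rcases le_total v c with hvc | hcv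
  · exact (h₁ ⟨hu.1, huc⟩ ⟨hv.1, hvc⟩ huv).trans (le_add_of_nonneg_right (by positivity))
  · calc ‖f v - f u‖ ≤ ‖f c - f u‖ + ‖f v - f c‖ := by
          rw [add_comm]; exact norm_sub_le_norm_sub_add_norm_sub _ _ _
      _ ≤ K₁ * (c - u) ^ θ + K₂ * (v - c) ^ θ :=
          add_le_add (h₁ ⟨hu.1, huc⟩ ⟨hu.1.trans huc, le_rfl⟩ huc)
            (h₂ ⟨le_rfl, hcv.trans hv.2⟩ ⟨hcv, hv.2⟩ hcv (by linarith))
      _ ≤ K₁ * (v - u) ^ θ + K₂ * (v - u) ^ θ := by gcongr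

theorem HolderAtScale.holderBound {f : ℝ → E} {S : Set ℝ} {Δ K θ A : ℝ}
    (hf : HolderAtScale Δ K θ S f)
    (hΔ : 0 < Δ) (hθ : 0 ≤ θ) (hA : ∀ t ∈ S, ‖f t‖ ≤ A) (hK : 2 * A * Δ ^ (-θ) ≤ K) :
    HolderBound K θ S f := by
  intro u hu v hv huv
  rcases le_or_gt (v - u) Δ with hle | hgt
  · exact hf hu hv huv hle
  have hA₀ : 0 ≤ A := (norm_nonneg _).trans (hA u hu)
  have hlarge : 1 ≤ Δ ^ (-θ) * (v - u) ^ θ := by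
    rw [Real.rpow_neg hΔ.le, le_inv_mul_iff₀ (by positivity), mul_one]
    exact Real.rpow_le_rpow hΔ.le hgt.le hθ
  have : 0 ≤ (v - u) ^ θ := Real.rpow_nonneg (sub_nonneg.2 huv) _
  calc ‖f v - f u‖ ≤ ‖f v‖ + ‖f u‖ := norm_sub_le _ _
    _ ≤ 2 * A := by linarith [hA u hu, hA v hv]
    _ ≤ 2 * A * (Δ ^ (-θ) * (v - u) ^ θ) := le_mul_of_one_le_right (by positivity) hlarge
    _ = 2 * A * Δ ^ (-θ) * (v - u) ^ θ := by ring
    _ ≤ K * (v - u) ^ θ := by gcongr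

/-- The regularity and growth of the coefficients used in the pathwise estimates. The bound `half`
on `∫ b₀` is what Hölder's inequality gives for `b₀ ∈ L²`. -/
structure CoeffBounds (T θ M : ℝ) (b : ℝ → E → E) (σ : ℝ → E → Fin m → E) (b₀ : ℝ → ℝ) :
    Prop where
  one_le : 1 ≤ M
  lip : ∀ t ∈ Icc 0 T, ∀ x y, ‖σ t x - σ t y‖ ≤ M * ‖x - y‖
  time : ∀ s ∈ Icc 0 T, ∀ t ∈ Icc 0 T, ∀ x, ‖σ t x - σ s x‖ ≤ M * |t - s| ^ θ
  zero : ∀ t ∈ Icc 0 T, ‖σ t 0‖ ≤ M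
  integrable : IntervalIntegrable b₀ volume 0 T
  nonneg : ∀ t ∈ Icc 0 T, 0 ≤ b₀ t
  half : ∀ s t, 0 ≤ s → s ≤ t → t ≤ T → ∫ u in s..t, b₀ u ≤ M * (t - s) ^ (1 / 2 : ℝ)
  growth : ∀ t ∈ Icc 0 T, ∀ x, ‖b t x‖ ≤ M * ‖x‖ + b₀ t

variable {T θ M r ν G A B s t : ℝ} {b : ℝ → E → E} {σ : ℝ → E → Fin m → E} {b₀ : ℝ → ℝ}
  {g : Fin m → ℝ → ℝ} {x : ℝ → E}

namespace CoeffBounds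

theorem const_nonneg (h : CoeffBounds T θ M b σ b₀) : 0 ≤ M := zero_le_one.trans h.one_le

theorem intervalIntegrable (h : CoeffBounds T θ M b σ b₀) (hs : 0 ≤ s) (hst : s ≤ t)
    (ht : t ≤ T) : IntervalIntegrable b₀ volume s t := by
  refine h.integrable.mono_set ?_
  rw [uIcc_of_le hst, uIcc_of_le (by linarith)]
  exact Icc_subset_Icc hs ht

theorem norm_sigma_le (h : CoeffBounds T θ M b σ b₀) {y : E} (ht : t ∈ Icc 0 T) (hy : ‖y‖ ≤ A) :
    ‖σ t y‖ ≤ M * (1 + A) := by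
  have hM := h.const_nonneg
  have hlip := h.lip t ht y 0
  rw [sub_zero] at hlip
  calc ‖σ t y‖ ≤ ‖σ t y - σ t 0‖ + ‖σ t 0‖ := norm_le_norm_sub_add _ _
    _ ≤ M * ‖y‖ + M := add_le_add hlip (h.zero t ht)
    _ ≤ M * A + M := by gcongr
    _ = M * (1 + A) := by ring

theorem norm_sigma_sub_le (h : CoeffBounds T θ M b σ b₀) {u v : ℝ} {y z : E} (hu : u ∈ Icc 0 T)
    (hv : v ∈ Icc 0 T) (huv : u ≤ v) : ‖σ v z - σ u y‖ ≤ M * (v - u) ^ θ + M * ‖z - y‖ := by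
  have htime := h.time u hu v hv z
  rw [abs_of_nonneg (sub_nonneg.2 huv)] at htime
  exact (norm_sub_le_norm_sub_add_norm_sub _ (σ u z) _).trans (add_le_add htime (h.lip u hu z y))

end CoeffBounds

variable [NormedSpace ℝ E]

/-- The integral equation with delay `r`, written for increments. -/
structure IncrementEq (T r : ℝ) (b : ℝ → E → E) (σ : ℝ → E → Fin m → E) (g : Fin m → ℝ → ℝ)
    (x : ℝ → E) : Prop where
  integrable : IntervalIntegrable (fun s => b s (x s)) volume 0 T
  incr : ∀ s t, 0 ≤ s → s < t → t ≤ T → ∃ J : Fin m → E,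
    (∀ j, HasRSIntegral (fun u => σ u (x (u - r)) j) (g j) s t (J j)) ∧
    x t - x s = (∫ u in s..t, b u (x u)) + ∑ j, J j

theorem IncrementEq.of_equation (hT : 0 < T)
    (h : ∀ t ∈ Ioc 0 T, IntervalIntegrable (fun s => b s (x s)) volume 0 t ∧
      ∃ I : Fin m → E, (∀ j, HasRSIntegral (fun s => σ s (x (s - r)) j) (g j) 0 t (I j)) ∧
        x t = x 0 + (∫ s in (0 : ℝ)..t, b s (x s)) + ∑ j, I j) :
    IncrementEq T r b σ g x := by
  refine ⟨(h T ⟨hT, le_rfl⟩).1, fun s t hs hst ht => ?_⟩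
  obtain ⟨hbt, I, hI, hxt⟩ := h t ⟨by linarith, ht⟩
  rcases hs.eq_or_lt with rfl | hs
  · exact ⟨I, hI, by rw [hxt]; abel⟩
  · obtain ⟨hbs, J, hJ, hxs⟩ := h s ⟨hs, by linarith⟩
    refine ⟨fun j => I j - J j, fun j => (hI j).tail hs.le (hJ j), ?_⟩
    rw [hxt, hxs, Finset.sum_sub_distrib, ← intervalIntegral.integral_interval_sub_left hbt hbs]
    abel

theorem CoeffBounds.norm_integral_le (h : CoeffBounds T θ M b σ b₀) (hs : 0 ≤ s) (hst : s ≤ t)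
    (ht : t ≤ T) (hA : ∀ u ∈ Icc s t, ‖x u‖ ≤ A) :
    ‖∫ u in s..t, b u (x u)‖ ≤ M * A * (t - s) + ∫ u in s..t, b₀ u := by
  have hM := h.const_nonneg
  have hint := h.intervalIntegrable hs hst ht
  calc ‖∫ u in s..t, b u (x u)‖ ≤ ∫ u in s..t, (M * A + b₀ u) := by
        refine intervalIntegral.norm_integral_le_of_norm_le hst (ae_of_all _ fun u hu => ?_)
          (intervalIntegrable_const.add hint)
        refine (h.growth u ⟨by linarith [hu.1], by linarith [hu.2]⟩ _).trans ?_
        gcongr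
        exact hA u (Ioc_subset_Icc_self hu)
    _ = M * A * (t - s) + ∫ u in s..t, b₀ u := by
        rw [intervalIntegral.integral_add intervalIntegrable_const hint,
          intervalIntegral.integral_const, smul_eq_mul, mul_comm]

theorem CoeffBounds.norm_sum_le (h : CoeffBounds T θ M b σ b₀) {J : Fin m → E} (hθ : 0 ≤ θ)
    (hν : 0 ≤ ν) (hθν : 1 < θ + ν) (hg : HolderDriver T ν G g) (hs : 0 ≤ s) (hst : s ≤ t)
    (ht : t ≤ T) (hA : ‖x (t - r)‖ ≤ A) (hx : HolderBound B θ (Ioc (s - r) (t - r)) x)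
    (hJ : ∀ j, HasRSIntegral (fun u => σ u (x (u - r)) j) (g j) s t (J j)) :
    ‖∑ j, J j‖ ≤ m * (G * (M * (1 + A) + youngConst (θ + ν) * (M * (1 + B)) * (t - s) ^ θ) *
      (t - s) ^ ν) := by
  have hM := h.const_nonneg
  have hmem : ∀ u ∈ Icc s t, u ∈ Icc 0 T := fun u hu => ⟨hs.trans hu.1, hu.2.trans ht⟩
  have hid : IsClock (fun u : ℝ => u) s t := ⟨continuousOn_id, fun _ _ _ _ _ => le_rfl⟩
  refine norm_sum_le_of_hasRSIntegral (F := fun u => σ u (x (u - r))) hs hst ht hid hθ hν hθν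
    (fun u hu v hv huv => ?_) (h.norm_sigma_le (hmem t ⟨hst, le_rfl⟩) hA) hg hJ
  have hdelay := hx (u := u - r) ⟨by linarith [hu.1], by linarith [hu.2]⟩ (v := v - r)
    ⟨by linarith [hv.1], by linarith [hv.2]⟩ (by linarith)
  rw [sub_sub_sub_cancel_right] at hdelay
  calc ‖σ v (x (v - r)) - σ u (x (u - r))‖
      ≤ M * (v - u) ^ θ + M * ‖x (v - r) - x (u - r)‖ :=
        h.norm_sigma_sub_le (hmem u (Ioc_subset_Icc_self hu)) (hmem v (Ioc_subset_Icc_self hv)) huv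
    _ ≤ M * (v - u) ^ θ + M * (B * (v - u) ^ θ) := by gcongr
    _ = M * (1 + B) * (v - u) ^ θ := by ring

theorem IncrementEq.norm_sub_le (he : IncrementEq T r b σ g x) (h : CoeffBounds T θ M b σ b₀)
    (hθ : 0 ≤ θ) (hν : 0 ≤ ν) (hθν : 1 < θ + ν) (hg : HolderDriver T ν G g) (hs : 0 ≤ s)
    (hst : s < t) (ht : t ≤ T) (hA : ∀ u ∈ Icc s t, ‖x u‖ ≤ A) (hAr : ‖x (t - r)‖ ≤ A)
    (hx : HolderBound B θ (Ioc (s - r) (t - r)) x) :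
    ‖x t - x s‖ ≤ M * A * (t - s) + (∫ u in s..t, b₀ u) +
      m * (G * (M * (1 + A) + youngConst (θ + ν) * (M * (1 + B)) * (t - s) ^ θ) * (t - s) ^ ν) := by
  obtain ⟨J, hJ, hxJ⟩ := he.incr s t hs hst ht
  rw [hxJ]
  exact (norm_add_le _ _).trans (add_le_add (h.norm_integral_le hs hst.le ht hA)
    (h.norm_sum_le hθ hν hθν hg hs hst.le ht hAr hx hJ))

/-- A Hölder continuous solution of the equation with delay `r`, whose initial path is bounded and
Hölder with constant `M`. No bound on the Hölder constant of the whole path is recorded. -/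
structure DelayPath (T r θ M : ℝ) (b : ℝ → E → E) (σ : ℝ → E → Fin m → E) (g : Fin m → ℝ → ℝ)
    (x : ℝ → E) : Prop where
  eq : IncrementEq T r b σ g x
  init : HolderNormLe M θ (-r) 0 x
  holder : ∃ C, 0 ≤ C ∧ HolderBound C θ (Icc (-r) T) x

/-- `Δ` is a time step on which the terms of the equation proportional to the path are small. -/
structure SmallStep (m : ℕ) (θ ν M G Δ : ℝ) : Prop where
  pos : 0 < Δ
  le_one : Δ ≤ 1
  drift : M * Δ ≤ 1 / 16
  sup : m * G * M * Δ ^ ν ≤ 1 / 16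
  holder : m * G * (youngConst (θ + ν) * M) * Δ ^ ν ≤ 1 / 4

theorem rpow_le_mul_rpow_of_le {h L a θ : ℝ} (hh : 0 ≤ h) (hL : h ≤ L) (hθ : 0 < θ) (ha : θ ≤ a) :
    h ^ a ≤ L ^ (a - θ) * h ^ θ := by
  rcases hh.eq_or_lt with rfl | hh
  · rw [Real.zero_rpow (hθ.trans_le ha).ne', Real.zero_rpow hθ.ne', mul_zero]
  · calc h ^ a = h ^ (a - θ) * h ^ θ := by rw [← Real.rpow_add hh]; ring_nf
      _ ≤ L ^ (a - θ) * h ^ θ := by gcongr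

namespace SmallStep

variable {Δ y : ℝ}

theorem one_le_rpow_neg (hΔ : SmallStep m θ ν M G Δ) (hθ : 0 ≤ θ) : 1 ≤ Δ ^ (-θ) := by
  rw [Real.rpow_neg hΔ.pos.le]
  exact (one_le_inv₀ (Real.rpow_pos_of_pos hΔ.pos _)).2 (Real.rpow_le_one hΔ.pos.le hΔ.le_one hθ)

theorem rpow_le (hΔ : SmallStep m θ ν M G Δ) {a : ℝ} (hθ : 0 < θ) (ha : θ ≤ a) (hy : 0 ≤ y)
    (hyΔ : y ≤ Δ) : y ^ a ≤ Δ ^ a * (Δ ^ (-θ) * y ^ θ) := by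
  rw [← mul_assoc, ← Real.rpow_add hΔ.pos]
  exact rpow_le_mul_rpow_of_le hy hyΔ hθ ha

theorem increment_le (hΔ : SmallStep m θ ν M G Δ) (hp : YoungPair θ ν) (hM : 1 ≤ M) (hG : 0 ≤ G)
    (hA : 0 ≤ A) (hB : 0 ≤ B) (hy : 0 ≤ y) (hyΔ : y ≤ Δ) :
    M * A * y + M * y ^ (1 / 2 : ℝ) +
      m * (G * (M * (1 + A) + youngConst (θ + ν) * (M * (1 + B)) * y ^ θ) * y ^ ν) ≤
      ((A / 8 + 2 * M) * Δ ^ (-θ) + 1 / 4 * B) * y ^ θ := by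
  have hθ := hp.pos_left
  have hY := youngConst_nonneg hp.one_lt
  have hD := hΔ.one_le_rpow_neg hθ.le
  set D := Δ ^ (-θ)
  have hy_one := hΔ.rpow_le (a := 1) hθ (by linarith [hp.le_half]) hy hyΔ
  rw [Real.rpow_one, Real.rpow_one] at hy_one
  have hy_half := hΔ.rpow_le hθ hp.le_half hy hyΔ
  have hy_nu := hΔ.rpow_le hθ (hp.le_half.trans hp.half_lt_right.le) hy hyΔ
  have hz : 0 ≤ y ^ θ := Real.rpow_nonneg hy _
  have drift : M * A * y ≤ A / 16 * (D * y ^ θ) := by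
    calc M * A * y ≤ M * A * (Δ * (D * y ^ θ)) := by gcongr
      _ = M * Δ * (A * (D * y ^ θ)) := by ring
      _ ≤ 1 / 16 * (A * (D * y ^ θ)) := by gcongr; exact hΔ.drift
      _ = _ := by ring
  have inhomogeneity : M * y ^ (1 / 2 : ℝ) ≤ M * (D * y ^ θ) := by
    have : Δ ^ (1 / 2 : ℝ) ≤ 1 := Real.rpow_le_one hΔ.pos.le hΔ.le_one (by norm_num)
    calc M * y ^ (1 / 2 : ℝ) ≤ M * (Δ ^ (1 / 2 : ℝ) * (D * y ^ θ)) := by gcongr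
      _ ≤ M * (1 * (D * y ^ θ)) := by gcongr
      _ = _ := by ring
  have sup : m * G * M * (1 + A) * y ^ ν ≤ 1 / 16 * (1 + A) * (D * y ^ θ) := by
    calc m * G * M * (1 + A) * y ^ ν ≤ m * G * M * (1 + A) * (Δ ^ ν * (D * y ^ θ)) := by gcongr
      _ = m * G * M * Δ ^ ν * ((1 + A) * (D * y ^ θ)) := by ring
      _ ≤ 1 / 16 * ((1 + A) * (D * y ^ θ)) := by gcongr; exact hΔ.sup
      _ = _ := by ring
  have young : m * G * (youngConst (θ + ν) * M) * (1 + B) * y ^ ν * y ^ θ ≤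
      (1 / 4 * D + 1 / 4 * B) * y ^ θ := by
    calc m * G * (youngConst (θ + ν) * M) * (1 + B) * y ^ ν * y ^ θ
        ≤ m * G * (youngConst (θ + ν) * M) * (1 + B) * Δ ^ ν * y ^ θ := by
          gcongr; exact hp.pos_right.le
      _ = m * G * (youngConst (θ + ν) * M) * Δ ^ ν * ((1 + B) * y ^ θ) := by ring
      _ ≤ 1 / 4 * ((1 + B) * y ^ θ) := by gcongr; exact hΔ.holder
      _ ≤ 1 / 4 * ((D + B) * y ^ θ) := by gcongr
      _ = _ := by ring
  have : D * y ^ θ ≤ M * (D * y ^ θ) := le_mul_of_one_le_left (by positivity) hM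
  nlinarith

end SmallStep

variable {Δ τ : ℝ}

theorem DelayPath.holderAtScale_of_nonneg (hx : DelayPath T r θ M b σ g x)
    (h : CoeffBounds T θ M b σ b₀) (hr : 0 ≤ r) (hp : YoungPair θ ν) (hg : HolderDriver T ν G g)
    (hΔ : SmallStep m θ ν M G Δ) (hτT : τ ≤ T) (hA₀ : 0 ≤ A) (hA : ∀ u ∈ Icc (-r) τ, ‖x u‖ ≤ A)
    (hB : 0 ≤ B) (hBx : HolderAtScale Δ B θ (Icc (-r) τ) x) :
    HolderAtScale Δ ((A / 8 + 2 * M) * Δ ^ (-θ) + 1 / 4 * B) θ (Icc 0 τ) x := by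
  intro u hu v hv huv hvΔ
  rcases huv.eq_or_lt with rfl | huv
  · simp [Real.zero_rpow hp.pos_left.ne']
  have hdelay : HolderBound B θ (Ioc (u - r) (v - r)) x := fun w hw z hz hwz =>
    hBx ⟨by linarith [hu.1, hw.1], by linarith [hv.2, hw.2]⟩
      ⟨by linarith [hu.1, hz.1], by linarith [hv.2, hz.2]⟩ hwz (by linarith [hw.1, hz.2])
  have hincr := hx.eq.norm_sub_le h hp.pos_left.le hp.pos_right.le hp.one_lt hg hu.1 huv
    (hv.2.trans hτT) (fun w hw => hA w ⟨by linarith [hu.1, hw.1], by linarith [hw.2, hv.2]⟩)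
    (hA _ ⟨by linarith [hv.1], by linarith [hv.2]⟩) hdelay
  have hhalf := h.half u v hu.1 huv.le (hv.2.trans hτT)
  have := hΔ.increment_le hp h.one_le hg.nonneg hA₀ hB (sub_nonneg.2 huv.le) hvΔ
  linarith

theorem DelayPath.holderAtScale (hx : DelayPath T r θ M b σ g x) (h : CoeffBounds T θ M b σ b₀)
    (hr : 0 ≤ r) (hp : YoungPair θ ν) (hg : HolderDriver T ν G g) (hΔ : SmallStep m θ ν M G Δ)
    (hτT : τ ≤ T) (hA₀ : 0 ≤ A) (hA : ∀ u ∈ Icc (-r) τ, ‖x u‖ ≤ A) :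
    HolderAtScale Δ ((A / 6 + 4 * M) * Δ ^ (-θ)) θ (Icc (-r) τ) x := by
  have hM := h.const_nonneg
  have hD := hΔ.one_le_rpow_neg hp.pos_left.le
  set D := Δ ^ (-θ)
  obtain ⟨C, hC, hCx⟩ := hx.holder
  have hstart : HolderAtScale Δ C θ (Icc (-r) τ) x := fun u hu v hv huv _ =>
    hCx ⟨hu.1, hu.2.trans hτT⟩ ⟨hv.1, hv.2.trans hτT⟩ huv
  have hfix := (fixedPoint_mem_of_mapsTo (K := (A / 8 + 3 * M) * D) (q := 1 / 4)
    (isClosed_setOf_holderAtScale Δ θ (Icc (-r) τ) x) ⟨C, hC, hstart⟩ (by norm_num) (by norm_num)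
    fun B ⟨hB, hBx⟩ => ⟨by positivity, ?_⟩).2
  · rwa [show (A / 8 + 3 * M) * D / (1 - 1 / 4) = (A / 6 + 4 * M) * D by ring] at hfix
  · have hpaste := hx.init.holder.trans_holderAtScale hp.pos_left.le hM (by positivity)
      (hx.holderAtScale_of_nonneg h hr hp hg hΔ hτT hA₀ hA hB hBx)
    intro u hu v hv huv hvΔ
    refine (hpaste hu hv huv hvΔ).trans (mul_le_mul_of_nonneg_right ?_
      (Real.rpow_nonneg (sub_nonneg.2 huv) _))
    linarith [le_mul_of_one_le_right hM hD]

end APriori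

section Growth

variable {E : Type*} [NormedAddCommGroup E] [NormedSpace ℝ E] {m : ℕ}
variable {T θ M r ν G Δ τ A : ℝ} {b : ℝ → E → E} {σ : ℝ → E → Fin m → E} {b₀ : ℝ → ℝ}
  {g : Fin m → ℝ → ℝ} {x : ℝ → E}

theorem DelayPath.exists_norm_le (hx : DelayPath T r θ M b σ g x) (hr : 0 ≤ r) (hT : 0 ≤ T)
    (hθ : 0 ≤ θ) : ∃ B, 0 ≤ B ∧ ∀ t ∈ Icc (-r) T, ‖x t‖ ≤ B := by
  obtain ⟨C, hC, hCx⟩ := hx.holder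
  have : 0 ≤ T + r := by linarith
  refine ⟨‖x (-r)‖ + C * (T + r) ^ θ, by positivity, fun t ht => ?_⟩
  calc ‖x t‖ ≤ ‖x (-r)‖ + ‖x t - x (-r)‖ := norm_le_norm_add_norm_sub' _ _
    _ ≤ ‖x (-r)‖ + C * (t - -r) ^ θ := by gcongr; exact hCx ⟨le_rfl, by linarith⟩ ht ht.1
    _ ≤ ‖x (-r)‖ + C * (T + r) ^ θ := by
      gcongr
      · linarith [ht.1]
      · linarith [ht.2]

/-- Over a small time step the increment of the path is at most a fraction of its supremum. -/
theorem DelayPath.norm_le_step (hx : DelayPath T r θ M b σ g x) (h : CoeffBounds T θ M b σ b₀)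
    (hr : 0 ≤ r) (hp : YoungPair θ ν) (hg : HolderDriver T ν G g) (hΔ : SmallStep m θ ν M G Δ)
    (hτ : 0 ≤ τ) (hτT : τ ≤ T) (hA : ∀ u ∈ Icc (-r) τ, ‖x u‖ ≤ A) :
    ∀ u ∈ Icc (-r) (min (τ + Δ) T), ‖x u‖ ≤ 2 * A + 5 * M := by
  have hM := h.const_nonneg
  have hA₀ : 0 ≤ A := (norm_nonneg _).trans (hA 0 ⟨by linarith, hτ⟩)
  obtain ⟨B₀, hB₀, hB₀x⟩ := hx.exists_norm_le hr (hτ.trans hτT) hp.pos_left.le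
  have hfix := (fixedPoint_mem_of_mapsTo (K := A + 4 * M) (q := 1 / 6)
    (isClosed_setOf_forall_le_mul (fun u : Icc (-r) (min (τ + Δ) T) => ‖x u‖) fun _ => 1)
    ⟨B₀, hB₀, fun u => ?_⟩ (by norm_num) (by norm_num) fun B ⟨hB, hBx⟩ =>
      ⟨by positivity, fun u => ?_⟩).2
  · refine fun u hu => (hfix ⟨u, hu⟩).trans ?_
    rw [mul_one, show (A + 4 * M) / (1 - 1 / 6) = 6 / 5 * (A + 4 * M) by ring]
    linarith
  · simpa only [mul_one] using hB₀x u ⟨u.2.1, u.2.2.trans (min_le_right _ _)⟩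
  · simp only [mul_one, Subtype.forall] at hBx ⊢
    obtain ⟨u, hu⟩ := u
    rcases le_total u τ with huτ | hτu
    · exact (hA u ⟨hu.1, huτ⟩).trans (by linarith)
    · have hstep : u - τ ≤ Δ := by linarith [hu.2.trans (min_le_left _ _)]
      have hincr : ‖x u - x τ‖ ≤ (B / 6 + 4 * M) * Δ ^ (-θ) * (u - τ) ^ θ :=
        hx.holderAtScale h hr hp hg hΔ (min_le_right _ _) hB hBx ⟨by linarith, hτu.trans hu.2⟩ hu
          hτu hstep
      have hscale : Δ ^ (-θ) * (u - τ) ^ θ ≤ 1 := by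
        rw [Real.rpow_neg hΔ.pos.le]
        exact inv_mul_le_one_of_le₀ (Real.rpow_le_rpow (by linarith) hstep hp.pos_left.le)
          (Real.rpow_nonneg hΔ.pos.le _)
      calc ‖x u‖ ≤ ‖x τ‖ + ‖x u - x τ‖ := norm_le_norm_add_norm_sub' _ _
        _ ≤ A + (B / 6 + 4 * M) * (Δ ^ (-θ) * (u - τ) ^ θ) := by
          rw [← mul_assoc]; exact add_le_add (hA τ ⟨by linarith, le_rfl⟩) hincr
        _ ≤ A + (B / 6 + 4 * M) * 1 := by gcongr
        _ = A + 4 * M + 1 / 6 * B := by ring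

theorem DelayPath.norm_le_iterate (hx : DelayPath T r θ M b σ g x) (h : CoeffBounds T θ M b σ b₀)
    (hr : 0 ≤ r) (hT : 0 ≤ T) (hp : YoungPair θ ν) (hg : HolderDriver T ν G g)
    (hΔ : SmallStep m θ ν M G Δ) (n : ℕ) :
    ∀ u ∈ Icc (-r) (min (n * Δ) T), ‖x u‖ ≤ 6 * M * 2 ^ n - 5 * M := by
  have hΔ₀ := hΔ.pos
  induction n with
  | zero =>
    intro u hu
    refine (hx.init.norm_le u ⟨hu.1, hu.2.trans ((min_le_left _ _).trans_eq ?_)⟩).trans_eq ?_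
    · simp
    · ring
  | succ n ih =>
    have hmin : min (min (n * Δ) T + Δ) T = min (((n + 1 : ℕ) : ℝ) * Δ) T := by
      rw [← min_add_add_right, min_assoc, min_eq_right (by linarith : T ≤ T + Δ)]
      push_cast
      ring_nf
    rw [← hmin]
    intro u hu
    refine (hx.norm_le_step h hr hp hg hΔ (le_min (by positivity) hT) (min_le_right _ _) ih u
      hu).trans_eq ?_
    ring

theorem two_pow_ceil_le_exp {y : ℝ} (hy : 0 ≤ y) :
    (2 : ℝ) ^ ⌈y⌉₊ ≤ Real.exp 1 * Real.exp y := by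
  calc (2 : ℝ) ^ ⌈y⌉₊ ≤ Real.exp 1 ^ ⌈y⌉₊ := by
        gcongr
        linarith [Real.add_one_le_exp (1 : ℝ)]
    _ = Real.exp ⌈y⌉₊ := by rw [← Real.exp_nat_mul, mul_one]
    _ ≤ Real.exp (1 + y) := Real.exp_le_exp.2 (by linarith [Nat.ceil_lt_add_one hy])
    _ = _ := Real.exp_add _ _

theorem DelayPath.norm_le_exp (hx : DelayPath T r θ M b σ g x) (h : CoeffBounds T θ M b σ b₀)
    (hr : 0 ≤ r) (hT : 0 ≤ T) (hp : YoungPair θ ν) (hg : HolderDriver T ν G g)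
    (hΔ : SmallStep m θ ν M G Δ) {t : ℝ} (ht : t ∈ Icc (-r) T) :
    ‖x t‖ ≤ 6 * M * (Real.exp 1 * Real.exp (T / Δ)) := by
  have hM := h.const_nonneg
  have hcover : T ≤ ⌈T / Δ⌉₊ * Δ := (div_le_iff₀ hΔ.pos).1 (Nat.le_ceil _)
  calc ‖x t‖ ≤ 6 * M * 2 ^ ⌈T / Δ⌉₊ - 5 * M :=
        hx.norm_le_iterate h hr hT hp hg hΔ _ t ⟨ht.1, le_min (ht.2.trans hcover) ht.2⟩
    _ ≤ 6 * M * 2 ^ ⌈T / Δ⌉₊ := by linarith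
    _ ≤ _ := by
      gcongr
      exact two_pow_ceil_le_exp (div_nonneg hT hΔ.pos.le)

theorem SmallStep.rpow_neg_le_exp (hΔ : SmallStep m θ ν M G Δ) (hθ : θ ≤ 1) :
    Δ ^ (-θ) ≤ Real.exp (1 / Δ) := by
  calc Δ ^ (-θ) = (1 / Δ) ^ θ := by
        rw [one_div, Real.inv_rpow hΔ.pos.le, Real.rpow_neg hΔ.pos.le]
    _ ≤ (1 / Δ) ^ (1 : ℝ) :=
        Real.rpow_le_rpow_of_exponent_le ((one_le_div hΔ.pos).2 hΔ.le_one) hθ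
    _ = 1 / Δ := Real.rpow_one _
    _ ≤ Real.exp (1 / Δ) := by linarith [Real.add_one_le_exp (1 / Δ)]

theorem DelayPath.holderNormLe_of_smallStep (hx : DelayPath T r θ M b σ g x)
    (h : CoeffBounds T θ M b σ b₀) (hr : 0 ≤ r) (hT : 0 ≤ T) (hp : YoungPair θ ν)
    (hg : HolderDriver T ν G g) (hΔ : SmallStep m θ ν M G Δ) :
    HolderNormLe ((12 * Real.exp 1 + 4) * M * Real.exp ((T + 1) / Δ)) θ (-r) T x := by
  have hM := h.const_nonneg
  set A := 6 * M * (Real.exp 1 * Real.exp (T / Δ)) with hA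
  have hA₀ : 0 ≤ A := by positivity
  have hD : 0 ≤ Δ ^ (-θ) := Real.rpow_nonneg hΔ.pos.le _
  have hsup : ∀ t ∈ Icc (-r) T, ‖x t‖ ≤ A := fun t ht => hx.norm_le_exp h hr hT hp hg hΔ ht
  have hlocal := hx.holderAtScale h hr hp hg hΔ le_rfl hA₀ hsup
  have hexp : 1 ≤ Real.exp (T / Δ) := Real.one_le_exp (div_nonneg hT hΔ.pos.le)
  have hconst : (2 * A + 4 * M) * Real.exp (1 / Δ) ≤
      (12 * Real.exp 1 + 4) * M * Real.exp ((T + 1) / Δ) := by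
    have : 2 * A + 4 * M ≤ (12 * Real.exp 1 + 4) * M * Real.exp (T / Δ) := by
      rw [hA]
      linarith [le_mul_of_one_le_right hM hexp]
    rw [add_div, Real.exp_add]
    exact (mul_le_mul_of_nonneg_right this (Real.exp_pos _).le).trans_eq (mul_assoc _ _ _)
  have hglobal : HolderBound ((2 * A + 4 * M) * Δ ^ (-θ)) θ (Icc (-r) T) x := by
    refine HolderAtScale.holderBound (fun u hu v hv huv hΔuv =>
      (hlocal hu hv huv hΔuv).trans ?_) hΔ.pos hp.pos_left.le hsup (by gcongr; linarith)
    have : 0 ≤ (v - u) ^ θ := Real.rpow_nonneg (sub_nonneg.2 huv) _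
    gcongr
    linarith
  refine ⟨fun t ht => (hsup t ht).trans (le_trans ?_ hconst), hglobal.weaken (le_trans ?_ hconst)⟩
  · have : 1 ≤ Real.exp (1 / Δ) := Real.one_le_exp (one_div_nonneg.2 hΔ.pos.le)
    nlinarith
  · gcongr
    exact hΔ.rpow_neg_le_exp (by linarith [hp.le_half])

/-- The reciprocal of `timeStep` for `G = 0`, raised to the power `ν`. -/
def stepRate (m : ℕ) (θ ν M : ℝ) : ℝ := 16 * M * (m + 1) * (youngConst (θ + ν) + 1)

/-- The largest time step, up to a constant factor, on which a driver with Hölder constant `G`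
contributes only a fraction of the path. -/
def timeStep (m : ℕ) (θ ν M G : ℝ) : ℝ := ((stepRate m θ ν M * (1 + G)) ^ (1 / ν))⁻¹

/-- The growth of the a priori bounds in the Hölder constant `G` of the driver. -/
def growthBound (C ν G : ℝ) : ℝ := C * Real.exp (C * (1 + G) ^ (1 / ν))

theorem growthBound_mono {C C' : ℝ} (hC : 0 ≤ C) (hCC' : C ≤ C') (hG : 0 ≤ 1 + G) :
    growthBound C ν G ≤ growthBound C' ν G := by
  unfold growthBound
  gcongr
  exact hC.trans hCC'

theorem sixteen_le_stepRate (m : ℕ) (hθν : 1 < θ + ν) (hM : 1 ≤ M) : 16 * M ≤ stepRate m θ ν M := by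
  have := youngConst_nonneg hθν
  have hm : (1 : ℝ) ≤ m + 1 := by linarith [(Nat.cast_nonneg m : (0 : ℝ) ≤ m)]
  calc 16 * M = 16 * M * 1 * 1 := by ring
    _ ≤ 16 * M * (m + 1) * (youngConst (θ + ν) + 1) := by gcongr; linarith

theorem smallStep_timeStep (m : ℕ) (hp : YoungPair θ ν) (hM : 1 ≤ M) (hG : 0 ≤ G) :
    SmallStep m θ ν M G (timeStep m θ ν M G) := by
  have hY := youngConst_nonneg hp.one_lt
  have hk16 := sixteen_le_stepRate m hp.one_lt hM
  have hν := hp.pos_right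
  set k := stepRate m θ ν M with hk
  set Δ := timeStep m θ ν M G with hΔ
  have hk₀ : 0 < k := by linarith
  have hΔ₀ : 0 < Δ := by rw [hΔ, timeStep]; positivity
  have hΔν : Δ ^ ν = (k * (1 + G))⁻¹ := by
    rw [hΔ, timeStep, Real.inv_rpow (by positivity), ← Real.rpow_mul (by positivity),
      one_div_mul_cancel hν.ne', Real.rpow_one]
  have hkG : k ≤ k * (1 + G) := le_mul_of_one_le_right hk₀.le (by linarith)
  have hΔk : Δ ≤ k⁻¹ := by
    refine inv_anti₀ hk₀ (hkG.trans (Real.self_le_rpow_of_one_le (by linarith) ?_))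
    rw [le_div_iff₀ hν, one_mul]
    exact hp.le_one
  have hGΔ : G * Δ ^ ν ≤ k⁻¹ := by
    rw [hΔν, mul_inv, mul_left_comm, ← div_eq_mul_inv G]
    exact mul_le_of_le_one_right (by positivity) ((div_le_one (by positivity)).2 (by linarith))
  have hfrac : ∀ {a q : ℝ}, a ≤ q * k → a * k⁻¹ ≤ q := fun h => (mul_inv_le_iff₀ hk₀).2 h
  rw [stepRate] at hk
  refine ⟨hΔ₀, hΔk.trans (inv_le_one_of_one_le₀ (by linarith)), ?_, ?_, ?_⟩
  · exact (mul_le_mul_of_nonneg_left hΔk (by positivity)).trans (hfrac (by linarith))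
  · calc m * G * M * Δ ^ ν = m * M * (G * Δ ^ ν) := by ring
      _ ≤ m * M * k⁻¹ := by gcongr
      _ ≤ 1 / 16 := hfrac ?_
    have : 0 ≤ M * (m * youngConst (θ + ν) + youngConst (θ + ν) + 1) := by positivity
    linarith
  · calc m * G * (youngConst (θ + ν) * M) * Δ ^ ν = m * (youngConst (θ + ν) * M) * (G * Δ ^ ν) := by
          ring
      _ ≤ m * (youngConst (θ + ν) * M) * k⁻¹ := by gcongr
      _ ≤ 1 / 4 := hfrac ?_
    have : 0 ≤ M * (3 * (m * youngConst (θ + ν)) + 4 * m + 4 * youngConst (θ + ν) + 4) := by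
      positivity
    linarith

/-- The constant of the a priori bound on sup and `θ`-Hölder norms. -/
def aprioriConst (m : ℕ) (T θ ν M : ℝ) : ℝ :=
  (12 * Real.exp 1 + 4) * M + (T + 1) * stepRate m θ ν M ^ (1 / ν)

theorem one_le_aprioriConst (m : ℕ) (hT : 0 ≤ T) (hθν : 1 < θ + ν) (hM : 1 ≤ M) :
    1 ≤ aprioriConst m T θ ν M := by
  have hk := sixteen_le_stepRate m hθν hM
  have : 0 ≤ stepRate m θ ν M := by linarith
  calc (1 : ℝ) ≤ 4 * M := by linarith
    _ ≤ (12 * Real.exp 1 + 4) * M := by gcongr; linarith [Real.exp_pos 1]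
    _ ≤ aprioriConst m T θ ν M := le_add_of_nonneg_right (by positivity)

theorem DelayPath.holderNormLe (hx : DelayPath T r θ M b σ g x) (h : CoeffBounds T θ M b σ b₀)
    (hr : 0 ≤ r) (hT : 0 ≤ T) (hp : YoungPair θ ν) (hg : HolderDriver T ν G g) :
    HolderNormLe (growthBound (aprioriConst m T θ ν M) ν G) θ (-r) T x := by
  have hM := h.const_nonneg
  have hG := hg.nonneg
  have hk₀ : 0 ≤ stepRate m θ ν M := by linarith [sixteen_le_stepRate m hp.one_lt h.one_le]
  have hbound := hx.holderNormLe_of_smallStep h hr hT hp hg (smallStep_timeStep m hp h.one_le hG)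
  have hle : (12 * Real.exp 1 + 4) * M * Real.exp ((T + 1) / timeStep m θ ν M G) ≤
      growthBound (aprioriConst m T θ ν M) ν G := by
    unfold growthBound aprioriConst timeStep
    rw [div_inv_eq_mul, Real.mul_rpow hk₀ (by linarith), ← mul_assoc]
    gcongr
    · exact le_add_of_nonneg_right (by positivity)
    · exact le_add_of_nonneg_left (by positivity)
  exact ⟨fun t ht => (hbound.norm_le t ht).trans hle, hbound.holder.weaken hle⟩

theorem DelayPath.norm_sub_le (hx : DelayPath T r θ M b σ g x) (h : CoeffBounds T θ M b σ b₀)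
    (hr : 0 ≤ r) (hθ : 0 ≤ θ) (hν : 0 < ν) (hθν : 1 < θ + ν) (hg : HolderDriver T ν G g) {R : ℝ}
    (hR₀ : 0 ≤ R) (hR : HolderNormLe R θ (-r) T x) {s t : ℝ} (hs : 0 ≤ s) (hst : s ≤ t)
    (ht : t ≤ T) :
    ‖x t - x s‖ ≤ M * R * (t - s) + (∫ u in s..t, b₀ u) +
      m * (G * (M * (1 + R) * (1 + youngConst (θ + ν) * T ^ θ)) * (t - s) ^ ν) := by
  have hM := h.const_nonneg
  have hY := youngConst_nonneg hθν
  have hG := hg.nonneg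
  rcases hst.eq_or_lt with rfl | hst
  · simp [Real.zero_rpow hν.ne']
  refine (hx.eq.norm_sub_le h hθ hν.le hθν hg hs hst ht
    (fun u hu => hR.norm_le u ⟨by linarith [hu.1], hu.2.trans ht⟩)
    (hR.norm_le _ ⟨by linarith, by linarith⟩) (hR.holder.mono fun u hu =>
      ⟨by linarith [hu.1], by linarith [hu.2]⟩)).trans ?_
  have : 0 ≤ (t - s) ^ ν := Real.rpow_nonneg (by linarith) _
  gcongr
  calc M * (1 + R) + youngConst (θ + ν) * (M * (1 + R)) * (t - s) ^ θ
      = M * (1 + R) * (1 + youngConst (θ + ν) * (t - s) ^ θ) := by ring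
    _ ≤ M * (1 + R) * (1 + youngConst (θ + ν) * T ^ θ) := by
      gcongr
      linarith

/-- Compares the increments of a solution with `(t - s) ^ (1 / 2)`. -/
def halfFactor (m : ℕ) (T θ ν M : ℝ) : ℝ :=
  M * T ^ (1 / 2 : ℝ) + M + 2 * m * M * (1 + youngConst (θ + ν) * T ^ θ) * T ^ (ν - 1 / 2)

/-- The constant of the a priori bound on the `1 / 2`-Hölder norm. -/
def halfConst (m : ℕ) (T θ ν M : ℝ) : ℝ :=
  (aprioriConst m T θ ν M + 1) * (halfFactor m T θ ν M + 1)

theorem halfFactor_nonneg (m : ℕ) (hT : 0 ≤ T) (hθν : 1 < θ + ν) (hM : 0 ≤ M) :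
    0 ≤ halfFactor m T θ ν M := by
  have := youngConst_nonneg hθν
  unfold halfFactor
  positivity

theorem increment_le_halfFactor {R y : ℝ} (hp : YoungPair θ ν) (hM : 0 ≤ M) (hR : 1 ≤ R)
    (hG : 0 ≤ G) (hy : 0 ≤ y) (hyT : y ≤ T) :
    M * R * y + M * y ^ (1 / 2 : ℝ) +
      m * (G * (M * (1 + R) * (1 + youngConst (θ + ν) * T ^ θ)) * y ^ ν) ≤
      R * (1 + G) * halfFactor m T θ ν M * y ^ (1 / 2 : ℝ) := by
  have hY := youngConst_nonneg hp.one_lt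
  have hT : 0 ≤ T := hy.trans hyT
  have hy_one := rpow_le_mul_rpow_of_le (a := 1) (θ := 1 / 2) hy hyT (by norm_num) (by norm_num)
  rw [Real.rpow_one, show (1 : ℝ) - 1 / 2 = 1 / 2 by norm_num] at hy_one
  have hy_nu := rpow_le_mul_rpow_of_le (a := ν) (θ := 1 / 2) hy hyT (by norm_num)
    hp.half_lt_right.le
  set w := y ^ (1 / 2 : ℝ)
  have : 0 ≤ w := Real.rpow_nonneg hy _
  have hG₁ : 1 ≤ 1 + G := by linarith
  have drift : M * R * y ≤ R * (1 + G) * (M * T ^ (1 / 2 : ℝ)) * w := by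
    calc M * R * y ≤ M * R * (T ^ (1 / 2 : ℝ) * w) := by gcongr
      _ = R * 1 * (M * T ^ (1 / 2 : ℝ)) * w := by ring
      _ ≤ _ := by gcongr
  have inhomogeneity : M * w ≤ R * (1 + G) * M * w := by
    calc M * w = 1 * 1 * M * w := by ring
      _ ≤ _ := by gcongr
  have young : m * (G * (M * (1 + R) * (1 + youngConst (θ + ν) * T ^ θ)) * y ^ ν) ≤
      R * (1 + G) * (2 * m * M * (1 + youngConst (θ + ν) * T ^ θ) * T ^ (ν - 1 / 2)) * w := by
    calc m * (G * (M * (1 + R) * (1 + youngConst (θ + ν) * T ^ θ)) * y ^ ν)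
        ≤ m * ((1 + G) * (M * (R + R) * (1 + youngConst (θ + ν) * T ^ θ)) *
            (T ^ (ν - 1 / 2) * w)) := by gcongr; linarith
      _ = _ := by ring
  unfold halfFactor
  linarith

theorem one_le_growthBound {C : ℝ} (hC : 1 ≤ C) (hG : 0 ≤ 1 + G) : 1 ≤ growthBound C ν G :=
  one_le_mul_of_one_le_of_one_le hC
    (Real.one_le_exp (mul_nonneg (zero_le_one.trans hC) (Real.rpow_nonneg hG _)))

theorem growthBound_mul_one_add_le {C : ℝ} (hν : 0 < ν) (hν1 : ν ≤ 1) (hC : 0 ≤ C) (hG : 0 ≤ G) :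
    growthBound C ν G * (1 + G) ≤ growthBound (C + 1) ν G := by
  set z := (1 + G) ^ (1 / ν)
  have hGz : 1 + G ≤ Real.exp z := by
    have : 1 + G ≤ z := Real.self_le_rpow_of_one_le (by linarith) ((one_le_div hν).2 hν1)
    linarith [Real.add_one_le_exp z]
  calc growthBound C ν G * (1 + G) ≤ C * Real.exp (C * z) * Real.exp z := by
        unfold growthBound; gcongr
    _ = C * Real.exp ((C + 1) * z) := by rw [mul_assoc, ← Real.exp_add, add_mul, one_mul]
    _ ≤ growthBound (C + 1) ν G := by unfold growthBound; gcongr; linarith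

theorem growthBound_mul_le {C K : ℝ} (hC : 0 ≤ C) (hK : 0 ≤ K) (hG : 0 ≤ 1 + G) :
    growthBound C ν G * K ≤ growthBound (C * (K + 1)) ν G := by
  have : 0 ≤ (1 + G) ^ (1 / ν) := Real.rpow_nonneg hG _
  calc growthBound C ν G * K = C * K * Real.exp (C * (1 + G) ^ (1 / ν)) := mul_right_comm _ _ _
    _ ≤ growthBound (C * (K + 1)) ν G := by
        unfold growthBound
        gcongr
        · linarith
        · exact le_mul_of_one_le_right hC (by linarith)

theorem DelayPath.holderBound_half (hx : DelayPath T r θ M b σ g x)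
    (h : CoeffBounds T θ M b σ b₀) (hr : 0 ≤ r) (hT : 0 ≤ T) (hp : YoungPair θ ν)
    (hg : HolderDriver T ν G g) :
    HolderBound (growthBound (halfConst m T θ ν M) ν G) (1 / 2) (Icc 0 T) x := by
  have hG := hg.nonneg
  have hapriori := hx.holderNormLe h hr hT hp hg
  have hC := one_le_aprioriConst m hT hp.one_lt h.one_le
  have hK := halfFactor_nonneg m hT hp.one_lt h.const_nonneg
  set C := aprioriConst m T θ ν M
  set K := halfFactor m T θ ν M
  have hR : 1 ≤ growthBound C ν G := one_le_growthBound hC (by linarith)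
  intro s hs t ht hst
  have : 0 ≤ (t - s) ^ (1 / 2 : ℝ) := Real.rpow_nonneg (sub_nonneg.2 hst) _
  have hincr := hx.norm_sub_le h hr hp.pos_left.le hp.pos_right hp.one_lt hg (by linarith) hapriori
    hs.1 hst ht.2
  have hhalf := h.half s t hs.1 hst ht.2
  calc ‖x t - x s‖ ≤ growthBound C ν G * (1 + G) * K * (t - s) ^ (1 / 2 : ℝ) := by
        have := increment_le_halfFactor (T := T) (θ := θ) (m := m) hp h.const_nonneg hR hG
          (sub_nonneg.2 hst) (by linarith [hs.1, ht.2])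
        linarith
    _ ≤ growthBound (C + 1) ν G * K * (t - s) ^ (1 / 2 : ℝ) := by
        gcongr; exact growthBound_mul_one_add_le hp.pos_right hp.le_one (by linarith) hG
    _ ≤ growthBound (halfConst m T θ ν M) ν G * (t - s) ^ (1 / 2 : ℝ) := by
        gcongr
        exact growthBound_mul_le (by linarith) hK (by linarith)

end Growth

section Stability

variable {E : Type*} [NormedAddCommGroup E] {m : ℕ}
variable {T θ δ N M M' s t : ℝ} {b : ℝ → E → E} {σ : ℝ → E → Fin m → E} {b₀ : ℝ → ℝ}

/-- The clock in which solutions are Hölder continuous with the exponent of the driving path. -/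
def clock (b₀ : ℝ → ℝ) (t : ℝ) : ℝ := t + ∫ u in (0 : ℝ)..t, b₀ u

theorem CoeffBounds.clock_sub (h : CoeffBounds T θ M b σ b₀) (hs : 0 ≤ s) (hst : s ≤ t)
    (ht : t ≤ T) : clock b₀ t - clock b₀ s = (t - s) + ∫ u in s..t, b₀ u := by
  rw [clock, clock, ← intervalIntegral.integral_interval_sub_left
    (h.intervalIntegrable le_rfl (hs.trans hst) ht)
    (h.intervalIntegrable le_rfl hs (hst.trans ht))]
  ring

theorem CoeffBounds.isClock (h : CoeffBounds T θ M b σ b₀) : IsClock (clock b₀) 0 T where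
  continuousOn := by
    rcases le_total 0 T with hT | hT
    · have := intervalIntegral.continuousOn_primitive_interval' h.integrable left_mem_uIcc
      rw [uIcc_of_le hT] at this
      exact continuousOn_id.add this
    · exact (subsingleton_Icc_of_ge hT).continuousOn _
  sub_le_sub u hu v hv huv := by
    have : 0 ≤ ∫ w in u..v, b₀ w := intervalIntegral.integral_nonneg huv fun w hw =>
      h.nonneg w ⟨hu.1.trans hw.1, hw.2.trans hv.2⟩
    linarith [h.clock_sub hu.1 huv hv.2]

variable [NormedSpace ℝ E]

/-- The local regularity of the coefficients used to compare two solutions bounded by `N`. -/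
structure LocalBounds (T θ δ N M : ℝ) (b : ℝ → E → E) (σ : ℝ → E → Fin m → E) : Prop where
  nonneg : 0 ≤ M
  differentiable : ∀ t ∈ Icc 0 T, Differentiable ℝ (σ t)
  deriv_time : ∀ s ∈ Icc 0 T, ∀ t ∈ Icc 0 T, ∀ x,
    ‖fderiv ℝ (σ t) x - fderiv ℝ (σ s) x‖ ≤ M * |t - s| ^ θ
  deriv_space : ∀ t ∈ Icc 0 T, ∀ x y, ‖x‖ ≤ N → ‖y‖ ≤ N →
    ‖fderiv ℝ (σ t) x - fderiv ℝ (σ t) y‖ ≤ M * ‖x - y‖ ^ δ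
  drift : ∀ t ∈ Icc 0 T, ∀ x y, ‖x‖ ≤ N → ‖y‖ ≤ N → ‖b t x - b t y‖ ≤ M * ‖x - y‖

theorem CoeffBounds.norm_fderiv_le (h : CoeffBounds T θ M b σ b₀) (ht : t ∈ Icc 0 T) (p : E) :
    ‖fderiv ℝ (σ t) p‖ ≤ M := by
  have hlip : LipschitzWith M.toNNReal (σ t) := LipschitzWith.of_dist_le_mul fun p q => by
    rw [dist_eq_norm, dist_eq_norm, Real.coe_toNNReal _ h.const_nonneg]
    exact h.lip t ht p q
  have := norm_fderiv_le_of_lipschitz ℝ hlip (x₀ := p)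
  rwa [Real.coe_toNNReal _ h.const_nonneg] at this

theorem norm_add_smul_sub_le {p q : E} {z : ℝ} (hp : ‖p‖ ≤ N) (hq : ‖q‖ ≤ N)
    (hz : z ∈ Icc (0 : ℝ) 1) : ‖q + z • (p - q)‖ ≤ N := by
  rw [← mem_closedBall_zero_iff] at *
  exact (convex_closedBall 0 N).add_smul_sub_mem hq hp hz

theorem LocalBounds.norm_fderiv_sub_le (hl : LocalBounds T θ δ N M' b σ) (hδ : 0 ≤ δ)
    {u v ρ : ℝ} (hu : u ∈ Icc 0 T) (hv : v ∈ Icc 0 T) {p q : E} (hp : ‖p‖ ≤ N) (hq : ‖q‖ ≤ N)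
    (hpq : ‖p - q‖ ≤ ρ) :
    ‖fderiv ℝ (σ v) p - fderiv ℝ (σ u) q‖ ≤ M' * (|v - u| ^ θ + ρ ^ δ) := by
  have hM' := hl.nonneg
  calc ‖fderiv ℝ (σ v) p - fderiv ℝ (σ u) q‖
      ≤ ‖fderiv ℝ (σ v) p - fderiv ℝ (σ u) p‖ + ‖fderiv ℝ (σ u) p - fderiv ℝ (σ u) q‖ :=
        norm_sub_le_norm_sub_add_norm_sub _ _ _
    _ ≤ M' * |v - u| ^ θ + M' * ρ ^ δ :=
        add_le_add (hl.deriv_time u hu v hv p)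
          ((hl.deriv_space u hu p q hp hq).trans (by gcongr))
    _ = M' * (|v - u| ^ θ + ρ ^ δ) := (mul_add _ _ _).symm

theorem LocalBounds.hasDerivAt_segment (hl : LocalBounds T θ δ N M' b σ) (ht : t ∈ Icc 0 T)
    (p q : E) (z : ℝ) :
    HasDerivAt (fun z : ℝ => σ t (q + z • p)) (fderiv ℝ (σ t) (q + z • p) p) z := by
  have hline : HasDerivAt (fun z : ℝ => q + z • p) p z := by
    simpa using ((hasDerivAt_id z).smul_const p).const_add q
  exact (hl.differentiable t ht (q + z • p)).hasFDerivAt.comp_hasDerivAt z hline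

theorem LocalBounds.norm_second_difference_le (hl : LocalBounds T θ δ N M' b σ)
    (h : CoeffBounds T θ M b σ b₀) (hδ : 0 ≤ δ) {u v ρ : ℝ} (hu : u ∈ Icc 0 T) (hv : v ∈ Icc 0 T)
    {x₁ y₁ x₀ y₀ : E} (hx₁ : ‖x₁‖ ≤ N) (hy₁ : ‖y₁‖ ≤ N) (hx₀ : ‖x₀‖ ≤ N) (hy₀ : ‖y₀‖ ≤ N)
    (hx : ‖x₁ - x₀‖ ≤ ρ) (hy : ‖y₁ - y₀‖ ≤ ρ) :
    ‖(σ v x₁ - σ v y₁) - (σ u x₀ - σ u y₀)‖ ≤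
      M * ‖(x₁ - y₁) - (x₀ - y₀)‖ + M' * (|v - u| ^ θ + ρ ^ δ) * ‖x₀ - y₀‖ := by
  set F : ℝ → Fin m → E := fun z => σ v (y₁ + z • (x₁ - y₁)) - σ u (y₀ + z • (x₀ - y₀)) with hF
  have hderiv : ∀ z ∈ Icc (0 : ℝ) 1, HasDerivWithinAt F
      (fderiv ℝ (σ v) (y₁ + z • (x₁ - y₁)) (x₁ - y₁) -
        fderiv ℝ (σ u) (y₀ + z • (x₀ - y₀)) (x₀ - y₀)) (Icc 0 1) z := fun z _ =>
    ((hl.hasDerivAt_segment hv _ _ z).sub (hl.hasDerivAt_segment hu _ _ z)).hasDerivWithinAt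
  have hbound : ∀ z ∈ Ico (0 : ℝ) 1,
      ‖fderiv ℝ (σ v) (y₁ + z • (x₁ - y₁)) (x₁ - y₁) -
        fderiv ℝ (σ u) (y₀ + z • (x₀ - y₀)) (x₀ - y₀)‖ ≤
      M * ‖(x₁ - y₁) - (x₀ - y₀)‖ + M' * (|v - u| ^ θ + ρ ^ δ) * ‖x₀ - y₀‖ := by
    intro z hz
    have hz := Ico_subset_Icc_self hz
    have hp₁ := norm_add_smul_sub_le hx₁ hy₁ hz
    have hp₀ := norm_add_smul_sub_le hx₀ hy₀ hz
    have hp : ‖(y₁ + z • (x₁ - y₁)) - (y₀ + z • (x₀ - y₀))‖ ≤ ρ := by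
      convert norm_add_smul_sub_le hx hy hz using 2
      simp only [smul_sub]
      abel
    set p₁ := y₁ + z • (x₁ - y₁)
    set p₀ := y₀ + z • (x₀ - y₀)
    have hsplit : fderiv ℝ (σ v) p₁ (x₁ - y₁) - fderiv ℝ (σ u) p₀ (x₀ - y₀) =
        fderiv ℝ (σ v) p₁ ((x₁ - y₁) - (x₀ - y₀)) +
          (fderiv ℝ (σ v) p₁ - fderiv ℝ (σ u) p₀) (x₀ - y₀) := by
      simp only [map_sub, sub_apply]
      abel
    rw [hsplit]
    exact (norm_add_le _ _).trans (add_le_add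
      (ContinuousLinearMap.le_of_opNorm_le _ (h.norm_fderiv_le hv p₁) _)
      (ContinuousLinearMap.le_of_opNorm_le _ (hl.norm_fderiv_sub_le hδ hu hv hp₁ hp₀ hp) _))
  convert norm_image_sub_le_of_norm_deriv_le_segment_01' hderiv hbound using 2
  simp only [hF, one_smul, zero_smul, add_zero, add_sub_cancel]
  abel

/-- Exponents for the comparison of two solutions: the difference of the solutions is estimated in
the Hölder exponent `κ`. -/
structure ComparisonExponents (κ θ δ ν : ℝ) : Prop extends YoungPair θ ν where
  pos : 0 < κ
  le_left : κ ≤ θ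
  le_mul : κ ≤ ν * δ
  one_lt_add : 1 < κ + ν

/-- A solution `x` and a solution `y` of the equation with delay `r`, seen on `[s₀, t₀]` in the
clock `φ`. The error committed in the diffusion coefficient by the delay is bounded by `ε`. -/
structure ComparedPaths (T r κ ν R R₁ ε s₀ t₀ : ℝ) (φ : ℝ → ℝ) (b : ℝ → E → E)
    (σ : ℝ → E → Fin m → E) (g : Fin m → ℝ → ℝ) (x y : ℝ → E) : Prop where
  eq_left : IncrementEq T 0 b σ g x
  eq_right : IncrementEq T r b σ g y
  norm_left : ∀ t ∈ Icc 0 T, ‖x t‖ ≤ R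
  norm_right : ∀ t ∈ Icc 0 T, ‖y t‖ ≤ R
  error : HolderNormLe ε κ 0 T fun u => σ u (y u) - σ u (y (u - r))
  start_nonneg : 0 ≤ s₀
  end_le : t₀ ≤ T
  clock : IsClock φ s₀ t₀
  const_nonneg : 0 ≤ R₁
  holder_left : ClockHolder φ R₁ ν (Icc s₀ t₀) x
  holder_right : ClockHolder φ R₁ ν (Icc s₀ t₀) y

/-- The rate at which the difference of two compared paths grows in the clock. -/
def comparisonRate (m : ℕ) (κ ν δ M M' G R₁ : ℝ) : ℝ :=
  M' + m * G * (M + 1) + m * G * youngConst (κ + ν) * (M' * (1 + R₁ ^ δ) + 1)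

/-- `L` is a length of clock time over which the estimates of the difference of two compared
paths improve themselves. -/
structure ContractiveLength (m : ℕ) (κ ν δ M M' G R₁ L : ℝ) : Prop where
  le_one : L ≤ 1
  young : m * G * youngConst (κ + ν) * M * L ^ ν ≤ 1 / 2
  rate : 2 * comparisonRate m κ ν δ M M' G R₁ * L ^ κ ≤ 1 / 2

variable {κ ν r R R₁ G ε s₀ t₀ L A B : ℝ} {φ : ℝ → ℝ} {g : Fin m → ℝ → ℝ} {x y : ℝ → E}

theorem ComparisonExponents.exponent_pos (he : ComparisonExponents κ θ δ ν) : 0 < δ :=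
  pos_of_mul_pos_right (he.pos.trans_le he.le_mul) he.pos_right.le

theorem ComparisonExponents.le_right (he : ComparisonExponents κ θ δ ν) : κ ≤ ν := by
  linarith [he.le_left, he.le_half, he.half_lt_right]

theorem comparisonRate_nonneg (m : ℕ) (hκν : 1 < κ + ν) (hM : 0 ≤ M) (hM' : 0 ≤ M') (hG : 0 ≤ G)
    (hR₁ : 0 ≤ R₁) : 0 ≤ comparisonRate m κ ν δ M M' G R₁ := by
  have := youngConst_nonneg hκν
  unfold comparisonRate
  positivity

theorem ComparedPaths.Icc_subset
    (hc : ComparedPaths T r κ ν R R₁ ε s₀ t₀ φ b σ g x y) : Icc s₀ t₀ ⊆ Icc 0 T :=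
  Icc_subset_Icc hc.start_nonneg hc.end_le

theorem ComparedPaths.norm_integrand_sub_le
    (hc : ComparedPaths T r κ ν R R₁ ε s₀ t₀ φ b σ g x y) (h : CoeffBounds T θ M b σ b₀)
    (ht : t ∈ Icc 0 T) (hA : ‖x t - y t‖ ≤ A) :
    ‖σ t (x t) - σ t (y (t - r))‖ ≤ M * A + ε := by
  refine (norm_sub_le_norm_sub_add_norm_sub _ (σ t (y t)) _).trans
    (add_le_add ((h.lip t ht _ _).trans ?_) (hc.error.norm_le t ht))
  exact mul_le_mul_of_nonneg_left hA h.const_nonneg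

theorem ComparedPaths.clockHolder_integrand_sub
    (hc : ComparedPaths T r κ ν R R₁ ε s₀ t₀ φ b σ g x y) (h : CoeffBounds T θ M b σ b₀)
    (hl : LocalBounds T θ δ R M' b σ) (he : ComparisonExponents κ θ δ ν)
    (hL : φ t₀ - φ s₀ ≤ 1) (hA : ∀ u ∈ Icc s₀ t₀, ‖x u - y u‖ ≤ A)
    (hB : ClockHolder φ B κ (Icc s₀ t₀) fun u => x u - y u) :
    ClockHolder φ (M * B + M' * (1 + R₁ ^ δ) * A + ε) κ (Icc s₀ t₀)
      fun u => σ u (x u) - σ u (y (u - r)) := by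
  intro u hu v hv huv
  have hM := h.const_nonneg
  have hM' := hl.nonneg
  have hR₁ := hc.const_nonneg
  have hu' := hc.Icc_subset hu
  have hv' := hc.Icc_subset hv
  have hε : 0 ≤ ε := (norm_nonneg _).trans (hc.error.norm_le u hu')
  have hτ := hc.clock.sub_le_sub hu hv huv
  have hw := hc.clock.sub_mem_Icc hu hv huv
  have hsecond := hl.norm_second_difference_le h he.exponent_pos.le hu' hv'
    (hc.norm_left v hv') (hc.norm_right v hv') (hc.norm_left u hu') (hc.norm_right u hu')
    (hc.holder_left hu hv huv) (hc.holder_right hu hv huv)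
  have herror := hc.error.holder hu' hv' huv
  have hdiff := hB hu hv huv
  set w := φ v - φ u
  have hpow : ∀ {a : ℝ}, κ ≤ a → w ^ a ≤ w ^ κ := fun ha =>
    Real.rpow_le_rpow_of_exponent_ge' hw.1 (hw.2.trans hL) he.pos.le ha
  have htime : |v - u| ^ θ ≤ w ^ κ := by
    rw [abs_of_nonneg (sub_nonneg.2 huv)]
    exact (Real.rpow_le_rpow (sub_nonneg.2 huv) hτ he.pos_left.le).trans (hpow he.le_left)
  have hspace : (R₁ * w ^ ν) ^ δ ≤ R₁ ^ δ * w ^ κ := by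
    rw [Real.mul_rpow hR₁ (Real.rpow_nonneg hw.1 _), ← Real.rpow_mul hw.1]
    exact mul_le_mul_of_nonneg_left (hpow he.le_mul) (by positivity)
  have : 0 ≤ w ^ κ := Real.rpow_nonneg hw.1 _
  calc ‖σ v (x v) - σ v (y (v - r)) - (σ u (x u) - σ u (y (u - r)))‖
      = ‖((σ v (x v) - σ v (y v)) - (σ u (x u) - σ u (y u))) +
          ((σ v (y v) - σ v (y (v - r))) - (σ u (y u) - σ u (y (u - r))))‖ := by congr 1; abel
    _ ≤ (M * ‖x v - y v - (x u - y u)‖ +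
          M' * (|v - u| ^ θ + (R₁ * w ^ ν) ^ δ) * ‖x u - y u‖) + ε * (v - u) ^ κ :=
        (norm_add_le _ _).trans (add_le_add hsecond herror)
    _ ≤ (M * (B * w ^ κ) + M' * (w ^ κ + R₁ ^ δ * w ^ κ) * A) + ε * w ^ κ := by
        gcongr
        · exact hA u hu
        · exact he.pos.le
    _ = (M * B + M' * (1 + R₁ ^ δ) * A + ε) * w ^ κ := by ring

theorem ComparedPaths.norm_integral_drift_sub_le
    (hc : ComparedPaths T r κ ν R R₁ ε s₀ t₀ φ b σ g x y) (hl : LocalBounds T θ δ R M' b σ)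
    (hA : ∀ u ∈ Icc s₀ t₀, ‖x u - y u‖ ≤ A) (hs : s₀ ≤ s) (hst : s ≤ t) (ht : t ≤ t₀) :
    ‖∫ w in s..t, (b w (x w) - b w (y w))‖ ≤ M' * A * (t - s) := by
  rw [← abs_of_nonneg (sub_nonneg.2 hst)]
  refine intervalIntegral.norm_integral_le_of_norm_le_const fun w hw => ?_
  rw [uIoc_of_le hst] at hw
  have hw₀ : w ∈ Icc s₀ t₀ := ⟨hs.trans hw.1.le, hw.2.trans ht⟩
  have hwT := hc.Icc_subset hw₀
  exact (hl.drift w hwT _ _ (hc.norm_left w hwT) (hc.norm_right w hwT)).trans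
    (mul_le_mul_of_nonneg_left (hA w hw₀) hl.nonneg)

theorem ContractiveLength.increment_le {τ w : ℝ} (hL : ContractiveLength m κ ν δ M M' G R₁ L)
    (he : ComparisonExponents κ θ δ ν) (hM : 0 ≤ M) (hM' : 0 ≤ M') (hG : 0 ≤ G)
    (hR₁ : 0 ≤ R₁) (hA : 0 ≤ A) (hB : 0 ≤ B) (hε : 0 ≤ ε) (hτw : τ ≤ w) (hw : 0 ≤ w)
    (hwL : w ≤ L) :
    M' * A * τ + m * (G * (M * A + ε +
        youngConst (κ + ν) * (M * B + M' * (1 + R₁ ^ δ) * A + ε) * w ^ κ) * w ^ ν) ≤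
      (comparisonRate m κ ν δ M M' G R₁ * (A + ε) + 1 / 2 * B) * w ^ κ := by
  have hY := youngConst_nonneg he.one_lt_add
  have hyoung := hL.young
  have hw1 : w ≤ 1 := hwL.trans hL.le_one
  have hτ : τ ≤ w ^ κ := by
    have := Real.rpow_le_rpow_of_exponent_ge' hw hw1 he.pos.le
      (he.le_left.trans (he.le_half.trans one_half_lt_one.le))
    rw [Real.rpow_one] at this
    exact hτw.trans this
  have hwν : w ^ ν ≤ w ^ κ := Real.rpow_le_rpow_of_exponent_ge' hw hw1 he.pos.le he.le_right
  have hwν1 : w ^ ν ≤ 1 := Real.rpow_le_one hw hw1 he.pos_right.le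
  have hwLν : w ^ ν ≤ L ^ ν := Real.rpow_le_rpow hw hwL he.pos_right.le
  have hP : 0 ≤ M' * (1 + R₁ ^ δ) := by positivity
  unfold comparisonRate
  set P := M' * (1 + R₁ ^ δ)
  set Y := youngConst (κ + ν)
  set z := w ^ κ
  set zν := w ^ ν
  have : 0 ≤ z := Real.rpow_nonneg hw _
  have drift : M' * A * τ ≤ M' * A * z := by gcongr
  have boundary : m * G * (M * A + ε) * zν ≤ m * G * (M * A + ε) * z := by gcongr
  have lower_order : m * G * Y * (P * A + ε) * z * zν ≤ m * G * Y * (P * A + ε) * z :=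
    mul_le_of_le_one_right (by positivity) hwν1
  have leading : m * G * Y * (M * B) * z * zν ≤ 1 / 2 * B * z := by
    calc m * G * Y * (M * B) * z * zν ≤ m * G * Y * (M * B) * z * L ^ ν := by gcongr
      _ = (m * G * Y * M * L ^ ν) * (B * z) := by ring
      _ ≤ 1 / 2 * (B * z) := by gcongr
      _ = 1 / 2 * B * z := by ring
  have rate : M' * A + m * G * (M * A + ε) + m * G * Y * (P * A + ε) ≤
      (M' + m * G * (M + 1) + m * G * Y * (P + 1)) * (A + ε) := by
    have : 0 ≤ M' * ε + m * G * (M * ε + A) + m * G * Y * (P * ε + A) := by positivity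
    linarith
  linarith [mul_le_mul_of_nonneg_right rate ‹0 ≤ z›]

theorem ComparedPaths.clockHolder_sub_step
    (hc : ComparedPaths T r κ ν R R₁ ε s₀ t₀ φ b σ g x y) (h : CoeffBounds T θ M b σ b₀)
    (hl : LocalBounds T θ δ R M' b σ) (he : ComparisonExponents κ θ δ ν)
    (hg : HolderDriver T ν G g) (hL : ContractiveLength m κ ν δ M M' G R₁ (φ t₀ - φ s₀))
    (hB₀ : 0 ≤ B) (hA : ∀ u ∈ Icc s₀ t₀, ‖x u - y u‖ ≤ A)
    (hB : ClockHolder φ B κ (Icc s₀ t₀) fun u => x u - y u) :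
    ClockHolder φ (comparisonRate m κ ν δ M M' G R₁ * (A + ε) + 1 / 2 * B) κ (Icc s₀ t₀)
      fun u => x u - y u := by
  intro u hu v hv huv
  rcases huv.eq_or_lt with rfl | huv
  · simp [Real.zero_rpow he.pos.ne']
  have hu' := hc.Icc_subset hu
  have hv' := hc.Icc_subset hv
  have hA₀ : 0 ≤ A := (norm_nonneg _).trans (hA u hu)
  have hε : 0 ≤ ε := (norm_nonneg _).trans (hc.error.norm_le u hu')
  have hw := hc.clock.sub_mem_Icc hu hv huv.le
  obtain ⟨I, hI, hxI⟩ := hc.eq_left.incr u v hu'.1 huv hv'.2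
  simp only [sub_zero] at hI
  obtain ⟨J, hJ, hyJ⟩ := hc.eq_right.incr u v hu'.1 huv hv'.2
  have hsub : uIcc u v ⊆ uIcc 0 T := by
    rw [uIcc_of_le huv.le, uIcc_of_le (hu'.1.trans hu'.2)]
    exact Icc_subset_Icc hu'.1 hv'.2
  have hincr : (x v - y v) - (x u - y u) =
      (∫ w in u..v, (b w (x w) - b w (y w))) + ∑ j, (I j - J j) := by
    rw [intervalIntegral.integral_sub (hc.eq_left.integrable.mono_set hsub)
      (hc.eq_right.integrable.mono_set hsub), Finset.sum_sub_distrib,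
      sub_sub_sub_comm, hxI, hyJ]
    abel
  have hdrift := hc.norm_integral_drift_sub_le hl hA hu.1 huv.le hv.2
  have hsum := norm_sum_le_of_hasRSIntegral hu'.1 huv.le hv'.2 (hc.clock.mono hu.1 hv.2)
    he.pos.le he.pos_right.le he.one_lt_add
    ((hc.clockHolder_integrand_sub h hl he hL.le_one hA hB).mono
      (Ioc_subset_Icc_self.trans (Icc_subset_Icc hu.1 hv.2)))
    (hc.norm_integrand_sub_le h hv' (hA v hv)) hg
    (J := fun j => I j - J j) fun j => (hI j).sub (hJ j)
  change ‖(x v - y v) - (x u - y u)‖ ≤ _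
  rw [hincr]
  exact (norm_add_le _ _).trans ((add_le_add hdrift hsum).trans
    (hL.increment_le he h.const_nonneg hl.nonneg hg.nonneg hc.const_nonneg hA₀ hB₀ hε
      (hc.clock.sub_le_sub hu hv huv.le) hw.1 hw.2))

theorem ComparedPaths.clockHolder_sub
    (hc : ComparedPaths T r κ ν R R₁ ε s₀ t₀ φ b σ g x y) (h : CoeffBounds T θ M b σ b₀)
    (hl : LocalBounds T θ δ R M' b σ) (he : ComparisonExponents κ θ δ ν)
    (hg : HolderDriver T ν G g) (hL : ContractiveLength m κ ν δ M M' G R₁ (φ t₀ - φ s₀))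
    (hA₀ : 0 ≤ A + ε) (hA : ∀ u ∈ Icc s₀ t₀, ‖x u - y u‖ ≤ A) :
    ClockHolder φ (2 * (comparisonRate m κ ν δ M M' G R₁ * (A + ε))) κ (Icc s₀ t₀)
      fun u => x u - y u := by
  have hR₁ := hc.const_nonneg
  have hrate := comparisonRate_nonneg (δ := δ) m he.one_lt_add h.const_nonneg hl.nonneg hg.nonneg
    hR₁
  have hstart : ClockHolder φ (2 * R₁) κ (Icc s₀ t₀) fun u => x u - y u := by
    intro u hu v hv huv
    have hw := hc.clock.sub_mem_Icc hu hv huv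
    have hpow : (φ v - φ u) ^ ν ≤ (φ v - φ u) ^ κ :=
      Real.rpow_le_rpow_of_exponent_ge' hw.1 (hw.2.trans hL.le_one) he.pos.le he.le_right
    calc ‖x v - y v - (x u - y u)‖ = ‖(x v - x u) - (y v - y u)‖ := by rw [sub_sub_sub_comm]
      _ ≤ R₁ * (φ v - φ u) ^ ν + R₁ * (φ v - φ u) ^ ν := (norm_sub_le _ _).trans
          (add_le_add (hc.holder_left hu hv huv) (hc.holder_right hu hv huv))
      _ ≤ 2 * R₁ * (φ v - φ u) ^ κ := by linarith [mul_le_mul_of_nonneg_left hpow hR₁]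
  convert (fixedPoint_mem_of_mapsTo (K := comparisonRate m κ ν δ M M' G R₁ * (A + ε)) (q := 1 / 2)
    (isClosed_setOf_clockHolder φ κ (Icc s₀ t₀) fun u => x u - y u)
    ⟨2 * R₁, by positivity, hstart⟩ (by norm_num) (by norm_num)
    fun B hB => ⟨add_nonneg (mul_nonneg hrate hA₀) (by linarith [hB.1]),
      hc.clockHolder_sub_step h hl he hg hL hB.1 hA hB.2⟩).2 using 1
  ring

theorem ComparedPaths.norm_sub_le
    (hc : ComparedPaths T r κ ν R R₁ ε s₀ t₀ φ b σ g x y) (h : CoeffBounds T θ M b σ b₀)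
    (hl : LocalBounds T θ δ R M' b σ) (he : ComparisonExponents κ θ δ ν)
    (hg : HolderDriver T ν G g) (hL : ContractiveLength m κ ν δ M M' G R₁ (φ t₀ - φ s₀))
    (ht : t ∈ Icc s₀ t₀) : ‖x t - y t‖ ≤ 2 * ‖x s₀ - y s₀‖ + ε := by
  have hε : 0 ≤ ε := (norm_nonneg _).trans (hc.error.norm_le t (hc.Icc_subset ht))
  have hR : 0 ≤ R := (norm_nonneg _).trans (hc.norm_left t (hc.Icc_subset ht))
  have hs₀ : s₀ ∈ Icc s₀ t₀ := left_mem_Icc.2 (ht.1.trans ht.2)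
  have hrate := comparisonRate_nonneg (δ := δ) m he.one_lt_add h.const_nonneg hl.nonneg hg.nonneg
    hc.const_nonneg
  have hstart : ∀ u : Icc s₀ t₀, ‖x u - y u‖ ≤ 2 * R * 1 := fun u => by
    have hu := hc.Icc_subset u.2
    linarith [_root_.norm_sub_le (x u) (y u), hc.norm_left u hu, hc.norm_right u hu]
  have hstep : ∀ A, 0 ≤ A → (∀ u : Icc s₀ t₀, ‖x u - y u‖ ≤ A * 1) →
      ∀ u : Icc s₀ t₀, ‖x u - y u‖ ≤ (‖x s₀ - y s₀‖ + 1 / 2 * ε + 1 / 2 * A) * 1 := by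
    intro A hA₀ hA u
    have hholder := hc.clockHolder_sub h hl he hg hL (by positivity)
      (fun u hu => (hA ⟨u, hu⟩).trans_eq (mul_one A)) hs₀ u.2 u.2.1
    have hw := hc.clock.sub_mem_Icc hs₀ u.2 u.2.1
    have hpow := Real.rpow_le_rpow hw.1 hw.2 he.pos.le
    have hsmall := mul_le_mul_of_nonneg_right hL.rate (show 0 ≤ A + ε by positivity)
    have := mul_le_mul_of_nonneg_left hpow
      (show 0 ≤ 2 * (comparisonRate m κ ν δ M M' G R₁ * (A + ε)) by positivity)
    linarith [norm_le_norm_sub_add (x u - y u) (x s₀ - y s₀)]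
  convert (fixedPoint_mem_of_mapsTo (K := ‖x s₀ - y s₀‖ + 1 / 2 * ε) (q := 1 / 2)
    (isClosed_setOf_forall_le_mul (fun u : Icc s₀ t₀ => ‖x u - y u‖) fun _ => 1)
    ⟨2 * R, by positivity, hstart⟩ (by norm_num) (by norm_num)
    fun A hA => ⟨by have := hA.1; positivity, hstep A hA.1 hA.2⟩).2 ⟨t, ht⟩ using 1
  ring

end Stability

section PathwiseConvergence

theorem exists_mul_rpow_le (c : ℝ) {a η : ℝ} (ha : 0 < a) (hη : 0 < η) :
    ∃ ℓ : ℝ, 0 < ℓ ∧ ℓ ≤ 1 ∧ c * ℓ ^ a ≤ η := by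
  have hcont : ContinuousAt (fun ℓ : ℝ => c * ℓ ^ a) 0 :=
    continuousAt_const.mul (Real.continuousAt_rpow_const _ _ (Or.inr ha.le))
  have hlim := hcont.tendsto.mono_left (nhdsWithin_le_nhds (s := Ioi 0))
  simp only [Real.zero_rpow ha.ne', mul_zero] at hlim
  obtain ⟨ℓ, hℓ, hℓ0, hℓ1⟩ := ((hlim.eventually (ge_mem_nhds hη)).and
    (Ioc_mem_nhdsGT (zero_lt_one : (0 : ℝ) < 1))).exists
  exact ⟨ℓ, hℓ0, hℓ1, hℓ⟩

theorem le_rpow_mul_rpow_of_le {d p q c : ℝ} (hd : 0 ≤ d) (hp : d ≤ p) (hq : d ≤ q) (hc : 0 ≤ c)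
    (hc1 : c ≤ 1) : d ≤ p ^ (1 - c) * q ^ c := by
  have := sub_nonneg.2 hc1
  have := hd.trans hp
  calc d = d ^ (1 - c) * d ^ c := by
        rw [← Real.rpow_add_of_nonneg hd (by linarith) hc, sub_add_cancel, Real.rpow_one]
    _ ≤ p ^ (1 - c) * q ^ c := by gcongr

theorem le_two_pow_mul_of_step {f : ℝ → ℝ} {T Δ ε : ℝ} (h0 : f 0 ≤ 0) (hΔ : 0 ≤ Δ)
    (hstep : ∀ s t, 0 ≤ s → s ≤ t → t ≤ T → t - s ≤ Δ → f t ≤ 2 * f s + ε) (n : ℕ) :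
    ∀ t ∈ Icc 0 T, t ≤ n * Δ → f t ≤ (2 ^ n - 1) * ε := by
  induction n with
  | zero =>
    intro t ht htn
    obtain rfl : t = 0 := le_antisymm (by simpa using htn) ht.1
    simpa using h0
  | succ n ih =>
    intro t ht htn
    rw [Nat.cast_succ, add_one_mul] at htn
    have hst : max (t - Δ) 0 ≤ t := max_le (by linarith) ht.1
    have hs := ih (max (t - Δ) 0) ⟨le_max_right _ _, hst.trans ht.2⟩
      (max_le (by linarith) (by positivity))
    have := hstep _ t (le_max_right (t - Δ) 0) hst ht.2 (by linarith [le_max_left (t - Δ) 0])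
    rw [pow_succ]
    linarith

theorem setLIntegral_mul_rpow_sub {B p t : ℝ} (hB : 0 ≤ B) (hp : 0 < p) (ht : 0 ≤ t) :
    ∫⁻ s in Ioo 0 t, ENNReal.ofReal (B * (t - s) ^ (p - 1)) =
      ENNReal.ofReal (B * (t ^ p / p)) := by
  have hint : IntervalIntegrable (fun s => B * (t - s) ^ (p - 1)) volume 0 t := by
    have := (intervalIntegral.intervalIntegrable_rpow' (a := 0) (b := t)
      (show -1 < p - 1 by linarith)).comp_sub_left t
    rw [sub_zero, sub_self] at this
    exact this.symm.const_mul B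
  have hval : ∫ s in (0 : ℝ)..t, B * (t - s) ^ (p - 1) = B * (t ^ p / p) := by
    rw [intervalIntegral.integral_const_mul,
      intervalIntegral.integral_comp_sub_left (fun u => u ^ (p - 1)) t,
      integral_rpow (Or.inl (by linarith)), sub_self, sub_zero, sub_add_cancel,
      Real.zero_rpow hp.ne', sub_zero]
  rw [setLIntegral_congr Ioo_ae_eq_Ioc, ← ofReal_integral_eq_lintegral_ofReal
    ((intervalIntegrable_iff_integrableOn_Ioc_of_le ht).1 hint),
    ← intervalIntegral.integral_of_le ht, hval]
  filter_upwards [ae_restrict_mem measurableSet_Ioc] with s hs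
  exact mul_nonneg hB (Real.rpow_nonneg (by linarith [hs.2]) _)

variable {E : Type*} [NormedAddCommGroup E]

theorem wNorm_le_of_holderBound {α κ T a B : ℝ} {f : ℝ → E} (hακ : α < κ) (hB : 0 ≤ B)
    (ha : ∀ t ∈ Icc 0 T, ‖f t‖ ≤ a) (hf : HolderBound B κ (Icc 0 T) f) :
    wNorm α 0 T f ≤ ENNReal.ofReal (a + B * (T ^ (κ - α) / (κ - α))) := by
  refine iSup₂_le fun t ht => ?_
  have hT : 0 ≤ T := ht.1.trans ht.2
  have hd : 0 < κ - α := sub_pos.2 hακ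
  rw [ENNReal.ofReal_add ((norm_nonneg _).trans (ha t ht)) (by positivity)]
  refine add_le_add ?_ ?_
  · rw [← ofReal_norm]
    exact ENNReal.ofReal_le_ofReal (ha t ht)
  · calc ∫⁻ s in Ioo 0 t, ‖f t - f s‖ₑ / ENNReal.ofReal ((t - s) ^ (α + 1))
        ≤ ∫⁻ s in Ioo 0 t, ENNReal.ofReal (B * (t - s) ^ (κ - α - 1)) := by
          refine setLIntegral_mono' measurableSet_Ioo fun s hs => ?_
          have hpos : 0 < t - s := sub_pos.2 hs.2
          rw [← ofReal_norm, ← ENNReal.ofReal_div_of_pos (by positivity)]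
          refine ENNReal.ofReal_le_ofReal ?_
          rw [div_le_iff₀ (by positivity), mul_assoc, ← Real.rpow_add hpos,
            show κ - α - 1 + (α + 1) = κ by ring]
          exact hf ⟨hs.1.le, hs.2.le.trans ht.2⟩ ht hs.2.le
      _ = ENNReal.ofReal (B * (t ^ (κ - α) / (κ - α))) := setLIntegral_mul_rpow_sub hB hd ht.1
      _ ≤ ENNReal.ofReal (B * (T ^ (κ - α) / (κ - α))) := by
          have := Real.rpow_le_rpow ht.1 ht.2 hd.le
          gcongr

variable {m : ℕ} {T θ δ M M' κ R r s t : ℝ} {b : ℝ → E → E} {σ : ℝ → E → Fin m → E} {b₀ : ℝ → ℝ}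
  {x y : ℝ → E}

/-- The norm `‖x - y‖_{α,∞}` is controlled by the distance `D` of two `1/2`-Hölder paths in the
supremum norm, by interpolation at the exponent `(α + 1/2)/2`. -/
def interpolationBound (α T R D : ℝ) : ℝ :=
  D + (2 * D) ^ (1 / 2 - α) * (2 * R) ^ (α + 1 / 2) *
    (T ^ ((1 / 2 - α) / 2) / ((1 / 2 - α) / 2))

theorem wNorm_sub_le_interpolationBound {α D : ℝ} (hα : 0 ≤ α) (hα2 : α < 1 / 2) (hD₀ : 0 ≤ D)
    (hR : 0 ≤ R) (hx : HolderBound R (1 / 2) (Icc 0 T) x) (hy : HolderBound R (1 / 2) (Icc 0 T) y)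
    (hD : ∀ t ∈ Icc 0 T, ‖x t - y t‖ ≤ D) :
    wNorm α 0 T (fun t => x t - y t) ≤ ENNReal.ofReal (interpolationBound α T R D) := by
  have hexp : (1 / 2 - α) / 2 = (α + 1 / 2) / 2 - α := by ring
  rw [interpolationBound, hexp]
  refine wNorm_le_of_holderBound (by linarith) (by positivity) hD fun s hs t ht hst => ?_
  have hts := sub_nonneg.2 hst
  have hsup : ‖(x t - y t) - (x s - y s)‖ ≤ 2 * D := by
    linarith [norm_sub_le (x t - y t) (x s - y s), hD t ht, hD s hs]
  have hhalf : ‖(x t - y t) - (x s - y s)‖ ≤ 2 * R * (t - s) ^ (1 / 2 : ℝ) := by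
    rw [sub_sub_sub_comm]
    linarith [norm_sub_le (x t - x s) (y t - y s), hx hs ht hst, hy hs ht hst]
  calc ‖(x t - y t) - (x s - y s)‖
      ≤ (2 * D) ^ (1 - (α + 1 / 2)) * (2 * R * (t - s) ^ (1 / 2 : ℝ)) ^ (α + 1 / 2) :=
        le_rpow_mul_rpow_of_le (norm_nonneg _) hsup hhalf (by linarith) (by linarith)
    _ = (2 * D) ^ (1 / 2 - α) * (2 * R) ^ (α + 1 / 2) * (t - s) ^ ((α + 1 / 2) / 2) := by
        rw [Real.mul_rpow (x := 2 * R) (by positivity) (by positivity), ← Real.rpow_mul hts,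
          ← mul_assoc]
        ring_nf

theorem tendsto_interpolationBound {α : ℝ} (hα2 : α < 1 / 2) (T R : ℝ) :
    Tendsto (interpolationBound α T R) (𝓝 0) (𝓝 0) := by
  have hcont : ContinuousAt (interpolationBound α T R) 0 :=
    continuousAt_id.add ((((continuousAt_const.mul continuousAt_id).rpow_const
      (Or.inr (by linarith))).mul continuousAt_const).mul continuousAt_const)
  have hzero : interpolationBound α T R 0 = 0 := by
    rw [interpolationBound, mul_zero, Real.zero_rpow (by linarith)]
    ring
  simpa only [hzero] using hcont.tendsto

theorem CoeffBounds.norm_delay_error_le (h : CoeffBounds T θ M b σ b₀) (hr : 0 ≤ r)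
    (hy : HolderBound R θ (Icc (-r) T) y) (ht : t ∈ Icc 0 T) :
    ‖σ t (y t) - σ t (y (t - r))‖ ≤ M * (1 + R) * r ^ θ := by
  have hdelay := hy (u := t - r) ⟨by linarith [ht.1], by linarith [ht.2]⟩ (v := t)
    ⟨by linarith [ht.1], ht.2⟩ (by linarith)
  rw [sub_sub_cancel] at hdelay
  rw [mul_assoc]
  exact (h.lip t ht _ _).trans (mul_le_mul_of_nonneg_left
    (hdelay.trans (by gcongr; exact le_add_of_nonneg_left zero_le_one)) h.const_nonneg)

theorem CoeffBounds.holderNormLe_delay_error (h : CoeffBounds T θ M b σ b₀) (hκ : 0 < κ)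
    (hκθ : κ ≤ θ) (hr : 0 < r) (hr1 : r ≤ 1) (hR : 0 ≤ R) (hy : HolderBound R θ (Icc (-r) T) y) :
    HolderNormLe (2 * M * (1 + R) * r ^ (θ - κ)) κ 0 T
      fun u => σ u (y u) - σ u (y (u - r)) := by
  have hM := h.const_nonneg
  have hmul : r ^ θ = r ^ (θ - κ) * r ^ κ := by rw [← Real.rpow_add hr, sub_add_cancel]
  have sup : ∀ u ∈ Icc 0 T,
      ‖σ u (y u) - σ u (y (u - r))‖ ≤ M * (1 + R) * (r ^ (θ - κ) * r ^ κ) := fun u hu =>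
    hmul ▸ h.norm_delay_error_le hr.le hy hu
  refine ⟨fun u hu => (sup u hu).trans ?_, fun u hu v hv huv => ?_⟩
  · have : r ^ κ ≤ 1 := Real.rpow_le_one hr.le hr1 hκ.le
    calc M * (1 + R) * (r ^ (θ - κ) * r ^ κ) ≤ M * (1 + R) * (r ^ (θ - κ) * 1) := by gcongr
      _ ≤ 2 * (M * (1 + R) * (r ^ (θ - κ) * 1)) := le_mul_of_one_le_left (by positivity) one_le_two
      _ = 2 * M * (1 + R) * r ^ (θ - κ) := by ring
  · rcases le_total (v - u) r with hle | hle
    · have hpow := rpow_le_mul_rpow_of_le (sub_nonneg.2 huv) hle hκ hκθ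
      have hmem : ∀ w ∈ Icc 0 T, w ∈ Icc (-r) T ∧ w - r ∈ Icc (-r) T := fun w hw =>
        ⟨⟨by linarith [hw.1], hw.2⟩, ⟨by linarith [hw.1], by linarith [hw.2]⟩⟩
      have hnow := hy (hmem u hu).1 (hmem v hv).1 huv
      have hthen := hy (hmem u hu).2 (hmem v hv).2 (sub_le_sub_right huv r)
      rw [sub_sub_sub_cancel_right] at hthen
      calc ‖(σ v (y v) - σ v (y (v - r))) - (σ u (y u) - σ u (y (u - r)))‖
          = ‖(σ v (y v) - σ u (y u)) - (σ v (y (v - r)) - σ u (y (u - r)))‖ := by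
            rw [sub_sub_sub_comm]
        _ ≤ (M * (v - u) ^ θ + M * (R * (v - u) ^ θ)) +
              (M * (v - u) ^ θ + M * (R * (v - u) ^ θ)) :=
            (norm_sub_le _ _).trans (add_le_add
              ((h.norm_sigma_sub_le hu hv huv).trans (by gcongr))
              ((h.norm_sigma_sub_le hu hv huv).trans (by gcongr)))
        _ = 2 * M * (1 + R) * (v - u) ^ θ := by ring
        _ ≤ 2 * M * (1 + R) * (r ^ (θ - κ) * (v - u) ^ κ) := by gcongr
        _ = 2 * M * (1 + R) * r ^ (θ - κ) * (v - u) ^ κ := by ring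
    · calc ‖(σ v (y v) - σ v (y (v - r))) - (σ u (y u) - σ u (y (u - r)))‖
          ≤ M * (1 + R) * (r ^ (θ - κ) * r ^ κ) + M * (1 + R) * (r ^ (θ - κ) * r ^ κ) :=
            (norm_sub_le _ _).trans (add_le_add (sup v hv) (sup u hu))
        _ = 2 * M * (1 + R) * r ^ (θ - κ) * r ^ κ := by ring
        _ ≤ 2 * M * (1 + R) * r ^ (θ - κ) * (v - u) ^ κ := by gcongr

theorem CoeffBounds.exists_clock_sub_le (h : CoeffBounds T θ M b σ b₀) {ℓ : ℝ} (hℓ : 0 < ℓ) :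
    ∃ Δ, 0 < Δ ∧ ∀ s t, 0 ≤ s → s ≤ t → t ≤ T → t - s ≤ Δ → clock b₀ t - clock b₀ s ≤ ℓ := by
  obtain ⟨Δ, hΔ0, hΔ1, hΔ⟩ := exists_mul_rpow_le (2 * M) one_half_pos hℓ
  refine ⟨Δ, hΔ0, fun s t hs hst ht hstΔ => ?_⟩
  rw [h.clock_sub hs hst ht]
  have htime : t - s ≤ Δ ^ (1 / 2 : ℝ) :=
    hstΔ.trans (Real.self_le_rpow_of_le_one hΔ0.le hΔ1 one_half_lt_one.le)
  have hpow : (t - s) ^ (1 / 2 : ℝ) ≤ Δ ^ (1 / 2 : ℝ) :=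
    Real.rpow_le_rpow (sub_nonneg.2 hst) hstΔ one_half_pos.le
  calc (t - s) + ∫ u in s..t, b₀ u ≤ Δ ^ (1 / 2 : ℝ) + M * (t - s) ^ (1 / 2 : ℝ) :=
        add_le_add htime (h.half s t hs hst ht)
    _ ≤ M * Δ ^ (1 / 2 : ℝ) + M * Δ ^ (1 / 2 : ℝ) := add_le_add
        (le_mul_of_one_le_left (by positivity) h.one_le)
        (mul_le_mul_of_nonneg_left hpow h.const_nonneg)
    _ ≤ ℓ := by linarith

variable [NormedSpace ℝ E] {g : Fin m → ℝ → ℝ} {ν G s₀ t₀ : ℝ}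

/-- The constant with which a solution bounded in Hölder norm by `R` is `ν`-Hölder in the clock. -/
def clockConst (m : ℕ) (T θ ν M G R : ℝ) : ℝ :=
  M * R + 1 + m * (G * (M * (1 + R) * (1 + youngConst (θ + ν) * T ^ θ)))

theorem clockConst_nonneg (m : ℕ) (hT : 0 ≤ T) (hθν : 1 < θ + ν) (hM : 0 ≤ M) (hG : 0 ≤ G)
    (hR : 0 ≤ R) : 0 ≤ clockConst m T θ ν M G R := by
  have := youngConst_nonneg hθν
  unfold clockConst
  positivity

theorem DelayPath.clockHolder (hx : DelayPath T r θ M b σ g x) (h : CoeffBounds T θ M b σ b₀)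
    (hr : 0 ≤ r) (hp : YoungPair θ ν) (hg : HolderDriver T ν G g) (hT : 0 ≤ T) (hR₀ : 0 ≤ R)
    (hR : HolderNormLe R θ (-r) T x) (hs₀ : 0 ≤ s₀) (ht₀ : t₀ ≤ T)
    (hcl : clock b₀ t₀ - clock b₀ s₀ ≤ 1) :
    ClockHolder (clock b₀) (clockConst m T θ ν M G R) ν (Icc s₀ t₀) x := by
  intro u hu v hv huv
  have hM := h.const_nonneg
  have hG := hg.nonneg
  have := youngConst_nonneg hp.one_lt
  have hτ := (h.isClock.mono hs₀ ht₀).sub_le_sub hu hv huv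
  have hw := (h.isClock.mono hs₀ ht₀).sub_mem_Icc hu hv huv
  have hdrift : ∫ w in u..v, b₀ w ≤ clock b₀ v - clock b₀ u := by
    rw [h.clock_sub (hs₀.trans hu.1) huv (hv.2.trans ht₀)]
    linarith
  refine (hx.norm_sub_le h hr hp.pos_left.le hp.pos_right hp.one_lt hg hR₀ hR (hs₀.trans hu.1) huv
    (hv.2.trans ht₀)).trans ?_
  set w := clock b₀ v - clock b₀ u
  have hwν : w ≤ w ^ ν := Real.self_le_rpow_of_le_one hw.1 (hw.2.trans hcl) hp.le_one
  have hτν : (v - u) ^ ν ≤ w ^ ν := Real.rpow_le_rpow (sub_nonneg.2 huv) hτ hp.pos_right.le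
  calc M * R * (v - u) + (∫ w in u..v, b₀ w) +
        m * (G * (M * (1 + R) * (1 + youngConst (θ + ν) * T ^ θ)) * (v - u) ^ ν)
      ≤ M * R * w ^ ν + w ^ ν +
        m * (G * (M * (1 + R) * (1 + youngConst (θ + ν) * T ^ θ)) * w ^ ν) := by
        refine add_le_add (add_le_add ?_ (hdrift.trans hwν)) (by gcongr)
        exact mul_le_mul_of_nonneg_left (hτ.trans hwν) (by positivity)
    _ = clockConst m T θ ν M G R * w ^ ν := by rw [clockConst]; ring

theorem exists_contractiveLength (m : ℕ) {R₁ : ℝ} (he : ComparisonExponents κ θ δ ν) (hM : 0 ≤ M)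
    (hM' : 0 ≤ M') (hG : 0 ≤ G) (hR₁ : 0 ≤ R₁) :
    ∃ ℓ, 0 < ℓ ∧ ∀ L, 0 ≤ L → L ≤ ℓ → ContractiveLength m κ ν δ M M' G R₁ L := by
  have := youngConst_nonneg he.one_lt_add
  have := comparisonRate_nonneg (δ := δ) m he.one_lt_add hM hM' hG hR₁
  obtain ⟨ℓ₁, hℓ₁0, hℓ₁1, hℓ₁⟩ := exists_mul_rpow_le (m * G * youngConst (κ + ν) * M)
    he.pos_right (one_half_pos (α := ℝ))
  obtain ⟨ℓ₂, hℓ₂0, -, hℓ₂⟩ := exists_mul_rpow_le (2 * comparisonRate m κ ν δ M M' G R₁) he.pos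
    (one_half_pos (α := ℝ))
  refine ⟨min ℓ₁ ℓ₂, lt_min hℓ₁0 hℓ₂0, fun L hL₀ hL => ?_⟩
  rw [le_min_iff] at hL
  exact ⟨hL.1.trans hℓ₁1,
    (mul_le_mul_of_nonneg_left (Real.rpow_le_rpow hL₀ hL.1 he.pos_right.le)
      (by positivity)).trans hℓ₁,
    (mul_le_mul_of_nonneg_left (Real.rpow_le_rpow hL₀ hL.2 he.pos.le) (by positivity)).trans hℓ₂⟩

theorem DelayPath.comparedPaths (hx : DelayPath T 0 θ M b σ g x)
    (hy : DelayPath T r θ M b σ g y) (h : CoeffBounds T θ M b σ b₀)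
    (he : ComparisonExponents κ θ δ ν) (hg : HolderDriver T ν G g) (hr : 0 < r) (hr1 : r ≤ 1)
    (hR₀ : 0 ≤ R) (hxR : HolderNormLe R θ (-0) T x) (hyR : HolderNormLe R θ (-r) T y)
    (hT : 0 ≤ T) (hs₀ : 0 ≤ s₀) (ht₀ : t₀ ≤ T) (hcl : clock b₀ t₀ - clock b₀ s₀ ≤ 1) :
    ComparedPaths T r κ ν R (clockConst m T θ ν M G R) (2 * M * (1 + R) * r ^ (θ - κ)) s₀ t₀
      (clock b₀) b σ g x y where
  eq_left := hx.eq
  eq_right := hy.eq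
  norm_left t ht := hxR.norm_le t ⟨by linarith [ht.1], ht.2⟩
  norm_right t ht := hyR.norm_le t ⟨by linarith [ht.1], ht.2⟩
  error := h.holderNormLe_delay_error he.pos he.le_left hr hr1 hR₀ hyR.holder
  start_nonneg := hs₀
  end_le := ht₀
  clock := h.isClock.mono hs₀ ht₀
  const_nonneg := clockConst_nonneg m hT he.one_lt h.const_nonneg hg.nonneg hR₀
  holder_left := hx.clockHolder h le_rfl he.toYoungPair hg hT hR₀ hxR hs₀ ht₀ hcl
  holder_right := hy.clockHolder h hr.le he.toYoungPair hg hT hR₀ hyR hs₀ ht₀ hcl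

theorem exists_norm_sub_le_rpow_delay (h : CoeffBounds T θ M b σ b₀)
    (hl : LocalBounds T θ δ R M' b σ) (hT : 0 ≤ T) (he : ComparisonExponents κ θ δ ν)
    (hg : HolderDriver T ν G g) (hx : DelayPath T 0 θ M b σ g x) (hR₀ : 0 ≤ R)
    (hxR : HolderNormLe R θ (-0) T x) :
    ∃ C, 0 ≤ C ∧ ∀ r y, 0 < r → r ≤ 1 → DelayPath T r θ M b σ g y → HolderNormLe R θ (-r) T y →
      y 0 = x 0 → ∀ t ∈ Icc 0 T, ‖x t - y t‖ ≤ C * r ^ (θ - κ) := by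
  have hM := h.const_nonneg
  obtain ⟨ℓ, hℓ0, hℓ⟩ := exists_contractiveLength m he hM hl.nonneg hg.nonneg
    (clockConst_nonneg m hT he.one_lt hM hg.nonneg hR₀)
  obtain ⟨Δ, hΔ0, hΔ⟩ := h.exists_clock_sub_le hℓ0
  obtain ⟨n, hn⟩ := exists_nat_ge (T / Δ)
  rw [div_le_iff₀ hΔ0] at hn
  refine ⟨2 ^ n * (2 * M * (1 + R)), by positivity, fun r y hr hr1 hy hyR h0 t ht => ?_⟩
  set ε := 2 * M * (1 + R) * r ^ (θ - κ) with hε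
  have hstep : ∀ s t, 0 ≤ s → s ≤ t → t ≤ T → t - s ≤ Δ →
      ‖x t - y t‖ ≤ 2 * ‖x s - y s‖ + ε := by
    intro s t hs hst ht hstΔ
    have hL := hℓ _ ((h.isClock.mono hs ht).sub_mem_Icc (left_mem_Icc.2 hst) (right_mem_Icc.2 hst)
      hst).1 (hΔ s t hs hst ht hstΔ)
    exact (hx.comparedPaths hy h he hg hr hr1 hR₀ hxR hyR hT hs ht hL.le_one).norm_sub_le h hl he
      hg hL (right_mem_Icc.2 hst)
  have hε0 : 0 ≤ ε := by positivity
  refine (le_two_pow_mul_of_step (by simp [h0]) hΔ0.le hstep n t ht (ht.2.trans hn)).trans ?_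
  rw [mul_assoc, ← hε]
  linarith

/-- The regularity of a solution of the equation with delay `r` obtained from the a priori
bounds, all with the constant `R`. -/
structure RegularPath (T r θ R : ℝ) (y : ℝ → E) : Prop where
  normLe : HolderNormLe R θ (-r) T y
  half : HolderBound R (1 / 2) (Icc 0 T) y

theorem exists_wNorm_sub_le {α : ℝ} (h : CoeffBounds T θ M b σ b₀)
    (hl : LocalBounds T θ δ R M' b σ) (hT : 0 ≤ T) (hα : 0 ≤ α) (hα2 : α < 1 / 2)
    (he : ComparisonExponents κ θ δ ν) (hκθ : κ < θ) (hg : HolderDriver T ν G g)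
    (hx : DelayPath T 0 θ M b σ g x) (hR₀ : 0 ≤ R) (hxR : RegularPath T 0 θ R x) {ε : ℝ}
    (hε : 0 < ε) :
    ∃ r₁, 0 < r₁ ∧ ∀ r y, 0 < r → r < r₁ → DelayPath T r θ M b σ g y → RegularPath T r θ R y →
      y 0 = x 0 → wNorm α 0 T (fun t => x t - y t) ≤ ENNReal.ofReal ε := by
  obtain ⟨C, hC₀, hC⟩ := exists_norm_sub_le_rpow_delay h hl hT he hg hx hR₀ hxR.normLe
  have hD : Tendsto (fun r : ℝ => C * r ^ (θ - κ)) (𝓝[>] 0) (𝓝 0) := by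
    have := ((Real.continuousAt_rpow_const 0 (θ - κ) (Or.inr (by linarith))).const_mul C).tendsto
    rw [Real.zero_rpow (by linarith), mul_zero] at this
    exact this.mono_left nhdsWithin_le_nhds
  have hsmall := (((tendsto_interpolationBound hα2 T R).comp hD).eventually (ge_mem_nhds hε)).and
    (Ioc_mem_nhdsGT (zero_lt_one : (0 : ℝ) < 1))
  obtain ⟨r₁, hr₁, hr⟩ := (mem_nhdsGT_iff_exists_Ioo_subset).1 hsmall
  refine ⟨r₁, hr₁, fun r y hr0 hrr₁ hy hyR h0 => ?_⟩
  obtain ⟨hbound, -, hr1⟩ := hr ⟨hr0, hrr₁⟩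
  exact (wNorm_sub_le_interpolationBound hα hα2 (by positivity) hR₀ hxR.half hyR.half
    (hC r y hr0 hr1 hy hyR.normLe h0)).trans (ENNReal.ofReal_le_ofReal hbound)

end PathwiseConvergence

section Hypotheses

theorem norm_le_of_norm_single_le {d : ℕ} {F : Type*} [NormedAddCommGroup F] [NormedSpace ℝ F]
    (L : EuclideanSpace ℝ (Fin d) →L[ℝ] F) {K : ℝ} (hK : 0 ≤ K)
    (h : ∀ i, ‖L (EuclideanSpace.single i 1)‖ ≤ K) : ‖L‖ ≤ d * K := by
  refine L.opNorm_le_bound (by positivity) fun x => ?_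
  have hx : ∑ i, x i • EuclideanSpace.single i (1 : ℝ) = x := by
    simpa using (EuclideanSpace.basisFun (Fin d) ℝ).sum_repr x
  calc ‖L x‖ = ‖∑ i, x i • L (EuclideanSpace.single i 1)‖ := by
        conv_lhs => rw [← hx, map_sum]
        simp only [map_smul]
    _ ≤ ∑ _i : Fin d, ‖x‖ * K := norm_sum_le_of_le _ fun i _ => by
        rw [norm_smul]
        exact mul_le_mul (PiLp.norm_apply_le x i) (h i) (norm_nonneg _) (norm_nonneg _)
    _ = d * K * ‖x‖ := by
        rw [Finset.sum_const, Finset.card_univ, Fintype.card_fin, nsmul_eq_mul]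
        ring

theorem abs_sub_rpow_le {s t T β θ : ℝ} (hs : s ∈ Icc 0 T) (ht : t ∈ Icc 0 T) (hθ : 0 < θ)
    (hθβ : θ ≤ β) : |t - s| ^ β ≤ T ^ (β - θ) * |t - s| ^ θ :=
  rpow_le_mul_rpow_of_le (abs_nonneg _)
    (abs_sub_le_iff.2 ⟨by linarith [hs.1, ht.2], by linarith [ht.1, hs.2]⟩) hθ hθβ

theorem integral_le_mul_rpow_half {f : ℝ → ℝ} {a c s t : ℝ}
    (hf : MemLp f 2 (volume.restrict (Icc a c))) (hs : a ≤ s) (hst : s ≤ t) (ht : t ≤ c) :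
    ∫ u in s..t, f u ≤ (∫ u in Icc a c, f u ^ 2) ^ (1 / 2 : ℝ) * (t - s) ^ (1 / 2 : ℝ) := by
  have hsub : Ioc s t ⊆ Icc a c := fun u hu => ⟨hs.trans hu.1.le, hu.2.trans ht⟩
  have hf' : MemLp f 2 (volume.restrict (Ioc s t)) :=
    hf.mono_measure (Measure.restrict_mono hsub le_rfl)
  have hnorm : ∫ u in s..t, f u ≤ ∫ u in Ioc s t, ‖f u‖ * ‖(1 : ℝ)‖ := by
    rw [intervalIntegral.integral_of_le hst, norm_one]
    simp only [mul_one]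
    exact (Real.le_norm_self _).trans (norm_integral_le_integral_norm _)
  have htwo : ENNReal.ofReal 2 = 2 := by simp
  have hholder := integral_mul_norm_le_Lp_mul_Lq (g := fun _ => (1 : ℝ))
    Real.HolderConjugate.two_two (by rwa [htwo]) (memLp_const (μ := volume.restrict (Ioc s t)) 1)
  have hsq : ∫ u in Ioc s t, ‖f u‖ ^ (2 : ℝ) ≤ ∫ u in Icc a c, f u ^ 2 := by
    simp only [Real.rpow_two, Real.norm_eq_abs, sq_abs]
    exact setIntegral_mono_set hf.integrable_sq (ae_of_all _ fun u => sq_nonneg _)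
      hsub.eventuallyLE
  have hone : ∫ _u in Ioc s t, ‖(1 : ℝ)‖ ^ (2 : ℝ) = t - s := by
    simp [Real.volume_real_Ioc_of_le hst]
  rw [hone] at hholder
  have : 0 ≤ t - s := sub_nonneg.2 hst
  have : 0 ≤ ∫ u in Ioc s t, ‖f u‖ ^ (2 : ℝ) := integral_nonneg fun u => by positivity
  exact (hnorm.trans hholder).trans (by gcongr)

variable {d m : ℕ} {T β δ ρ α : ℝ}
  {σ : ℝ → EuclideanSpace ℝ (Fin d) → Fin m → EuclideanSpace ℝ (Fin d)}
  {b : ℝ → EuclideanSpace ℝ (Fin d) → EuclideanSpace ℝ (Fin d)}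

theorem HypH1.exists_bounds (h : HypH1 T β δ σ) :
    ∃ M : ℝ → ℝ, (∀ N ≥ 0, 0 < M N) ∧
      (∀ t ∈ Icc 0 T, ∀ x y, ‖σ t x - σ t y‖ ≤ M 0 * ‖x - y‖) ∧
      (∀ s ∈ Icc 0 T, ∀ t ∈ Icc 0 T, ∀ x, ‖σ t x - σ s x‖ ≤ M 0 * |t - s| ^ β) ∧
      (∀ s ∈ Icc 0 T, ∀ t ∈ Icc 0 T, ∀ x,
        ‖fderiv ℝ (σ t) x - fderiv ℝ (σ s) x‖ ≤ d * (M 0 * |t - s| ^ β)) ∧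
      ∀ N ≥ 0, ∀ t ∈ Icc 0 T, ∀ x y, ‖x‖ ≤ N → ‖y‖ ≤ N →
        ‖fderiv ℝ (σ t) x - fderiv ℝ (σ t) y‖ ≤ d * (M N * ‖x - y‖ ^ δ) := by
  obtain ⟨M, hM, hlip, hspace, htime⟩ := h.bounds
  have := hM 0 le_rfl
  refine ⟨M, hM, hlip, fun s hs t ht x => ?_, fun s hs t ht x => ?_,
    fun N hN t ht x y hx hy => ?_⟩
  · rcases Nat.eq_zero_or_pos d with rfl | hd
    · rw [Subsingleton.elim (σ t x - σ s x) 0, norm_zero]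
      positivity
    · exact (le_add_of_nonneg_right (norm_nonneg _)).trans (htime t ht s hs x ⟨0, hd⟩)
  · exact norm_le_of_norm_single_le _ (by positivity) fun i =>
      (le_add_of_nonneg_left (norm_nonneg _)).trans (htime t ht s hs x i)
  · have := hM N hN
    exact norm_le_of_norm_single_le _ (by positivity) fun i => hspace N hN t ht x y hx hy i

theorem exists_diffusion_bound {θ : ℝ} (hT : 0 ≤ T) (hσ : HypH1 T β δ σ) (hθ : 0 < θ)
    (hθβ : θ ≤ β) :
    ∃ M, 0 ≤ M ∧ (∀ t ∈ Icc 0 T, ∀ x y, ‖σ t x - σ t y‖ ≤ M * ‖x - y‖) ∧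
      (∀ s ∈ Icc 0 T, ∀ t ∈ Icc 0 T, ∀ x, ‖σ t x - σ s x‖ ≤ M * |t - s| ^ θ) ∧
      ∀ t ∈ Icc 0 T, ‖σ t 0‖ ≤ M := by
  obtain ⟨M, hM, hlip, htime, -, -⟩ := hσ.exists_bounds
  have hM₀ := hM 0 le_rfl
  set A := M 0 * T ^ (β - θ)
  have : 0 ≤ A := by positivity
  have htimeθ : ∀ s ∈ Icc 0 T, ∀ t ∈ Icc 0 T, ∀ x, ‖σ t x - σ s x‖ ≤ A * |t - s| ^ θ :=
    fun s hs t ht x => (htime s hs t ht x).trans <| by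
      rw [mul_assoc]
      exact mul_le_mul_of_nonneg_left (abs_sub_rpow_le hs ht hθ hθβ) hM₀.le
  have hzero : ∀ t ∈ Icc 0 T, ‖σ t 0‖ ≤ ‖σ 0 0‖ + A * T ^ θ := fun t ht =>
    calc ‖σ t 0‖ ≤ ‖σ 0 0‖ + ‖σ t 0 - σ 0 0‖ := norm_le_norm_add_norm_sub' _ _
      _ ≤ ‖σ 0 0‖ + A * |t - 0| ^ θ := by gcongr; exact htimeθ 0 ⟨le_rfl, hT⟩ t ht 0
      _ ≤ ‖σ 0 0‖ + A * T ^ θ := by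
        rw [sub_zero, abs_of_nonneg ht.1]
        gcongr
        exacts [ht.1, ht.2]
  refine ⟨M 0 + A + (‖σ 0 0‖ + A * T ^ θ), by positivity, fun t ht x y => ?_,
    fun s hs t ht x => ?_, fun t ht => ?_⟩
  · refine (hlip t ht x y).trans ?_
    gcongr
    rw [add_assoc]
    exact le_add_of_nonneg_right (by positivity)
  · refine (htimeθ s hs t ht x).trans ?_
    gcongr
    rw [add_right_comm]
    exact le_add_of_nonneg_left (by positivity)
  · exact (hzero t ht).trans (le_add_of_nonneg_left (by positivity))

theorem exists_coeffBounds {θ : ℝ} (hT : 0 ≤ T) (hσ : HypH1 T β δ σ) (hb : HypH2' T ρ b)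
    (hθ : 0 < θ) (hθβ : θ ≤ β) :
    ∃ (b₀ : ℝ → ℝ) (M₀ : ℝ), ∀ M ≥ M₀, CoeffBounds T θ M b σ b₀ := by
  obtain ⟨A, hA, hlip, htime, hzero⟩ := exists_diffusion_bound hT hσ hθ hθβ
  obtain ⟨b₀, L, hb₀, hL, -, hgrowth⟩ := hb.bounds
  have hL₀ := hL 0 le_rfl
  have hb₂ : MemLp b₀ 2 (volume.restrict (Icc 0 T)) :=
    hb₀.mono_exponent (by simpa using ENNReal.ofReal_le_ofReal hb.ρ_ge)
  set B := (∫ u in Icc 0 T, b₀ u ^ 2) ^ (1 / 2 : ℝ)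
  have hB : 0 ≤ B := Real.rpow_nonneg (integral_nonneg fun u => sq_nonneg _) _
  refine ⟨b₀, 1 + A + B + L 0, fun M hM => ?_⟩
  have hAM : A ≤ M := by linarith
  have hBM : B ≤ M := by linarith
  have hLM : L 0 ≤ M := by linarith
  exact {
    one_le := by linarith
    lip := fun t ht x y => (hlip t ht x y).trans (by gcongr)
    time := fun s hs t ht x => (htime s hs t ht x).trans (by gcongr)
    zero := fun t ht => (hzero t ht).trans hAM
    integrable := (intervalIntegrable_iff_integrableOn_Icc_of_le hT).2
      (hb₂.integrable one_le_two)
    nonneg := fun t ht => by simpa using (norm_nonneg _).trans (hgrowth t ht 0)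
    half := fun s t hs hst ht => (integral_le_mul_rpow_half hb₂ hs hst ht).trans
      (mul_le_mul_of_nonneg_right hBM (Real.rpow_nonneg (sub_nonneg.2 hst) _))
    growth := fun t ht x => (hgrowth t ht x).trans (by gcongr) }

theorem exists_localBounds {θ R : ℝ} (hT : 0 ≤ T) (hσ : HypH1 T β δ σ) (hb : HypH2' T ρ b)
    (hθ : 0 < θ) (hθβ : θ ≤ β) (hR : 0 ≤ R) : ∃ M : ℝ, LocalBounds T θ δ R M b σ := by
  obtain ⟨M, hM, -, -, htime, hspace⟩ := hσ.exists_bounds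
  obtain ⟨b₀, L, -, hL, hdrift, -⟩ := hb.bounds
  have hM₀ := hM 0 le_rfl
  have hMR := hM R hR
  have hLR := hL R hR
  have hA : 0 ≤ d * (M 0 * T ^ (β - θ)) := by positivity
  have hB : 0 ≤ d * M R := by positivity
  refine ⟨d * (M 0 * T ^ (β - θ)) + d * M R + L R, by positivity, hσ.differentiable,
    fun s hs t ht x => ?_, fun t ht x y hx hy => ?_, fun t ht x y hx hy => ?_⟩
  · calc ‖fderiv ℝ (σ t) x - fderiv ℝ (σ s) x‖ ≤ d * (M 0 * |t - s| ^ β) := htime s hs t ht x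
      _ ≤ d * (M 0 * (T ^ (β - θ) * |t - s| ^ θ)) := by
          gcongr
          exact abs_sub_rpow_le hs ht hθ hθβ
      _ = d * (M 0 * T ^ (β - θ)) * |t - s| ^ θ := by ring
      _ ≤ _ := by gcongr; linarith
  · refine (hspace R hR t ht x y hx hy).trans ?_
    rw [← mul_assoc]
    gcongr
    linarith
  · refine (hdrift R hR t ht x y hx hy).trans ?_
    gcongr
    linarith

theorem HolderBound.of_exponent_ge {E : Type*} [NormedAddCommGroup E] {f : ℝ → E} {S : Set ℝ}
    {K L a θ : ℝ} (h : HolderBound K a S f) (hK : 0 ≤ K) (hθ : 0 < θ) (hθa : θ ≤ a)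
    (hS : ∀ u ∈ S, ∀ v ∈ S, v - u ≤ L) : HolderBound (K * L ^ (a - θ)) θ S f :=
  fun u hu v hv huv => (h hu hv huv).trans <| by
    rw [mul_assoc]
    exact mul_le_mul_of_nonneg_left
      (rpow_le_mul_rpow_of_le (sub_nonneg.2 huv) (hS u hu v hv) hθ hθa) hK

theorem HolderBound.trans {E : Type*} [NormedAddCommGroup E] {f : ℝ → E} {K₁ K₂ θ a c e : ℝ}
    (h₁ : HolderBound K₁ θ (Icc a c) f) (h₂ : HolderBound K₂ θ (Icc c e) f) (hθ : 0 ≤ θ)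
    (hK₁ : 0 ≤ K₁) (hK₂ : 0 ≤ K₂) : HolderBound (K₁ + K₂) θ (Icc a e) f :=
  fun _ hu _ hv huv => h₁.trans_holderAtScale hθ hK₁ hK₂
    (fun _ hu _ hv huv _ => h₂ hu hv huv) hu hv huv le_rfl

theorem MemHolder.exists_holderNormLe {E : Type*} [NormedAddCommGroup E] {lam a c : ℝ}
    {f : ℝ → E} (hlam : 0 < lam) (hf : MemHolder lam a c f) :
    ∃ K, 0 ≤ K ∧ HolderNormLe K lam a c f := by
  refine ⟨(holderNorm lam a c f).toReal, ENNReal.toReal_nonneg, fun t ht => ?_,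
    fun s hs t ht hst => ?_⟩
  · have hsup : ‖f t‖ₑ ≤ holderNorm lam a c f :=
      le_trans (le_iSup₂ (f := fun t (_ : t ∈ Icc a c) => ‖f t‖ₑ) t ht) le_self_add
    simpa using ENNReal.toReal_mono (ne_of_lt hf) hsup
  · rcases hst.eq_or_lt with rfl | hst
    · simp [Real.zero_rpow hlam.ne']
    have hp : 0 < (t - s) ^ lam := Real.rpow_pos_of_pos (sub_pos.2 hst) _
    have hquot : ‖f t - f s‖ₑ / ENNReal.ofReal ((t - s) ^ lam) ≤ holderNorm lam a c f :=
      calc _ ≤ ⨆ s ∈ Ico a t, ‖f t - f s‖ₑ / ENNReal.ofReal ((t - s) ^ lam) :=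
            le_iSup₂ (f := fun s (_ : s ∈ Ico a t) =>
              ‖f t - f s‖ₑ / ENNReal.ofReal ((t - s) ^ lam)) s ⟨hs.1, hst⟩
        _ ≤ ⨆ t ∈ Icc a c, ⨆ s ∈ Ico a t, ‖f t - f s‖ₑ / ENNReal.ofReal ((t - s) ^ lam) :=
            le_iSup₂ (f := fun t (_ : t ∈ Icc a c) =>
              ⨆ s ∈ Ico a t, ‖f t - f s‖ₑ / ENNReal.ofReal ((t - s) ^ lam)) t ht
        _ ≤ _ := le_add_self
    rw [← ofReal_norm, ← ENNReal.ofReal_div_of_pos hp] at hquot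
    have := ENNReal.toReal_mono (ne_of_lt hf) hquot
    rwa [ENNReal.toReal_ofReal (by positivity), div_le_iff₀ hp] at this

theorem IsDelaySolution.delayPath {r r₀ θ M K : ℝ} {η x : ℝ → EuclideanSpace ℝ (Fin d)}
    {g : Fin m → ℝ → ℝ} (hx : IsDelaySolution α T r b σ η g x) (hT : 0 < T) (hr : 0 < r)
    (hrr : r ≤ r₀) (hα2 : α ≤ 1 / 2) (hθ : 0 < θ) (hθα : θ ≤ α) (hK : 0 ≤ K)
    (hη : HolderNormLe K (1 - α) (-r₀) 0 η) (hM : K * (1 + r₀ ^ (1 - α - θ)) ≤ M) :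
    DelayPath T r θ M b σ g x := by
  have hr₀ : 0 ≤ r₀ := hr.le.trans hrr
  have hx₀ : x 0 = η 0 := hx.initial 0 ⟨by linarith, le_rfl⟩
  have hsub : Icc (-r) 0 ⊆ Icc (-r₀) 0 := Icc_subset_Icc_left (neg_le_neg hrr)
  have hKr : 0 ≤ K * r₀ ^ (1 - α - θ) := by positivity
  rw [mul_add, mul_one] at hM
  have hM₀ : 0 ≤ M := by linarith
  have hinit : HolderBound M θ (Icc (-r) 0) x := fun u hu v hv huv => by
    rw [hx.initial u hu, hx.initial v hv]
    exact ((hη.holder.of_exponent_ge (L := r₀) hK hθ (by linarith) fun u hu v hv => by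
      linarith [hu.1, hv.2]).weaken (by linarith)) (hsub hu) (hsub hv) huv
  obtain ⟨C, hC, hCx⟩ := hx.memW.exists_holderBound_Icc (hθ.trans_le hθα) hr
  rw [neg_add_cancel] at hCx
  have hpos : HolderBound (C * T ^ (α - θ)) θ (Icc 0 T) x :=
    hCx.of_exponent_ge hC hθ hθα fun u hu v hv => by linarith [hu.1, hv.2]
  exact {
    eq := IncrementEq.of_equation hT fun t ht => by
      rw [hx₀]
      exact hx.equation t ht
    init := ⟨fun t ht => by
      rw [hx.initial t ht]
      exact (hη.norm_le t (hsub ht)).trans (by linarith), hinit⟩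
    holder := ⟨M + C * T ^ (α - θ), by positivity,
      hinit.trans hpos hθ.le hM₀ (by positivity)⟩ }

theorem IncrementEq.exists_norm_sub_apply_zero_le {θ ν G M A B : ℝ} {b₀ : ℝ → ℝ}
    {x : ℝ → EuclideanSpace ℝ (Fin d)} {g : Fin m → ℝ → ℝ} (he : IncrementEq T 0 b σ g x)
    (h : CoeffBounds T θ M b σ b₀) (hp : YoungPair θ ν) (hθ : 0 < θ) (hg : HolderDriver T ν G g)
    (hA : ∀ t ∈ Icc 0 T, ‖x t‖ ≤ A) (hB : 0 ≤ B) (hx : HolderBound B θ (Ioc 0 T) x) (hT : 0 ≤ T) :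
    ∃ C, 0 ≤ C ∧ ∀ t ∈ Ioc 0 T, ‖x t - x 0‖ ≤ C * t ^ θ := by
  have := h.const_nonneg
  have := hg.nonneg
  have := youngConst_nonneg hp.one_lt
  have : 0 ≤ A := (norm_nonneg _).trans (hA 0 ⟨le_rfl, hT⟩)
  refine ⟨M * A * T ^ (1 - θ) + M * T ^ (1 / 2 - θ) +
    m * (G * (M * (1 + A) + youngConst (θ + ν) * (M * (1 + B)) * T ^ θ) * T ^ (ν - θ)),
    by positivity, fun t ht => ?_⟩
  have hincr := he.norm_sub_le h hθ.le hp.pos_right.le hp.one_lt hg le_rfl ht.1 ht.2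
    (fun u hu => hA u ⟨hu.1, hu.2.trans ht.2⟩) (by rw [sub_zero]; exact hA t ⟨ht.1.le, ht.2⟩)
    (by simpa only [sub_zero] using hx.mono (Ioc_subset_Ioc_right ht.2))
  have hhalf := h.half 0 t le_rfl ht.1.le ht.2
  rw [sub_zero] at hincr hhalf
  have hpow : ∀ a, θ ≤ a → t ^ a ≤ T ^ (a - θ) * t ^ θ := fun a ha =>
    rpow_le_mul_rpow_of_le ht.1.le ht.2 hθ ha
  have hone := hpow 1 (by linarith [hp.le_half])
  rw [Real.rpow_one] at hone
  have ht₀ : 0 ≤ t := ht.1.le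
  calc ‖x t - x 0‖ ≤ M * A * t + M * t ^ (1 / 2 : ℝ) +
        m * (G * (M * (1 + A) + youngConst (θ + ν) * (M * (1 + B)) * t ^ θ) * t ^ ν) :=
        hincr.trans (by gcongr)
    _ ≤ M * A * (T ^ (1 - θ) * t ^ θ) + M * (T ^ (1 / 2 - θ) * t ^ θ) +
        m * (G * (M * (1 + A) + youngConst (θ + ν) * (M * (1 + B)) * T ^ θ) *
          (T ^ (ν - θ) * t ^ θ)) := by
        gcongr
        · exact hpow _ hp.le_half
        · exact ht.2
        · exact hpow _ (hp.le_half.trans hp.half_lt_right.le)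
    _ = _ := by ring

theorem IsSolution.apply_zero {x₀ : EuclideanSpace ℝ (Fin d)} {x : ℝ → EuclideanSpace ℝ (Fin d)}
    {g : Fin m → ℝ → ℝ} (hx : IsSolution α T b σ x₀ g x) (hT : 0 ≤ T) : x 0 = x₀ := by
  obtain ⟨-, I, hI, hx₀⟩ := hx.equation 0 ⟨le_rfl, hT⟩
  simpa only [(hI _).eq_zero_of_eq, intervalIntegral.integral_same, Finset.sum_const_zero,
    add_zero] using hx₀

theorem IsSolution.incrementEq {x₀ : EuclideanSpace ℝ (Fin d)} {x : ℝ → EuclideanSpace ℝ (Fin d)}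
    {g : Fin m → ℝ → ℝ} (hx : IsSolution α T b σ x₀ g x) (hT : 0 < T) :
    IncrementEq T 0 b σ g x :=
  IncrementEq.of_equation hT fun t ht => by
    simpa only [hx.apply_zero hT.le, sub_zero] using hx.equation t ⟨ht.1.le, ht.2⟩

theorem IsSolution.delayPath {θ ν G M : ℝ} {x₀ : EuclideanSpace ℝ (Fin d)} {b₀ : ℝ → ℝ}
    {x : ℝ → EuclideanSpace ℝ (Fin d)} {g : Fin m → ℝ → ℝ} (hx : IsSolution α T b σ x₀ g x)
    (hT : 0 < T) (h : CoeffBounds T θ M b σ b₀) (hθ : 0 < θ) (hθα : θ ≤ α) (hp : YoungPair θ ν)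
    (hg : HolderDriver T ν G g) (hM : ‖x₀‖ ≤ M) : DelayPath T 0 θ M b σ g x := by
  obtain ⟨K, hK, hKx⟩ := hx.memW.exists_holderBound_Ioc (hθ.trans_le hθα)
  have hpos : HolderBound (K * T ^ (α - θ)) θ (Ioc 0 T) x :=
    hKx.of_exponent_ge hK hθ hθα fun u hu v hv => by linarith [hu.1, hv.2]
  have hB : 0 ≤ K * T ^ (α - θ) := by positivity
  obtain ⟨C, hC, hCx⟩ := (hx.incrementEq hT).exists_norm_sub_apply_zero_le h hp hθ hg
    (fun _ ht => hx.memW.norm_le ht) hB hpos hT.le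
  refine ⟨hx.incrementEq hT, ?_, K * T ^ (α - θ) + C, by positivity, ?_⟩
  · rw [neg_zero]
    refine ⟨fun t ht => ?_, fun u hu v hv _ => ?_⟩
    · rw [Icc_self, mem_singleton_iff] at ht
      rwa [ht, hx.apply_zero hT.le]
    · rw [Icc_self, mem_singleton_iff] at hu hv
      simp [hu, hv, Real.zero_rpow hθ.ne']
  · rw [neg_zero]
    intro u hu v hv huv
    rcases huv.eq_or_lt with rfl | huv
    · simp [Real.zero_rpow hθ.ne']
    rcases hu.1.eq_or_lt with rfl | hu₀
    · rw [sub_zero]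
      have : 0 ≤ v ^ θ := Real.rpow_nonneg huv.le _
      exact (hCx v ⟨huv, hv.2⟩).trans (by gcongr; exact le_add_of_nonneg_left hB)
    · exact (hpos.weaken (le_add_of_nonneg_right hC)) ⟨hu₀, hu.2⟩ ⟨hu₀.trans huv, hv.2⟩ huv.le

end Hypotheses

section DyadicChaining

variable {E : Type*} [NormedAddCommGroup E] {K q a b s t ν : ℝ} {f : ℝ → E} {n : ℕ}

/-- The increments of `f` over the dyadic intervals of level `n` of `[a, b]` are at most
`K * q ^ n`. -/
def DyadicBound (K q a b : ℝ) (f : ℝ → E) : Prop :=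
  ∀ ⦃n k : ℕ⦄, k < 2 ^ n → ‖f (dyadicPoint a b n (k + 1)) - f (dyadicPoint a b n k)‖ ≤ K * q ^ n

/-- The index of the dyadic interval of level `n` of `[a, b]` that contains `t`. -/
def dyadicIndex (a b : ℝ) (n : ℕ) (t : ℝ) : ℕ := ⌊(t - a) / (b - a) * 2 ^ n⌋₊

/-- The largest dyadic point of level `n` of `[a, b]` below `t`. -/
def dyadicFloor (a b : ℝ) (n : ℕ) (t : ℝ) : ℝ := dyadicPoint a b n (dyadicIndex a b n t)

theorem eq_add_mul_div_two_pow (hab : a < b) (n : ℕ) (t : ℝ) :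
    t = a + (t - a) / (b - a) * 2 ^ n * ((b - a) / 2 ^ n) := by
  have : b - a ≠ 0 := (sub_pos.2 hab).ne'
  field_simp
  ring

theorem dyadicFloor_le (hab : a < b) (ht : a ≤ t) : dyadicFloor a b n t ≤ t := by
  have : 0 < b - a := sub_pos.2 hab
  have : 0 ≤ t - a := sub_nonneg.2 ht
  have hfloor : (dyadicIndex a b n t : ℝ) ≤ (t - a) / (b - a) * 2 ^ n :=
    Nat.floor_le (by positivity)
  calc dyadicFloor a b n t ≤ a + (t - a) / (b - a) * 2 ^ n * ((b - a) / 2 ^ n) := by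
        unfold dyadicFloor dyadicPoint; gcongr
    _ = t := (eq_add_mul_div_two_pow hab n t).symm

theorem lt_dyadicFloor_add (hab : a < b) (n : ℕ) (t : ℝ) :
    t < dyadicFloor a b n t + (b - a) / 2 ^ n := by
  have : 0 < b - a := sub_pos.2 hab
  calc t = a + (t - a) / (b - a) * 2 ^ n * ((b - a) / 2 ^ n) := eq_add_mul_div_two_pow hab n t
    _ < a + (dyadicIndex a b n t + 1) * ((b - a) / 2 ^ n) := by
        gcongr; exact Nat.lt_floor_add_one _
    _ = dyadicFloor a b n t + (b - a) / 2 ^ n := by unfold dyadicFloor dyadicPoint; ring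

theorem dyadicIndex_le_two_pow (ht : t ∈ Icc a b) : dyadicIndex a b n t ≤ 2 ^ n := by
  have hta : 0 ≤ t - a := sub_nonneg.2 ht.1
  have : (t - a) / (b - a) ≤ 1 := div_le_one_of_le₀ (by linarith [ht.2]) (by linarith [ht.2])
  exact Nat.floor_le_of_le (by
    push_cast
    exact mul_le_of_le_one_left (by positivity) this)

theorem dyadicFloor_mem_Icc (hab : a < b) (ht : t ∈ Icc a b) : dyadicFloor a b n t ∈ Icc a b :=
  dyadicPoint_mem_Icc hab.le (dyadicIndex_le_two_pow ht)

theorem dyadicIndex_succ_div_two (a b : ℝ) (n : ℕ) (t : ℝ) :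
    dyadicIndex a b (n + 1) t / 2 = dyadicIndex a b n t := by
  unfold dyadicIndex
  rw [← Nat.floor_div_natCast, pow_succ, ← mul_assoc, Nat.cast_ofNat,
    mul_div_cancel_right₀ _ two_ne_zero]

theorem tendsto_dyadicFloor (hab : a < b) (ht : t ∈ Icc a b) :
    Tendsto (fun n => dyadicFloor a b n t) atTop (𝓝[Icc a b] t) := by
  have hmesh : Tendsto (fun n : ℕ => (b - a) / 2 ^ n) atTop (𝓝 0) :=
    tendsto_const_nhds.div_atTop (tendsto_pow_atTop_atTop_of_one_lt one_lt_two)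
  have hlower : Tendsto (fun n : ℕ => t - (b - a) / 2 ^ n) atTop (𝓝 t) := by
    simpa only [sub_zero] using hmesh.const_sub t
  exact tendsto_nhdsWithin_iff.2 ⟨tendsto_of_tendsto_of_tendsto_of_le_of_le hlower
    tendsto_const_nhds (fun n => by linarith [lt_dyadicFloor_add hab n t])
    (fun n => dyadicFloor_le hab ht.1), .of_forall fun n => dyadicFloor_mem_Icc hab ht⟩

namespace DyadicBound

theorem norm_sub_dyadicFloor_succ_le (h : DyadicBound K q a b f) (hK : 0 ≤ K) (hq : 0 ≤ q)
    (ht : t ∈ Icc a b) (n : ℕ) :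
    ‖f (dyadicFloor a b n t) - f (dyadicFloor a b (n + 1) t)‖ ≤ K * q * q ^ n := by
  have hfloor : dyadicFloor a b n t = dyadicPoint a b (n + 1) (2 * dyadicIndex a b n t) :=
    (dyadicPoint_succ_two_mul a b n _).symm
  have hdiv := dyadicIndex_succ_div_two a b n t
  rw [hfloor, norm_sub_rev, dyadicFloor]
  obtain heven | hodd : dyadicIndex a b (n + 1) t = 2 * dyadicIndex a b n t ∨
      dyadicIndex a b (n + 1) t = 2 * dyadicIndex a b n t + 1 := by omega
  · rw [heven, sub_self, norm_zero]
    positivity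
  · rw [hodd, mul_assoc, ← pow_succ']
    exact h (by have := dyadicIndex_le_two_pow (n := n + 1) ht; omega)

theorem norm_dyadicFloor_sub_le (h : DyadicBound K q a b f) (hf : ContinuousOn f (Icc a b))
    (hab : a < b) (hK : 0 ≤ K) (hq : 0 ≤ q) (hq1 : q < 1) (ht : t ∈ Icc a b) (n : ℕ) :
    ‖f (dyadicFloor a b n t) - f t‖ ≤ K * q ^ n * (q / (1 - q)) := by
  have htail := dist_le_of_le_geometric_of_tendsto q (K * q) hq1
    (fun n => (dist_eq_norm _ _).trans_le (h.norm_sub_dyadicFloor_succ_le hK hq ht n))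
    ((hf t ht).tendsto.comp (tendsto_dyadicFloor hab ht)) n
  rw [← dist_eq_norm]
  exact htail.trans_eq (by ring)

theorem norm_dyadicFloor_sub_dyadicFloor_le (h : DyadicBound K q a b f) (hab : a < b) (hK : 0 ≤ K)
    (hq : 0 ≤ q) (hs : a ≤ s) (ht : t ∈ Icc a b) (hst : s ≤ t) (hn : t - s ≤ (b - a) / 2 ^ n) :
    ‖f (dyadicFloor a b n t) - f (dyadicFloor a b n s)‖ ≤ K * q ^ n := by
  have hba : 0 < b - a := sub_pos.2 hab
  have hmono : dyadicIndex a b n s ≤ dyadicIndex a b n t := Nat.floor_mono (by gcongr)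
  have hsucc : dyadicIndex a b n t ≤ dyadicIndex a b n s + 1 := by
    have hle : (t - a) / (b - a) * 2 ^ n ≤ (s - a) / (b - a) * 2 ^ n + 1 := by
      rw [le_div_iff₀ (by positivity)] at hn
      rw [div_mul_eq_mul_div, div_mul_eq_mul_div, div_add_one hba.ne']
      gcongr
      linarith
    exact (Nat.floor_mono hle).trans_eq (Nat.floor_add_one
      (mul_nonneg (div_nonneg (sub_nonneg.2 hs) hba.le) (by positivity)))
  unfold dyadicFloor
  obtain heq | hadj : dyadicIndex a b n t = dyadicIndex a b n s ∨
      dyadicIndex a b n t = dyadicIndex a b n s + 1 := by omega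
  · rw [heq, sub_self, norm_zero]
    positivity
  · rw [hadj]
    exact h (by have := dyadicIndex_le_two_pow (n := n) ht; omega)

end DyadicBound

/-- The constant of the dyadic chaining argument on an interval of length `L`. -/
def chainingConst (ν L : ℝ) : ℝ := (2 / L) ^ ν * (1 + 2 * (2 ^ (-ν) / (1 - 2 ^ (-ν))))

theorem two_rpow_neg_lt_one (hν : 0 < ν) : (2 : ℝ) ^ (-ν) < 1 :=
  Real.rpow_lt_one_of_one_lt_of_neg one_lt_two (neg_lt_zero.2 hν)

theorem chainingConst_pos (hν : 0 < ν) {L : ℝ} (hL : 0 < L) : 0 < chainingConst ν L := by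
  have := sub_pos.2 (two_rpow_neg_lt_one hν)
  unfold chainingConst
  positivity

theorem two_rpow_neg_pow_le (hν : 0 ≤ ν) {L d : ℝ} (hL : 0 < L) (hd : 0 ≤ d)
    (hn : L / 2 ^ (n + 1) ≤ d) : ((2 : ℝ) ^ (-ν)) ^ n ≤ (2 / L) ^ ν * d ^ ν := by
  calc ((2 : ℝ) ^ (-ν)) ^ n = (1 / 2 ^ n) ^ ν := by
        rw [div_two_pow_rpow zero_le_one, Real.one_rpow, one_mul]
    _ = (2 / L * (L / 2 ^ (n + 1))) ^ ν := by
        congr 1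
        field_simp
        rw [pow_succ]
    _ ≤ (2 / L * d) ^ ν := by gcongr
    _ = (2 / L) ^ ν * d ^ ν := Real.mul_rpow (by positivity) hd

theorem DyadicBound.holderBound (h : DyadicBound K (2 ^ (-ν)) a b f)
    (hf : ContinuousOn f (Icc a b)) (hab : a < b) (hK : 0 ≤ K) (hν : 0 < ν) :
    HolderBound (chainingConst ν (b - a) * K) ν (Icc a b) f := by
  intro s hs t ht hst
  obtain rfl | hlt := hst.eq_or_lt
  · simp [Real.zero_rpow hν.ne']
  set q : ℝ := 2 ^ (-ν)
  have hq : 0 ≤ q := by positivity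
  have hq1 : q < 1 := two_rpow_neg_lt_one hν
  have : 0 < 1 - q := sub_pos.2 hq1
  have hba : 0 < b - a := sub_pos.2 hab
  have hd : 0 < t - s := sub_pos.2 hlt
  obtain ⟨n, hn, hn'⟩ := exists_nat_pow_near (x := (b - a) / (t - s)) (y := 2)
    ((one_le_div hd).2 (by linarith [hs.1, ht.2])) one_lt_two
  have hlevel : t - s ≤ (b - a) / 2 ^ n := (le_div_comm₀ (by positivity) hd).1 hn
  have hlevel' : (b - a) / 2 ^ (n + 1) ≤ t - s := ((div_lt_comm₀ hd (by positivity)).1 hn').le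
  calc ‖f t - f s‖
      = ‖(f (dyadicFloor a b n t) - f (dyadicFloor a b n s)) -
          (f (dyadicFloor a b n t) - f t) + (f (dyadicFloor a b n s) - f s)‖ := by
        congr 1; abel
    _ ≤ K * q ^ n + K * q ^ n * (q / (1 - q)) + K * q ^ n * (q / (1 - q)) :=
        norm_add_le_of_le (norm_sub_le_of_le
          (h.norm_dyadicFloor_sub_dyadicFloor_le hab hK hq hs.1 ht hst hlevel)
          (h.norm_dyadicFloor_sub_le hf hab hK hq hq1 ht n))
          (h.norm_dyadicFloor_sub_le hf hab hK hq hq1 hs n)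
    _ = K * (1 + 2 * (q / (1 - q))) * q ^ n := by ring
    _ ≤ K * (1 + 2 * (q / (1 - q))) * ((2 / (b - a)) ^ ν * (t - s) ^ ν) := by
        gcongr
        exact two_rpow_neg_pow_le hν.le hba hd.le hlevel'
    _ = chainingConst ν (b - a) * K * (t - s) ^ ν := by unfold chainingConst; ring

end DyadicChaining

section GaussianTails

/-- The weight `u ^ (2l) * exp (ε u²)`. Its Gaussian integral decays like `s ^ (2l)` in the standard
deviation `s`, which outweighs the number of dyadic intervals of a level once `l` is large. -/
def gaussWeight (ε : ℝ) (l : ℕ) (u : ℝ) : ℝ := u ^ (2 * l) * Real.exp (ε * u ^ 2)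

theorem gaussWeight_nonneg (ε : ℝ) (l : ℕ) (u : ℝ) : 0 ≤ gaussWeight ε l u :=
  mul_nonneg ((even_two_mul l).pow_nonneg u) (Real.exp_nonneg _)

theorem measurable_gaussWeight (ε : ℝ) (l : ℕ) : Measurable (gaussWeight ε l) := by
  unfold gaussWeight
  fun_prop

theorem gaussWeight_mul_le {ε s : ℝ} (hε : 0 ≤ ε) (hs : 0 ≤ s) (hs1 : s ≤ 1) (l : ℕ) (u : ℝ) :
    gaussWeight ε l (s * u) ≤ s ^ (2 * l) * gaussWeight ε l u := by
  have hsq : (s * u) ^ 2 ≤ u ^ 2 := by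
    rw [mul_pow]
    exact mul_le_of_le_one_left (sq_nonneg u) (pow_le_one₀ hs hs1)
  have : 0 ≤ u ^ (2 * l) := (even_two_mul l).pow_nonneg u
  rw [gaussWeight, gaussWeight, mul_pow, mul_assoc]
  gcongr

theorem exp_le_add_gaussWeight {ε : ℝ} (hε : 0 ≤ ε) (l : ℕ) (u : ℝ) :
    Real.exp (ε * u ^ 2) ≤ Real.exp ε + gaussWeight ε l u := by
  rcases le_total (u ^ 2) 1 with h | h
  · exact (Real.exp_le_exp.2 (mul_le_of_le_one_right hε h)).trans
      (le_add_of_nonneg_right (gaussWeight_nonneg ε l u))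
  · refine le_trans ?_ (le_add_of_nonneg_left (Real.exp_nonneg ε))
    rw [gaussWeight, pow_mul]
    exact le_mul_of_one_le_left (Real.exp_nonneg _) (one_le_pow₀ h)

theorem exists_lintegral_gaussWeight_lt_top :
    ∃ ε : ℝ, 0 < ε ∧ ∀ l, ∫⁻ u, ENNReal.ofReal (gaussWeight ε l u) ∂(gaussianReal 0 1) < ∞ := by
  obtain ⟨C, hC, hint⟩ := IsGaussian.exists_integrable_exp_sq (gaussianReal 0 1)
  refine ⟨C / 2, half_pos hC, fun l => ?_⟩
  have hle : ∀ u : ℝ,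
      gaussWeight (C / 2) l u ≤ l.factorial / (C / 2) ^ l * Real.exp (C * ‖u‖ ^ 2) := by
    intro u
    have hpow : u ^ (2 * l) ≤ l.factorial / (C / 2) ^ l * Real.exp (C / 2 * u ^ 2) := by
      have h := Real.pow_div_factorial_le_exp (C / 2 * u ^ 2) (by positivity) l
      rw [div_le_iff₀ (by positivity), mul_pow, ← pow_mul] at h
      rw [div_mul_eq_mul_div, le_div_iff₀ (by positivity)]
      linarith
    calc gaussWeight (C / 2) l u
        ≤ l.factorial / (C / 2) ^ l * Real.exp (C / 2 * u ^ 2) * Real.exp (C / 2 * u ^ 2) :=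
          mul_le_mul_of_nonneg_right hpow (Real.exp_nonneg _)
      _ = l.factorial / (C / 2) ^ l * Real.exp (C * ‖u‖ ^ 2) := by
          rw [mul_assoc, ← Real.exp_add, Real.norm_eq_abs, sq_abs]
          ring_nf
  exact (lintegral_mono fun u => ENNReal.ofReal_le_ofReal (hle u)).trans_lt
    (hint.const_mul _).lintegral_lt_top

variable {Ω : Type*} {ε : ℝ} {l : ℕ} {ξ : ℕ → ℕ → Ω → ℝ}

/-- The sum of the weights `gaussWeight ε l` over a dyadic array, which controls its supremum. -/
def gaussSum (ε : ℝ) (l : ℕ) (ξ : ℕ → ℕ → Ω → ℝ) (ω : Ω) : ℝ≥0∞ :=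
  ∑' n, ∑ k ∈ Finset.range (2 ^ n), ENNReal.ofReal (gaussWeight ε l (ξ n k ω))

theorem gaussWeight_le_toReal_gaussSum {ω : Ω} (hω : gaussSum ε l ξ ω < ∞) {n k : ℕ}
    (hk : k < 2 ^ n) : gaussWeight ε l (ξ n k ω) ≤ (gaussSum ε l ξ ω).toReal := by
  have hle : ENNReal.ofReal (gaussWeight ε l (ξ n k ω)) ≤ gaussSum ε l ξ ω :=
    (Finset.single_le_sum (f := fun k => ENNReal.ofReal (gaussWeight ε l (ξ n k ω)))
      (fun _ _ => zero_le) (Finset.mem_range.2 hk)).trans (ENNReal.le_tsum n)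
  exact (ENNReal.ofReal_le_iff_le_toReal hω.ne).1 hle

theorem exists_bound_of_gaussSum_lt_top (hε : 0 < ε) {ω : Ω} (hω : gaussSum ε l ξ ω < ∞) :
    ∃ K : ℝ, 0 ≤ K ∧ (∀ ⦃n k : ℕ⦄, k < 2 ^ n → |ξ n k ω| ≤ K) ∧
      ENNReal.ofReal (Real.exp (ε * K ^ 2)) ≤ ENNReal.ofReal (Real.exp ε) + gaussSum ε l ξ ω := by
  set z := (gaussSum ε l ξ ω).toReal
  have hz : 0 ≤ z := ENNReal.toReal_nonneg
  have hone : 1 ≤ Real.exp ε + z := by linarith [Real.one_le_exp hε.le]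
  have hpos : 0 < Real.exp ε + z := one_pos.trans_le hone
  have := Real.log_nonneg hone
  set K := √(Real.log (Real.exp ε + z) / ε)
  have hK : ε * K ^ 2 = Real.log (Real.exp ε + z) := by
    rw [Real.sq_sqrt (by positivity), mul_div_cancel₀ _ hε.ne']
  refine ⟨K, Real.sqrt_nonneg _, fun n k hk => ?_, ?_⟩
  · have hexp : Real.exp (ε * ξ n k ω ^ 2) ≤ Real.exp ε + z :=
      (exp_le_add_gaussWeight hε.le l _).trans
        (add_le_add_right (gaussWeight_le_toReal_gaussSum hω hk) _)
    refine abs_le_of_sq_le_sq (le_of_mul_le_mul_left ?_ hε) (Real.sqrt_nonneg _)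
    exact hK ▸ (Real.le_log_iff_exp_le hpos).2 hexp
  · rw [hK, Real.exp_log hpos, ENNReal.ofReal_add (Real.exp_nonneg _) hz,
      ENNReal.ofReal_toReal hω.ne]

variable [MeasurableSpace Ω] {P : Measure Ω} {p : ℝ}

theorem lintegral_gaussWeight_le {X : Ω → ℝ} {s : ℝ}
    (hX : HasLaw X ((gaussianReal 0 1).map (s * ·)) P) (hε : 0 ≤ ε) (hs : 0 ≤ s) (hs1 : s ≤ 1) :
    ∫⁻ ω, ENNReal.ofReal (gaussWeight ε l (X ω)) ∂P ≤
      ENNReal.ofReal (s ^ (2 * l)) *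
        ∫⁻ u, ENNReal.ofReal (gaussWeight ε l u) ∂(gaussianReal 0 1) := by
  have hmeas : Measurable fun u => ENNReal.ofReal (gaussWeight ε l u) :=
    (measurable_gaussWeight ε l).ennreal_ofReal
  rw [hX.lintegral_comp hmeas.aemeasurable, lintegral_map hmeas (measurable_const_mul s),
    ← lintegral_const_mul _ hmeas]
  refine lintegral_mono fun u => ?_
  rw [← ENNReal.ofReal_mul (by positivity)]
  exact ENNReal.ofReal_le_ofReal (gaussWeight_mul_le hε hs hs1 l u)

/-- A triangular array `ξ n k`, `k < 2 ^ n`, of centred Gaussian variables, not necessarily jointly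
Gaussian, with standard deviations `p ^ n`. -/
def DyadicGaussian (P : Measure Ω) (p : ℝ) (ξ : ℕ → ℕ → Ω → ℝ) : Prop :=
  ∀ ⦃n k : ℕ⦄, k < 2 ^ n → HasLaw (ξ n k) ((gaussianReal 0 1).map (p ^ n * ·)) P

namespace DyadicGaussian

theorem aemeasurable_gaussWeight (h : DyadicGaussian P p ξ) (n : ℕ) :
    ∀ k ∈ Finset.range (2 ^ n),
      AEMeasurable (fun ω => ENNReal.ofReal (gaussWeight ε l (ξ n k ω))) P := fun _ hk =>
  ((measurable_gaussWeight ε l).comp_aemeasurable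
    (h (Finset.mem_range.1 hk)).aemeasurable).ennreal_ofReal

theorem aemeasurable_gaussSum (h : DyadicGaussian P p ξ) : AEMeasurable (gaussSum ε l ξ) P :=
  .tsum fun n => Finset.aemeasurable_fun_sum _ (h.aemeasurable_gaussWeight n)

theorem lintegral_level_le (h : DyadicGaussian P p ξ) (hε : 0 ≤ ε) (hp : 0 ≤ p) (hp1 : p ≤ 1)
    (hl : p ^ (2 * l) ≤ 1 / 4) (n : ℕ) :
    ∫⁻ ω, ∑ k ∈ Finset.range (2 ^ n), ENNReal.ofReal (gaussWeight ε l (ξ n k ω)) ∂P ≤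
      ENNReal.ofReal ((1 / 2) ^ n) *
        ∫⁻ u, ENNReal.ofReal (gaussWeight ε l u) ∂(gaussianReal 0 1) := by
  set Γ := ∫⁻ u, ENNReal.ofReal (gaussWeight ε l u) ∂(gaussianReal 0 1)
  rw [lintegral_finsetSum' _ (h.aemeasurable_gaussWeight n)]
  calc ∑ k ∈ Finset.range (2 ^ n), ∫⁻ ω, ENNReal.ofReal (gaussWeight ε l (ξ n k ω)) ∂P
      ≤ ∑ _k ∈ Finset.range (2 ^ n), ENNReal.ofReal ((p ^ n) ^ (2 * l)) * Γ :=
        Finset.sum_le_sum fun k hk => lintegral_gaussWeight_le (h (Finset.mem_range.1 hk)) hε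
          (by positivity) (pow_le_one₀ hp hp1)
    _ = ENNReal.ofReal ((2 * p ^ (2 * l)) ^ n) * Γ := by
        rw [Finset.sum_const, Finset.card_range, nsmul_eq_mul, ← mul_assoc, Nat.cast_pow,
          Nat.cast_ofNat, ← ENNReal.ofReal_ofNat, ← ENNReal.ofReal_pow zero_le_two,
          ← ENNReal.ofReal_mul (by positivity), mul_pow, pow_right_comm]
    _ ≤ ENNReal.ofReal ((1 / 2) ^ n) * Γ := by
        gcongr
        linarith

theorem lintegral_gaussSum_lt_top (h : DyadicGaussian P p ξ) (hε : 0 ≤ ε) (hp : 0 ≤ p)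
    (hp1 : p ≤ 1) (hl : p ^ (2 * l) ≤ 1 / 4)
    (hΓ : ∫⁻ u, ENNReal.ofReal (gaussWeight ε l u) ∂(gaussianReal 0 1) < ∞) :
    ∫⁻ ω, gaussSum ε l ξ ω ∂P < ∞ := by
  have hgeom : ∑' n : ℕ, ENNReal.ofReal ((1 / 2) ^ n) < ∞ := by
    rw [← ENNReal.ofReal_tsum_of_nonneg (fun n => by positivity) summable_geometric_two]
    exact ENNReal.ofReal_lt_top
  unfold gaussSum
  rw [lintegral_tsum fun n => Finset.aemeasurable_fun_sum _ (h.aemeasurable_gaussWeight n)]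
  refine (ENNReal.tsum_le_tsum (h.lintegral_level_le hε hp hp1 hl)).trans_lt ?_
  rw [ENNReal.tsum_mul_right]
  exact ENNReal.mul_lt_top hgeom hΓ

end DyadicGaussian

end GaussianTails

section FractionalBrownianMotion

variable {Ω : Type*} {H T ν : ℝ} {W : ℝ → Ω → ℝ}

/-- The increments of `W` over the dyadic intervals of `[0, T]`, normalized so that all of them are
bounded by `K` exactly if `W` satisfies the dyadic bound of order `ν` with constant `T ^ H * K`. -/
def normalizedIncrement (H T ν : ℝ) (W : ℝ → Ω → ℝ) (n k : ℕ) (ω : Ω) : ℝ :=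
  (T ^ H * (2 ^ (-ν)) ^ n)⁻¹ * (W (dyadicPoint 0 T n (k + 1)) ω - W (dyadicPoint 0 T n k) ω)

theorem dyadicBound_of_normalizedIncrement_le (hT : 0 < T) {K : ℝ} {ω : Ω}
    (h : ∀ ⦃n k : ℕ⦄, k < 2 ^ n → |normalizedIncrement H T ν W n k ω| ≤ K) :
    DyadicBound (T ^ H * K) (2 ^ (-ν)) 0 T (fun t => W t ω) := by
  intro n k hk
  have hle := h hk
  rw [normalizedIncrement, abs_mul, abs_of_pos (by positivity),
    inv_mul_le_iff₀ (by positivity)] at hle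
  exact hle.trans_eq (by ring)

variable [MeasurableSpace Ω] {P : Measure Ω}

namespace IsFractionalBrownianMotion

theorem integral_sub_sq (hW : IsFractionalBrownianMotion P H T W) (hH : 0 < H) {s t : ℝ}
    (hs : s ∈ Icc 0 T) (ht : t ∈ Icc 0 T) :
    ∫ ω, (W t ω - W s ω) ^ 2 ∂P = |t - s| ^ (2 * H) := by
  have hmem : ∀ u ∈ Icc 0 T, MemLp (W u) 2 P := fun u hu =>
    (hW.gaussian.hasGaussianLaw_eval ⟨u, hu⟩).memLp_two
  have hint : ∀ u ∈ Icc 0 T, ∀ v ∈ Icc 0 T, Integrable (fun ω => W u ω * W v ω) P :=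
    fun u hu v hv => (hmem u hu).integrable_mul (hmem v hv)
  have hexpand : (fun ω => (W t ω - W s ω) ^ 2) =
      fun ω => (W t ω * W t ω - 2 * (W s ω * W t ω)) + W s ω * W s ω := by
    funext ω; ring
  have hcross := (hint s hs t ht).const_mul 2
  have hdiff : Integrable (fun ω => W t ω * W t ω - 2 * (W s ω * W t ω)) P :=
    (hint t ht t ht).sub hcross
  rw [hexpand, integral_add hdiff (hint s hs s hs),
    integral_sub (hint t ht t ht) hcross, integral_const_mul, hW.covariance t ht t ht,
    hW.covariance s hs t ht, hW.covariance s hs s hs, sub_self, sub_self, abs_zero,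
    Real.zero_rpow (by positivity)]
  ring

theorem hasLaw_const_mul_sub (hW : IsFractionalBrownianMotion P H T W) (hH : 0 < H) {s t : ℝ}
    (hs : s ∈ Icc 0 T) (ht : t ∈ Icc 0 T) (c : ℝ) :
    HasLaw (fun ω => c * (W t ω - W s ω)) ((gaussianReal 0 1).map (c * |t - s| ^ H * ·)) P := by
  have hgauss : HasGaussianLaw (fun ω => W t ω - W s ω) P :=
    hW.gaussian.hasGaussianLaw_fun_sub (s := ⟨t, ht⟩) (t := ⟨s, hs⟩)
  have hmean : ∫ ω, W t ω - W s ω ∂P = 0 := by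
    rw [integral_sub (hW.gaussian.hasGaussianLaw_eval ⟨t, ht⟩).integrable
      (hW.gaussian.hasGaussianLaw_eval ⟨s, hs⟩).integrable, hW.mean_zero t ht, hW.mean_zero s hs,
      sub_zero]
  have hmean' : ∫ ω, c * (W t ω - W s ω) ∂P = 0 := by rw [integral_const_mul, hmean, mul_zero]
  have hvar : Var[fun ω => c * (W t ω - W s ω); P] = (c * |t - s| ^ H) ^ 2 := by
    rw [variance_const_mul, variance_of_integral_eq_zero hgauss.aemeasurable hmean,
      hW.integral_sub_sq hH hs ht, mul_pow, mul_comm 2 H, Real.rpow_mul (abs_nonneg _),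
      Real.rpow_two]
  have hgauss' : HasGaussianLaw (fun ω => c * (W t ω - W s ω)) P := hgauss.fun_smul c
  refine ⟨hgauss'.aemeasurable, ?_⟩
  rw [hgauss'.map_eq_gaussianReal, gaussianReal_map_const_mul, hmean', hvar, mul_zero,
    mul_one]
  congr 1
  exact Real.toNNReal_of_nonneg (sq_nonneg _)

theorem dyadicGaussian (hW : IsFractionalBrownianMotion P H T W) (hT : 0 < T) (hH : 0 < H)
    (ν : ℝ) : DyadicGaussian P (2 ^ (-(H - ν))) (normalizedIncrement H T ν W) := by
  intro n k hk
  have hlaw := hW.hasLaw_const_mul_sub hH (dyadicPoint_mem_Icc hT.le hk.le)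
    (dyadicPoint_mem_Icc hT.le (Nat.succ_le_of_lt hk)) (T ^ H * (2 ^ (-ν)) ^ n)⁻¹
  have hscale : (T ^ H * ((2 : ℝ) ^ (-ν)) ^ n)⁻¹ *
      |dyadicPoint 0 T n (k + 1) - dyadicPoint 0 T n k| ^ H = (2 ^ (-(H - ν))) ^ n := by
    rw [dyadicPoint_succ_sub, sub_zero, abs_of_nonneg (by positivity), div_two_pow_rpow hT.le,
      show -H = -ν + -(H - ν) by ring, Real.rpow_add two_pos, mul_pow]
    field_simp
  rwa [Nat.succ_eq_add_one, hscale] at hlaw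

/-- The Hölder constants of the paths have Gaussian tails: they can be chosen so that `exp (ε G²)`
is dominated by an integrable function, with the same `ε` for all `W`. -/
theorem exists_integrable_holderBound (P : Measure Ω) (hT : 0 < T) (hH : 0 < H) (hν : 0 < ν)
    (hνH : ν < H) :
    ∃ ε : ℝ, 0 < ε ∧ ∀ W : ℝ → Ω → ℝ, IsFractionalBrownianMotion P H T W →
      ∃ S : Ω → ℝ≥0∞, AEMeasurable S P ∧ ∫⁻ ω, S ω ∂P < ∞ ∧ ∀ᵐ ω ∂P, ∃ G : ℝ, 0 ≤ G ∧
        HolderBound G ν (Icc 0 T) (fun t => W t ω) ∧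
        ENNReal.ofReal (Real.exp (ε * G ^ 2)) ≤ S ω := by
  obtain ⟨ε, hε, hΓ⟩ := exists_lintegral_gaussWeight_lt_top
  set p : ℝ := 2 ^ (-(H - ν))
  have hp : 0 ≤ p := by positivity
  have hp1 : p < 1 := two_rpow_neg_lt_one (sub_pos.2 hνH)
  obtain ⟨l, hl⟩ := exists_pow_lt_of_lt_one (show (0 : ℝ) < 1 / 4 by norm_num) hp1
  have hl' : p ^ (2 * l) ≤ 1 / 4 :=
    (pow_le_pow_of_le_one hp hp1.le (by omega : l ≤ 2 * l)).trans hl.le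
  set D : ℝ := chainingConst ν T * T ^ H
  have hD : 0 < D := mul_pos (chainingConst_pos hν hT) (by positivity)
  refine ⟨ε / D ^ 2, by positivity, fun W hW => ?_⟩
  have := hW.gaussian.isProbabilityMeasure
  have hξ := hW.dyadicGaussian hT hH ν
  have hmeas := hξ.aemeasurable_gaussSum (ε := ε) (l := l)
  have hfin := hξ.lintegral_gaussSum_lt_top hε.le hp hp1.le hl' (hΓ l)
  refine ⟨fun ω => ENNReal.ofReal (Real.exp ε) + gaussSum ε l (normalizedIncrement H T ν W) ω,
    hmeas.const_add _, ?_, ?_⟩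
  · rw [lintegral_add_left measurable_const, lintegral_const, measure_univ, mul_one]
    exact ENNReal.add_lt_top.2 ⟨ENNReal.ofReal_lt_top, hfin⟩
  · filter_upwards [ae_lt_top' hmeas hfin.ne, hW.continuous] with ω hω hcont
    obtain ⟨K, hK, hle, hexp⟩ := exists_bound_of_gaussSum_lt_top hε hω
    have hholder := (dyadicBound_of_normalizedIncrement_le hT hle).holderBound hcont hT
      (by positivity) hν
    refine ⟨D * K, by positivity, hholder.weaken (by rw [sub_zero, ← mul_assoc]), ?_⟩
    rwa [show ε / D ^ 2 * (D * K) ^ 2 = ε * K ^ 2 by field_simp]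

end IsFractionalBrownianMotion

end FractionalBrownianMotion

section DelayLimit

theorem exists_comparisonExponents {H θ δ : ℝ} (hH : H < 1) (hθ : 1 - H < θ) (hθ2 : θ ≤ 1 / 2)
    (hδ : 1 / H - 1 < δ) : ∃ ν κ, ν < H ∧ κ < θ ∧ ComparisonExponents κ θ δ ν := by
  have hH₀ : 0 < H := by linarith
  have hδ₀ : 0 < δ := by linarith [(one_lt_div hH₀).2 hH]
  have hδH : 1 / (1 + δ) < H := by
    rw [one_div_lt (by linarith) hH₀]
    linarith
  obtain ⟨ν, hν, hνH⟩ := exists_between (max_lt (by linarith : 1 - θ < H) hδH)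
  have hνθ : 1 - θ < ν := (le_max_left _ _).trans_lt hν
  have hνδ : 1 - ν < ν * δ := by
    have := (div_lt_iff₀ (by linarith)).1 ((le_max_right _ _).trans_lt hν)
    linarith
  obtain ⟨κ, hκ, hκθδ⟩ := exists_between (lt_min (by linarith : 1 - ν < θ) hνδ)
  have hκθ := hκθδ.trans_le (min_le_left _ _)
  exact ⟨ν, κ, hνH, hκθ, {
    le_half := hθ2
    le_one := by linarith
    one_lt := by linarith
    pos := by linarith
    le_left := hκθ.le
    le_mul := (hκθδ.trans_le (min_le_right _ _)).le
    one_lt_add := by linarith }⟩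

section Bounds

variable {E : Type*} [NormedAddCommGroup E] {m : ℕ} {T θ M R r ν G : ℝ} {b : ℝ → E → E}
  {σ : ℝ → E → Fin m → E} {b₀ : ℝ → ℝ} {g : Fin m → ℝ → ℝ} {x y : ℝ → E}

theorem RegularPath.wNorm_sub_le {α : ℝ} (hα2 : α < 1 / 2) (hR : 0 ≤ R) (hr : 0 ≤ r)
    (hx : RegularPath T 0 θ R x) (hy : RegularPath T r θ R y) :
    wNorm α 0 T (fun t => x t - y t) ≤
      ENNReal.ofReal (R * (2 * (1 + T ^ (1 / 2 - α) / (1 / 2 - α)))) := by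
  refine (wNorm_le_of_holderBound (a := 2 * R) (B := 2 * R) hα2 (by positivity) (fun t ht => ?_)
    fun s hs t ht hst => ?_).trans (le_of_eq (by ring_nf))
  · linarith [norm_sub_le (x t) (y t), hx.normLe.norm_le t ⟨by linarith [ht.1], ht.2⟩,
      hy.normLe.norm_le t ⟨by linarith [ht.1], ht.2⟩]
  · rw [sub_sub_sub_comm]
    linarith [norm_sub_le (x t - x s) (y t - y s), hx.half hs ht hst, hy.half hs ht hst]

variable [NormedSpace ℝ E]

theorem DelayPath.regularPath (hx : DelayPath T r θ M b σ g x) (h : CoeffBounds T θ M b σ b₀)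
    (hr : 0 ≤ r) (hT : 0 ≤ T) (hp : YoungPair θ ν) (hg : HolderDriver T ν G g) :
    RegularPath T r θ (growthBound (halfConst m T θ ν M) ν G) x := by
  have hG := hg.nonneg
  have hC := one_le_aprioriConst m hT hp.one_lt h.one_le
  have hK := halfFactor_nonneg m hT hp.one_lt h.const_nonneg
  have hapriori := hx.holderNormLe h hr hT hp hg
  have hle : growthBound (aprioriConst m T θ ν M) ν G ≤ growthBound (halfConst m T θ ν M) ν G :=
    growthBound_mono (by linarith) (by unfold halfConst; nlinarith) (by linarith)
  exact ⟨⟨fun t ht => (hapriori.norm_le t ht).trans hle, hapriori.holder.weaken hle⟩,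
    hx.holderBound_half h hr hT hp hg⟩

end Bounds

variable {d m : ℕ} {b : ℝ → EuclideanSpace ℝ (Fin d) → EuclideanSpace ℝ (Fin d)}
  {σ : ℝ → EuclideanSpace ℝ (Fin d) → Fin m → EuclideanSpace ℝ (Fin d)}
  {η x : ℝ → EuclideanSpace ℝ (Fin d)} {g : Fin m → ℝ → ℝ} {T r₀ H α β δ ρ B : ℝ}

/-- The distances in `‖·‖_{α,∞}` from `x` to the solutions of the equations with delay `r ≤ r₀` are
bounded by `B` and tend to zero with `r`. -/
structure IsDelayLimit (α T r₀ B : ℝ)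
    (b : ℝ → EuclideanSpace ℝ (Fin d) → EuclideanSpace ℝ (Fin d))
    (σ : ℝ → EuclideanSpace ℝ (Fin d) → Fin m → EuclideanSpace ℝ (Fin d))
    (η : ℝ → EuclideanSpace ℝ (Fin d)) (g : Fin m → ℝ → ℝ)
    (x : ℝ → EuclideanSpace ℝ (Fin d)) : Prop where
  bound : ∀ r ∈ Ioc 0 r₀, ∀ y, IsDelaySolution α T r b σ η g y →
    wNorm α 0 T (fun t => x t - y t) ≤ ENNReal.ofReal B
  eventually_le : ∀ ε > 0, ∀ᶠ r in 𝓝[>] 0, ∀ y, IsDelaySolution α T r b σ η g y →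
    wNorm α 0 T (fun t => x t - y t) ≤ ENNReal.ofReal ε

theorem IsDelayLimit.tendsto_wNorm {ι : Type*} {l : Filter ι} {r : ι → ℝ}
    {y : ι → ℝ → EuclideanSpace ℝ (Fin d)} (h : IsDelayLimit α T r₀ B b σ η g x)
    (hr : Tendsto r l (𝓝[>] 0)) (hy : ∀ᶠ i in l, IsDelaySolution α T (r i) b σ η g (y i)) :
    Tendsto (fun i => wNorm α 0 T (fun t => x t - y i t)) l (𝓝 0) := by
  rw [ENNReal.tendsto_nhds_zero]
  intro ε hε
  rcases eq_or_ne ε ∞ with rfl | htop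
  · exact Eventually.of_forall fun _ => le_top
  · filter_upwards [hr.eventually (h.eventually_le _ (ENNReal.toReal_pos hε.ne' htop)), hy]
      with i hi hyi
    exact (hi _ hyi).trans_eq (ENNReal.ofReal_toReal htop)

theorem exists_delayPath_bounds {θ : ℝ} (hT : 0 < T) (hσ : HypH1 T β δ σ) (hb : HypH2' T ρ b)
    (hηC : MemHolder (1 - α) (-r₀) 0 η) (hr₀ : 0 ≤ r₀) (hα2 : α ≤ 1 / 2) (hθ : 0 < θ)
    (hθα : θ ≤ α) (hθβ : θ ≤ β) :
    ∃ (b₀ : ℝ → ℝ) (M : ℝ), CoeffBounds T θ M b σ b₀ ∧ ‖η 0‖ ≤ M ∧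
      ∀ r ∈ Ioc 0 r₀, ∀ g y, IsDelaySolution α T r b σ η g y → DelayPath T r θ M b σ g y := by
  obtain ⟨b₀, M₀, hM₀⟩ := exists_coeffBounds hT.le hσ hb hθ hθβ
  obtain ⟨K, hK, hηK⟩ := hηC.exists_holderNormLe (by linarith)
  refine ⟨b₀, max M₀ (K * (1 + r₀ ^ (1 - α - θ))), hM₀ _ (le_max_left _ _), ?_,
    fun r hr g y hy => hy.delayPath hT hr.1 hr.2 hα2 hθ hθα hK hηK (le_max_right _ _)⟩
  calc ‖η 0‖ ≤ K := hηK.norm_le 0 ⟨by linarith, le_rfl⟩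
    _ ≤ K * (1 + r₀ ^ (1 - α - θ)) :=
      le_mul_of_one_le_right hK (le_add_of_nonneg_right (by positivity))
    _ ≤ _ := le_max_right _ _

theorem exists_isDelayLimit (hT : 0 < T) (hr₀ : 0 < r₀) (hH : H < 1) (hσ : HypH1 T β δ σ)
    (hb : HypH2' T ρ b) (hβ : 1 - H < β) (hδ : 1 / H - 1 < δ) (hα : 1 - H < α)
    (hα2 : α < 1 / 2) (hηC : MemHolder (1 - α) (-r₀) 0 η) :
    ∃ ν C : ℝ, 1 / 2 < ν ∧ ν < H ∧ 0 ≤ C ∧ ∀ g G x, HolderDriver T ν G g →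
      IsSolution α T b σ (η 0) g x → IsDelayLimit α T r₀ (growthBound C ν G) b σ η g x := by
  set θ := min α β
  have hθα : θ ≤ α := min_le_left _ _
  have hθβ : θ ≤ β := min_le_right _ _
  have hθH : 1 - H < θ := lt_min hα hβ
  obtain ⟨ν, κ, hνH, hκθ, he⟩ := exists_comparisonExponents hH hθH (by linarith) hδ
  have hp := he.toYoungPair
  have hθ := hp.pos_left
  obtain ⟨b₀, M, hM, hηM, hdelay⟩ :=
    exists_delayPath_bounds hT hσ hb hηC hr₀.le hα2.le hθ hθα hθβ
  have hC : 0 ≤ halfConst m T θ ν M := by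
    have := one_le_aprioriConst m hT.le hp.one_lt hM.one_le
    have := halfFactor_nonneg m hT.le hp.one_lt hM.const_nonneg
    unfold halfConst
    positivity
  set C := halfConst m T θ ν M
  have : 0 < 1 / 2 - α := by linarith
  set K := 2 * (1 + T ^ (1 / 2 - α) / (1 / 2 - α))
  have hK : 0 ≤ K := by positivity
  refine ⟨ν, C * (K + 1), hp.half_lt_right, hνH, by positivity, fun g G x hg hx => ?_⟩
  have hG := hg.nonneg
  have hR : 0 ≤ growthBound C ν G := by unfold growthBound; positivity
  have hxp := hx.delayPath hT hM hθ hθα hp hg hηM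
  have hxR := hxp.regularPath hM le_rfl hT.le hp hg
  have hreg := fun r hr y hy => (hdelay r hr g y hy).regularPath hM hr.1.le hT.le hp hg
  refine ⟨fun r hr y hy => ?_, fun ε hε => ?_⟩
  · exact (hxR.wNorm_sub_le hα2 hR hr.1.le (hreg r hr y hy)).trans
      (ENNReal.ofReal_le_ofReal (growthBound_mul_le hC hK (by linarith)))
  · obtain ⟨M', hM'⟩ := exists_localBounds hT.le hσ hb hθ hθβ hR
    obtain ⟨r₁, hr₁, hclose⟩ :=
      exists_wNorm_sub_le hM hM' hT.le (by linarith) hα2 he hκθ hg hxp hR hxR hε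
    filter_upwards [Ioc_mem_nhdsGT hr₀, Ioo_mem_nhdsGT hr₁] with r hr hrr y hy
    exact hclose r y hr.1 hrr.2 (hdelay r hr g y hy) (hreg r hr y hy)
      ((hy.initial 0 ⟨by linarith [hr.1], le_rfl⟩).trans (hx.apply_zero hT.le).symm)

end DelayLimit

section Moments

theorem exists_mul_rpow_le_mul_sq {c q ε : ℝ} (hc : 0 ≤ c) (hq : 0 ≤ q) (hq2 : q < 2)
    (hε : 0 < ε) : ∃ A : ℝ, ∀ G : ℝ, 0 ≤ G → c * (1 + G) ^ q ≤ ε * G ^ 2 + A := by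
  set Y := (2 * c / ε) ^ (1 / (2 - q))
  have hq2' : 0 < 2 - q := by linarith
  have hY : 0 ≤ Y := by positivity
  have hA : 0 ≤ c * Y ^ q := by positivity
  refine ⟨ε + c * Y ^ q, fun G hG => ?_⟩
  have hsq : ε / 2 * (1 + G) ^ 2 ≤ ε * G ^ 2 + ε := by
    linarith [mul_nonneg hε.le (sq_nonneg (G - 1))]
  set y := 1 + G
  have hy : 0 < y := by positivity
  rcases le_total y Y with h | h
  · have : c * y ^ q ≤ c * Y ^ q := by gcongr
    have : 0 ≤ ε * G ^ 2 := by positivity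
    linarith
  · have hc_le : c ≤ ε / 2 * y ^ (2 - q) := by
      have : 2 * c / ε ≤ y ^ (2 - q) := by
        calc 2 * c / ε = Y ^ (2 - q) := by
              rw [← Real.rpow_mul (by positivity), one_div_mul_cancel hq2'.ne', Real.rpow_one]
          _ ≤ y ^ (2 - q) := Real.rpow_le_rpow hY h hq2'.le
      rw [div_le_iff₀ hε] at this
      linarith
    calc c * y ^ q ≤ ε / 2 * y ^ (2 - q) * y ^ q := by gcongr
      _ = ε / 2 * y ^ 2 := by
          rw [mul_assoc, ← Real.rpow_add hy, sub_add_cancel, Real.rpow_two]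
      _ ≤ ε * G ^ 2 + (ε + c * Y ^ q) := by linarith

theorem exists_ofReal_growthBound_rpow_le {C ν p ε : ℝ} (hC : 0 ≤ C) (hν : 1 / 2 < ν) (hp : 0 ≤ p)
    (hε : 0 < ε) : ∃ A : ℝ, ∀ G : ℝ, 0 ≤ G →
      ENNReal.ofReal (growthBound C ν G) ^ p ≤
        ENNReal.ofReal A * ENNReal.ofReal (Real.exp (ε * G ^ 2)) := by
  have hν₀ : 0 < ν := by linarith
  obtain ⟨A, hA⟩ := exists_mul_rpow_le_mul_sq (c := C * p) (q := 1 / ν) (by positivity)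
    (by positivity) (by rw [div_lt_iff₀ hν₀]; linarith) hε
  refine ⟨C ^ p * Real.exp A, fun G hG => ?_⟩
  unfold growthBound
  rw [ENNReal.ofReal_rpow_of_nonneg (by positivity) hp, ← ENNReal.ofReal_mul (by positivity)]
  refine ENNReal.ofReal_le_ofReal ?_
  rw [Real.mul_rpow hC (Real.exp_pos _).le, ← Real.exp_mul, mul_assoc (C ^ p), ← Real.exp_add]
  gcongr
  linarith [hA G hG]

variable {Ω : Type*} [MeasurableSpace Ω] {P : Measure Ω}

/-- The functions `F n` need not be measurable. -/
theorem tendsto_lintegral_zero_of_dominated {F : ℕ → Ω → ℝ≥0∞} (S : Ω → ℝ≥0∞)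
    (hS : ∫⁻ ω, S ω ∂P ≠ ∞) (hFS : ∀ᶠ n in atTop, ∀ᵐ ω ∂P, F n ω ≤ S ω)
    (hF : ∀ᵐ ω ∂P, Tendsto (fun n => F n ω) atTop (𝓝 0)) :
    Tendsto (fun n => ∫⁻ ω, F n ω ∂P) atTop (𝓝 0) := by
  choose f hfm hfF hf using fun n => exists_measurable_le_lintegral_eq P (F n)
  have hlim : Tendsto (fun n => ∫⁻ ω, f n ω ∂P) atTop (𝓝 (∫⁻ _, 0 ∂P)) :=
    tendsto_lintegral_filter_of_dominated_convergence S (Eventually.of_forall hfm)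
      (hFS.mono fun n hn => hn.mono fun ω hω => (hfF n ω).trans hω) hS
      (hF.mono fun ω hω => tendsto_of_tendsto_of_tendsto_of_le_of_le tendsto_const_nhds hω
        (fun _ => zero_le) fun n => hfF n ω)
  simpa only [hf, lintegral_zero] using hlim

theorem exists_integrable_holderDriver [IsFiniteMeasure P] {m : ℕ} {H T ν : ℝ} (hT : 0 < T)
    (hH : 0 < H) (hν : 0 < ν) (hνH : ν < H) {W : Fin m → ℝ → Ω → ℝ}
    (hW : ∀ j, IsFractionalBrownianMotion P H T (W j)) :
    ∃ (ε : ℝ) (S : Ω → ℝ≥0∞), 0 < ε ∧ ∫⁻ ω, S ω ∂P < ∞ ∧ ∀ᵐ ω ∂P, ∃ G : ℝ,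
      HolderDriver T ν G (fun j t => W j t ω) ∧ ENNReal.ofReal (Real.exp (ε * G ^ 2)) ≤ S ω := by
  obtain ⟨ε, hε, h⟩ :=
    IsFractionalBrownianMotion.exists_integrable_holderBound P hT hH hν hνH
  choose S hSm hSi hS using fun j => h (W j) (hW j)
  refine ⟨ε, fun ω => 1 + ∑ j, S j ω, hε, ?_, ?_⟩
  · rw [lintegral_add_left measurable_const, lintegral_finsetSum' _ fun j _ => hSm j,
      lintegral_const, one_mul]
    exact ENNReal.add_lt_top.2
      ⟨measure_lt_top P univ, ENNReal.sum_lt_top.2 fun j _ => hSi j⟩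
  · filter_upwards [ae_all_iff.2 hS] with ω hω
    choose G hG₀ hG hGS using hω
    rcases isEmpty_or_nonempty (Fin m) with he | hne
    · exact ⟨0, ⟨le_rfl, fun j => he.elim j⟩, by simp⟩
    · obtain ⟨i, -, hi⟩ := Finset.exists_max_image Finset.univ G Finset.univ_nonempty
      refine ⟨G i, ⟨hG₀ i, fun j => (hG j).weaken (hi j (Finset.mem_univ j))⟩, ?_⟩
      calc ENNReal.ofReal (Real.exp (ε * G i ^ 2)) ≤ S i ω := hGS i
        _ ≤ ∑ j, S j ω := Finset.single_le_sum (f := fun j => S j ω) (fun _ _ => zero_le)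
            (Finset.mem_univ i)
        _ ≤ 1 + ∑ j, S j ω := le_add_self

variable {d m : ℕ} {T r₀ H α β δ ρ p : ℝ} {W : Fin m → ℝ → Ω → ℝ}
  {b : ℝ → EuclideanSpace ℝ (Fin d) → EuclideanSpace ℝ (Fin d)}
  {σ : ℝ → EuclideanSpace ℝ (Fin d) → Fin m → EuclideanSpace ℝ (Fin d)}
  {η : ℝ → EuclideanSpace ℝ (Fin d)} {X : ℝ → Ω → EuclideanSpace ℝ (Fin d)}

theorem exists_integrable_isDelayLimit [IsFiniteMeasure P] (hT : 0 < T) (hr₀ : 0 < r₀)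
    (hH : H < 1) (hW : ∀ j, IsFractionalBrownianMotion P H T (W j)) (hσ : HypH1 T β δ σ)
    (hb : HypH2' T ρ b) (hβ : 1 - H < β) (hδ : 1 / H - 1 < δ) (hα : 1 - H < α)
    (hα2 : α < 1 / 2) (hηC : MemHolder (1 - α) (-r₀) 0 η)
    (hX : ∀ᵐ ω ∂P, IsSolution α T b σ (η 0) (fun j t => W j t ω) (fun t => X t ω)) (hp : 0 ≤ p) :
    ∃ S : Ω → ℝ≥0∞, ∫⁻ ω, S ω ∂P ≠ ∞ ∧ ∀ᵐ ω ∂P, ∃ B,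
      IsDelayLimit α T r₀ B b σ η (fun j t => W j t ω) (fun t => X t ω) ∧
      ENNReal.ofReal B ^ p ≤ S ω := by
  obtain ⟨ν, C, hν, hνH, hC, hlim⟩ := exists_isDelayLimit hT hr₀ hH hσ hb hβ hδ hα hα2 hηC
  obtain ⟨ε, S, hε, hS, hG⟩ :=
    exists_integrable_holderDriver hT (by linarith) (by linarith) hνH hW
  obtain ⟨A, hA⟩ := exists_ofReal_growthBound_rpow_le hC hν hp hε
  refine ⟨fun ω => ENNReal.ofReal A * S ω, ?_, ?_⟩
  · rw [lintegral_const_mul' _ _ ENNReal.ofReal_ne_top]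
    exact ENNReal.mul_ne_top ENNReal.ofReal_ne_top hS.ne
  · filter_upwards [hX, hG] with ω hXω ⟨G, hGω, hGS⟩
    refine ⟨_, hlim _ G _ hGω hXω, (hA G hGω.nonneg).trans ?_⟩
    gcongr

theorem tendsto_lintegral_wNorm_rpow {Xr : ℝ → ℝ → Ω → EuclideanSpace ℝ (Fin d)}
    {S : Ω → ℝ≥0∞} (hr₀ : 0 < r₀) (hp : 0 < p) (hS : ∫⁻ ω, S ω ∂P ≠ ∞)
    (hX : ∀ᵐ ω ∂P, ∃ B, IsDelayLimit α T r₀ B b σ η (fun j t => W j t ω) (fun t => X t ω) ∧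
      ENNReal.ofReal B ^ p ≤ S ω)
    (hXr : ∀ r ∈ Ioc 0 r₀, ∀ᵐ ω ∂P,
      IsDelaySolution α T r b σ η (fun j t => W j t ω) (fun t => Xr r t ω)) :
    Tendsto (fun r => ∫⁻ ω, (wNorm α 0 T (fun t => X t ω - Xr r t ω)) ^ p ∂P)
      (𝓝[>] 0) (𝓝 0) := by
  -- Along a sequence of delays the exceptional null sets have a null union.
  refine tendsto_of_seq_tendsto fun r hr => tendsto_lintegral_zero_of_dominated S hS ?_ ?_
  · filter_upwards [hr.eventually (Ioc_mem_nhdsGT hr₀)] with n hn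
    filter_upwards [hX, hXr (r n) hn] with ω ⟨B, hB, hBS⟩ hXrω
    exact (ENNReal.rpow_le_rpow (hB.bound (r n) hn _ hXrω) hp.le).trans hBS
  · have hall : ∀ᵐ ω ∂P, ∀ n, r n ∈ Ioc 0 r₀ →
        IsDelaySolution α T (r n) b σ η (fun j t => W j t ω) (fun t => Xr (r n) t ω) :=
      ae_all_iff.2 fun n => eventually_imp_distrib_left.2 (hXr (r n))
    filter_upwards [hX, hall] with ω ⟨B, hB, _⟩ hallω
    have hlim := hB.tendsto_wNorm hr ((hr.eventually (Ioc_mem_nhdsGT hr₀)).mono hallω)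
    simpa only [ENNReal.zero_rpow_of_pos hp, Function.comp_def] using
      (ENNReal.continuous_rpow_const (y := p)).tendsto 0 |>.comp hlim

end Moments

end

end DelayFBM

theorem theorem1p2_general {d m : ℕ} {Ω : Type*} [MeasurableSpace Ω] {P : Measure Ω}
    [IsProbabilityMeasure P] {T r₀ H α β δ ρ : ℝ} (hT : 0 < T) (hr₀ : 0 < r₀) (hH : H < 1)
    {W : Fin m → ℝ → Ω → ℝ} (hW : ∀ j, IsFractionalBrownianMotion P H T (W j))
    {b : ℝ → EuclideanSpace ℝ (Fin d) → EuclideanSpace ℝ (Fin d)}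
    {σ : ℝ → EuclideanSpace ℝ (Fin d) → Fin m → EuclideanSpace ℝ (Fin d)}
    {η : ℝ → EuclideanSpace ℝ (Fin d)} (hσ : HypH1 T β δ σ) (hb : HypH2' T ρ b)
    (hβ : 1 - H < β) (hδ : 1 / H - 1 < δ) (hα : 1 - H < α) (hα2 : α < 1 / 2)
    (hηC : MemHolder (1 - α) (-r₀) 0 η) {X : ℝ → Ω → EuclideanSpace ℝ (Fin d)}
    (hX : ∀ᵐ ω ∂P, IsSolution α T b σ (η 0) (fun j t => W j t ω) (fun t => X t ω))
    {Xr : ℝ → ℝ → Ω → EuclideanSpace ℝ (Fin d)}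
    (hXr : ∀ r ∈ Ioc 0 r₀, ∀ᵐ ω ∂P,
      IsDelaySolution α T r b σ η (fun j t => W j t ω) (fun t => Xr r t ω)) :
    ((∀ᵐ ω ∂P, ∀ r ∈ Ioc 0 r₀,
        IsDelaySolution α T r b σ η (fun j t => W j t ω) (fun t => Xr r t ω)) →
      ∀ᵐ ω ∂P, Tendsto (fun r => wNorm α 0 T (fun t => X t ω - Xr r t ω)) (𝓝[>] 0) (𝓝 0)) ∧
    ∀ p : ℝ, 0 < p →
      Tendsto (fun r => ∫⁻ ω, (wNorm α 0 T (fun t => X t ω - Xr r t ω)) ^ p ∂P)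
        (𝓝[>] 0) (𝓝 0) := by
  have hlim := fun p (hp : 0 ≤ p) =>
    exists_integrable_isDelayLimit hT hr₀ hH hW hσ hb hβ hδ hα hα2 hηC hX hp
  refine ⟨fun hall => ?_, fun p hp => ?_⟩
  · obtain ⟨_, _, hbound⟩ := hlim 1 zero_le_one
    filter_upwards [hbound, hall] with ω ⟨B, hB, _⟩ hallω
    exact hB.tendsto_wNorm tendsto_id (eventually_of_mem (Ioc_mem_nhdsGT hr₀) hallω)
  · obtain ⟨S, hS, hbound⟩ := hlim p hp.le
    exact tendsto_lintegral_wNorm_rpow hr₀ hp hS hbound hXr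

theorem theorem1p2 {d m : ℕ} {Ω : Type*} [MeasurableSpace Ω] (P : Measure Ω)
    [IsProbabilityMeasure P] (T r₀ H α β δ ρ : ℝ)
    (hT : 0 < T) (hr₀ : 0 < r₀) (hH : H ∈ Ioo (1 / 2 : ℝ) 1)
    -- the driving fractional Brownian motions
    (W : Fin m → ℝ → Ω → ℝ)
    (hW : ∀ j, IsFractionalBrownianMotion P H T (W j))
    (hWindep : iIndepFun (fun (j : Fin m) (ω : Ω) (t : Icc (0 : ℝ) T) => W j t ω) P)
    -- the coefficients and the initial path
    (b : ℝ → EuclideanSpace ℝ (Fin d) → EuclideanSpace ℝ (Fin d))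
    (σ : ℝ → EuclideanSpace ℝ (Fin d) → Fin m → EuclideanSpace ℝ (Fin d))
    (η : ℝ → EuclideanSpace ℝ (Fin d))
    (hσ : HypH1 T β δ σ) (hb : HypH2' T ρ b)
    (hβ : 1 - H < β) (hδ : 1 / H - 1 < δ) (hα : 1 - H < α) (hρ : ρ ≤ 1 / α)
    (hηW : MemW α (-r₀) 0 η) (hηC : MemHolder (1 - α) (-r₀) 0 η)
    -- the solution of the equation without delay
    (X : ℝ → Ω → EuclideanSpace ℝ (Fin d))
    (hXmeas : ∀ t ∈ Icc 0 T, AEMeasurable (X t) P)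
    (hX : ∀ᵐ ω ∂P, IsSolution α T b σ (η 0) (fun j t => W j t ω) (fun t => X t ω))
    -- the solutions of the delay equations
    (Xr : ℝ → ℝ → Ω → EuclideanSpace ℝ (Fin d))
    (hXrmeas : ∀ r ∈ Ioc 0 r₀, ∀ t ∈ Icc (-r) T, AEMeasurable (Xr r t) P)
    (hXr : ∀ r ∈ Ioc 0 r₀, ∀ᵐ ω ∂P,
      IsDelaySolution α T r b σ η (fun j t => W j t ω) (fun t => Xr r t ω)) :
    -- almost sure convergence, the paths `Xr r · ω` being solutions for all `r` simultaneously
    (α < min (1 / 2) (min β (δ / (1 + δ))) →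
      (∀ᵐ ω ∂P, ∀ r ∈ Ioc 0 r₀,
        IsDelaySolution α T r b σ η (fun j t => W j t ω) (fun t => Xr r t ω)) →
      ∀ᵐ ω ∂P, Tendsto (fun r => wNorm α 0 T (fun t => X t ω - Xr r t ω)) (𝓝[>] 0) (𝓝 0)) ∧
    -- convergence in `L^p`
    (∀ γ : ℝ, HypH3 T γ σ →
      α < max (min (1 / 2) (min β (δ / (1 + δ)))) ((2 - γ) / 4) →
      ∀ p : ℝ, 1 ≤ p →
        Tendsto (fun r => ∫⁻ ω, (wNorm α 0 T (fun t => X t ω - Xr r t ω)) ^ p ∂P)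
          (𝓝[>] 0) (𝓝 0)) := by
  have general := fun hα2 =>
    theorem1p2_general hT hr₀ hH.2 hW hσ hb hβ hδ hα hα2 hηC hX hXr
  refine ⟨fun hα₁ => (general (hα₁.trans_le (min_le_left _ _))).1, fun γ hγ hα₁ p hp => ?_⟩
  have hγ2 : (2 - γ) / 4 ≤ 1 / 2 := by linarith [hγ.1.1]
  exact (general (hα₁.trans_le (max_le (min_le_left _ _) hγ2))).2 p (by linarith)
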